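/- Let $U\subseteq\mathbb R^2$ be open and let $X:U\times\mathbb R/\mathbb Z\to\mathbb R^2$ be a smooth 1-periodic vector field (for a smooth field on the closed disc $\mathbb D^2$ that is tangent to $\partial\mathbb D^2$, take $U=\operatorname{int}\mathbb D^2$ for integral curves in the interior, or a neighbourhood of $\mathbb D^2$ to which the field has been smoothly extended). Write $C^k=C^k(\mathbb R/\mathbb Z;\mathbb R^2)$, with the $C^1$-norm $\max(\sup|x|,\sup|x'|)$ on $C^1$, and for $x\in C^1$ with values in $U$ put $\mathscr E(x)=\frac{dx}{dt}-X(x(t),t)\in C^0$. A closed integral curve is an $x\in C^1$ with values in $U$ and $\mathscr E(x)=0$. It is non-degenerate if the derivative $D\mathscr E(x):C^1\to C^0$ is an isomorphism, and isolated if some $C^1$-ball about $x$ contains no other closed integral curve. Let $x$ be a closed integral curve. Call $(M,\Theta,\epsilon)$ admissible for $x$ if - $\epsilon>0$ is so small that the closed ball $\overline{B_\epsilon(x)}\subset C^1$ consists of loops with values in $U$ and $x$ is the only zero of $\mathscr E$ in it; - $M:C^0\to C^1$ is a linear isomorphism (bounded with bounded inverse) such that $\Phi_M:=M\mathscr E$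 is of the form $\mathrm{Id}-K_M$ with $K_M$ compact (continuous with relatively compact image) on $\overline{B_\epsilon(x)}$; - $\Theta$ is a real $2\times2$ matrix with no eigenvalue in $2\pi i\mathbb Z$. Let $\beta_M(\Theta)$ be the number of negative (real) eigenvalues of the operator $M\frac{d}{dt}-M\Theta$ on $C^1$, counted with algebraic multiplicity, and put $$\iota(x;M,\Theta,\epsilon)=-\operatorname{sgn}(\det\Theta)\,(-1)^{\beta_M(\Theta)}\,\deg_{LS}\bigl(\Phi_M,B_\epsilon(x),0\bigr),$$ where $\deg_{LS}$ is the Leray–Schauder degree. Then: 1. If $x$ is non-degenerate, then $x$ is isolated. 2. If $x$ is isolated, its index is well defined: for every admissible $(M,\Theta,\epsilon)$ the map $\Phi_M$ is an admissible map for the Leray–Schauder degree on $B_\epsilon(x)$ at $0$ (in particular it has no zero on $\partial B_\epsilon(x)$), and $M\frac{d}{dt}-M\Theta$ has only finitely many negative eigenvalues, each of finite algebraic multiplicity; admissible triples exist; and the integer $\iota(x):=\iota(x;M,\Theta,\epsilon)$ is the same for all of them. That is, it does not depend on the choice of the parametrix $M$, of the matrix $\Theta$, or of the radius $\epsilon$.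 -/

import Mathlib

open Set Metric Topology
open scoped ContDiff

noncomputable section

namespace CurveIndex

/-! ### Brouwer and Leray-Schauder degree -/

/-- Signed count of the solutions of `g z = y` in `Ω`: the sum of the signs of the Jacobian
determinants. -/
def signedCount {F : Type*} [NormedAddCommGroup F] [NormedSpace ℝ F]
    (g : F → F) (Ω : Set F) (y : F) : ℤ :=
  ∑ᶠ z ∈ {z : F | z ∈ Ω ∧ g z = y}, ((SignType.sign (fderiv ℝ g z).det : SignType) : ℤ)

/-- `g` is a smooth map with regular value `y` in `Ω`, and on the closure of `Ω` it is closer to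
`f` than the distance `dist (y, f (∂Ω))`. -/
structure IsRegularApprox {F : Type*} [NormedAddCommGroup F] [NormedSpace ℝ F]
    (f : F → F) (Ω : Set F) (y : F) (g : F → F) : Prop where
  smooth : ContDiff ℝ ∞ g
  close : ∃ r : ℝ, (∀ w ∈ frontier Ω, r ≤ ‖f w - y‖) ∧ ∀ z ∈ closure Ω, ‖f z - g z‖ < r
  regular : ∀ z ∈ Ω, g z = y → (fderiv ℝ g z).det ≠ 0

open Classical in
/-- The Brouwer degree `deg (f, Ω, y)` in a finite-dimensional space, for `Ω` bounded and open,
`f` continuous on the closure of `Ω` and `y ∉ f (∂Ω)`: the signed count of the solutions of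
`g z = y` for a smooth approximation `g` of `f` with regular value `y`. -/
def brouwerDegree {F : Type*} [NormedAddCommGroup F] [NormedSpace ℝ F]
    (f : F → F) (Ω : Set F) (y : F) : ℤ :=
  if h : ∃ g : F → F, IsRegularApprox f Ω y g then signedCount h.choose Ω y else 0

/-- `K` is a compact (nonlinear) map on `S`: continuous, with relatively compact image. -/
def IsCompactMapOn {V W : Type*} [TopologicalSpace V] [TopologicalSpace W]
    (K : V → W) (S : Set V) : Prop :=
  ContinuousOn K S ∧ IsCompact (closure (K '' S))

/-- `Φ` is of the form `identity + compact` on `S`. -/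
def IsIdAddCompactOn {V : Type*} [NormedAddCommGroup V] (Φ : V → V) (S : Set V) : Prop :=
  IsCompactMapOn (fun z => z - Φ z) S

/-- The hypotheses under which the Leray-Schauder degree `deg_LS (Φ, Ω, y)` is defined. -/
structure IsLSAdmissible {V : Type*} [NormedAddCommGroup V] [NormedSpace ℝ V]
    (Φ : V → V) (Ω : Set V) (y : V) : Prop where
  isOpen : IsOpen Ω
  bounded : Bornology.IsBounded Ω
  compact : IsIdAddCompactOn Φ (closure Ω)
  boundary : ∀ w ∈ frontier Ω, Φ w ≠ y

/-- A finite-dimensional approximation of `Φ = id - K` on `Ω`: a finite-dimensional subspace `F`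
containing `y` and a continuous map `k : closure Ω → F` that is closer to `K` than
`dist (y, Φ (∂Ω))`. -/
structure FiniteDimApprox {V : Type*} [NormedAddCommGroup V] [NormedSpace ℝ V]
    (Φ : V → V) (Ω : Set V) (y : V) where
  F : Submodule ℝ V
  finiteDimensional : FiniteDimensional ℝ F
  point : F
  point_eq : (point : V) = y
  k : V → F
  continuousOn : ContinuousOn k (closure Ω)
  close : ∃ r : ℝ, (∀ w ∈ frontier Ω, r ≤ ‖Φ w - y‖) ∧
    ∀ z ∈ closure Ω, ‖(z - Φ z) - (k z : V)‖ < r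

/-- The degree of an approximation: the Brouwer degree of `id - k` on `Ω ∩ F`. -/
def FiniteDimApprox.degree {V : Type*} [NormedAddCommGroup V] [NormedSpace ℝ V]
    {Φ : V → V} {Ω : Set V} {y : V} (A : FiniteDimApprox Φ Ω y) : ℤ :=
  brouwerDegree (fun z : A.F => z - A.k (z : V)) {z : A.F | (z : V) ∈ Ω} A.point

open Classical in
/-- The Leray-Schauder degree `deg_LS (Φ, Ω, y)`, for data as in `IsLSAdmissible`. -/
def lsDegree {V : Type*} [NormedAddCommGroup V] [NormedSpace ℝ V]
    (Φ : V → V) (Ω : Set V) (y : V) : ℤ :=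
  if h : Nonempty (FiniteDimApprox Φ Ω y) then h.some.degree else 0

/-! ### Morse index -/

/-- The number of negative eigenvalues of `A`, counted with (algebraic) multiplicity. -/
def morseIndex {V : Type*} [NormedAddCommGroup V] [NormedSpace ℝ V] (A : V →L[ℝ] V) : ℕ :=
  ∑ᶠ l ∈ Iio (0 : ℝ), Module.finrank ℝ (Module.End.maxGenEigenspace (A : V →ₗ[ℝ] V) l)

/-- There are finitely many negative eigenvalues, all of finite multiplicity. -/
def HasFiniteMorseIndex {V : Type*} [NormedAddCommGroup V] [NormedSpace ℝ V]
    (A : V →L[ℝ] V) : Prop :=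
  {l : ℝ | l < 0 ∧ Module.End.HasEigenvalue (A : V →ₗ[ℝ] V) l}.Finite ∧
    ∀ l : ℝ, l < 0 →
      FiniteDimensional ℝ (Module.End.maxGenEigenspace (A : V →ₗ[ℝ] V) l)

/-! ### Loops in the plane -/

/-- The Euclidean plane. -/
abbrev Plane : Type := EuclideanSpace ℝ (Fin 2)

/-- `C⁰(ℝ/ℤ)`, continuous loops in the plane with the supremum norm. -/
abbrev C0 : Type := C(UnitAddCircle, Plane)

/-- The pairs `(x, x')` of continuous loops such that `x'` is the derivative of `x`. -/
def C1Pairs : Submodule ℝ (C0 × C0) where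
  carrier := {p | ∀ t : ℝ,
    HasDerivAt (fun s : ℝ => p.1 (s : UnitAddCircle)) (p.2 (t : UnitAddCircle)) t}
  add_mem' hp hq t := (hp t).add (hq t)
  zero_mem' t := hasDerivAt_const t 0
  smul_mem' c _ hp t := (hp t).const_smul c

/-- `C¹(ℝ/ℤ)`, as the space of pairs `(x, x')`, with the norm `max (sup |x|) (sup |x'|)`. -/
def C1 : Type := C1Pairs

instance : NormedAddCommGroup C1 := inferInstanceAs (NormedAddCommGroup C1Pairs)

instance : NormedSpace ℝ C1 := inferInstanceAs (NormedSpace ℝ C1Pairs)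

/-- The inclusion `C¹ → C⁰`. -/
def incl : C1 →L[ℝ] C0 where
  toFun x := x.1.1
  map_add' _ _ := rfl
  map_smul' _ _ := rfl
  cont := continuous_fst.comp (continuous_subtype_val (p := fun p : C0 × C0 => p ∈ C1Pairs))

/-- The derivative `d/dt : C¹ → C⁰`. -/
def ddt : C1 →L[ℝ] C0 where
  toFun x := x.1.2
  map_add' _ _ := rfl
  map_smul' _ _ := rfl
  cont := continuous_snd.comp (continuous_subtype_val (p := fun p : C0 × C0 => p ∈ C1Pairs))

/-- A smooth time-dependent 1-periodic vector field on `U ⊆ ℝ²`. Its values outside `U` are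
irrelevant. -/
def IsSmoothField (U : Set Plane) (X : Plane → UnitAddCircle → Plane) : Prop :=
  ContDiffOn ℝ ∞ (fun p : Plane × ℝ => X p.1 (p.2 : UnitAddCircle)) (U ×ˢ univ)

/-- The loop `x` takes values in `U`. -/
def StaysIn (U : Set Plane) (x : C1) : Prop := ∀ t : UnitAddCircle, incl x t ∈ U

open Classical in
/-- The loop `t ↦ X (x (t), t)`. It is continuous when `X` is a smooth field on `U` and `x` stays
in `U`; otherwise `0` is a placeholder. -/
def alongLoop (X : Plane → UnitAddCircle → Plane) (x : C1) : C0 :=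
  if h : Continuous (fun t : UnitAddCircle => X (incl x t) t) then ⟨_, h⟩ else 0

/-- The map `ℰ (x) = dx/dt - X (x, t)` from `C¹` to `C⁰`. -/
def defect (X : Plane → UnitAddCircle → Plane) (x : C1) : C0 := ddt x - alongLoop X x

/-- `x` is a closed integral curve (of period 1) of the vector field `X` on `U`. -/
def IsClosedIntegralCurve (U : Set Plane) (X : Plane → UnitAddCircle → Plane) (x : C1) : Prop :=
  StaysIn U x ∧ defect X x = 0

/-- `x` is non-degenerate: the linearization `C¹ → C⁰` of `ℰ` at `x` is an isomorphism. -/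
def IsNondegenerate (X : Plane → UnitAddCircle → Plane) (x : C1) : Prop :=
  (fderiv ℝ (defect X) x).IsInvertible

/-- `x` is the only closed integral curve of `X` in some `C¹`-ball about `x`. -/
def IsIsolated (U : Set Plane) (X : Plane → UnitAddCircle → Plane) (x : C1) : Prop :=
  ∃ ε : ℝ, 0 < ε ∧ ∀ y ∈ ball x ε, IsClosedIntegralCurve U X y → y = x

/-- The radius `ε` is small enough for `x`: the closed `ε`-ball about `x` consists of loops in `U`
and contains no closed integral curve of `X` other than `x`. -/
def IsIsolatingRadius (U : Set Plane) (X : Plane → UnitAddCircle → Plane) (x : C1) (ε : ℝ) :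
    Prop :=
  0 < ε ∧ ∀ y ∈ closedBall x ε, StaysIn U y ∧ (defect X y = 0 → y = x)

/-- The map `Φ_M = M ∘ ℰ` on `C¹`. -/
def parametrixMap (X : Plane → UnitAddCircle → Plane) (M : C0 ≃L[ℝ] C1) (x : C1) : C1 :=
  M (defect X x)

/-- The matrix `Θ` has no eigenvalue of the form `2πki` with `k ∈ ℤ`. -/
def IsAdmissibleMatrix (Θ : Matrix (Fin 2) (Fin 2) ℝ) : Prop :=
  ∀ k : ℤ, (2 * Real.pi * k * Complex.I : ℂ) ∉ spectrum ℂ (Θ.map (algebraMap ℝ ℂ))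

/-- Pointwise multiplication of a loop with the matrix `Θ`. -/
def matrixMul (Θ : Matrix (Fin 2) (Fin 2) ℝ) : C0 →L[ℝ] C0 :=
  (Matrix.toEuclideanCLM (𝕜 := ℝ) Θ).compLeftContinuous ℝ UnitAddCircle

/-- The operator `M d/dt - M Θ` on `C¹`. -/
def linearModel (M : C0 ≃L[ℝ] C1) (Θ : Matrix (Fin 2) (Fin 2) ℝ) : C1 →L[ℝ] C1 :=
  (M : C0 →L[ℝ] C1).comp
    (ddt - (matrixMul Θ).comp incl)

/-- `(M, Θ, ε)` is an admissible choice for computing the index of `x`: `ε` is small enough,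
`Φ_M` is of the form `identity + compact` on the closed `ε`-ball, and `Θ` is admissible. -/
structure IsAdmissibleChoice (U : Set Plane) (X : Plane → UnitAddCircle → Plane) (x : C1)
    (M : C0 ≃L[ℝ] C1) (Θ : Matrix (Fin 2) (Fin 2) ℝ) (ε : ℝ) : Prop where
  radius : IsIsolatingRadius U X x ε
  parametrix : IsIdAddCompactOn (parametrixMap X M) (closedBall x ε)
  matrix : IsAdmissibleMatrix Θ

/-- The index computed from the choice `(M, Θ, ε)`:
`- sgn (det Θ) (-1) ^ β_M(Θ) deg_LS (Φ_M, B_ε(x), 0)`. -/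
def index (X : Plane → UnitAddCircle → Plane) (x : C1)
    (M : C0 ≃L[ℝ] C1) (Θ : Matrix (Fin 2) (Fin 2) ℝ) (ε : ℝ) : ℤ :=
  -((SignType.sign Θ.det : SignType) : ℤ) *
    (-1) ^ morseIndex (V := C1) (linearModel M Θ) *
    lsDegree (parametrixMap X M) (ball x ε) 0

end CurveIndex

end

/-!
The index of a closed integral curve is the same for all admissible choices because every
ingredient is compared with one reference parametrix `J`, the inverse of `x ↦ x' + (mean of x)`.

**Degree theory.** For a smooth map `g` and a bump function `φ` concentrated near the value `y`,
the integral of `φ (g z - y) det (Dg z)` is unchanged by homotopies that avoid `y` on the boundary,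
because the cofactor fields of a Jacobian matrix are divergence free (`sum_fderiv_det_update`,
`degreeIntegral_add_eq`); for a regular value it equals the signed count of the solutions
(`degreeIntegral_eq_signedCount`). With Sard's theorem this shows that the Brouwer degree does not
depend on the approximation that is chosen in its definition (`IsRegularApprox.brouwerDegree_eq`),
and yields its homotopy invariance, excision, multiplication by the sign of the determinant under
linear isomorphisms, and reduction to subspaces that contain the range of `id - f`. These pass to
the Leray-Schauder degree through approximations of finite rank (`FiniteDimApprox.lsDegree_eq`).

**Morse index.** If `A` is an injective compact perturbation of the identity, then the sum of the
generalized eigenspaces for negative eigenvalues is finite-dimensional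
(`finiteDimensional_negSpace`), and `A` can be deformed through injective compact perturbations of
the identity to an operator that equals `A` on this sum and the identity on a complement. Hence
composition with `A` multiplies the degree by `(-1) ^ morseIndex A` (`lsDegree_linear_comp`). In
particular the parity of the Morse index is multiplicative, and constant along paths of injective
operators.

**The index.** Write `M = S J`. If `Φ_M` is of the form identity plus compact, then so is `M d/dt`,
because the nonlinear term is compact by the Arzelà-Ascoli theorem, and hence so is `S`. Therefore
`deg Φ_M` is `(-1) ^ β(S)` times `deg Φ_J`, and `(-1) ^ β_M(Θ)` is `(-1) ^ β(S)` times
`(-1) ^ β_J(Θ)`. Finally `(-1) ^ β_J(Θ)` is the sign of `det Θ`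
(`neg_one_pow_morseIndex_linearModel_stdParametrix`): deforming `Θ` to `0` on the loops of mean zero
only, through matrices of non-zero trace, turns `J (d/dt - Θ)` into an operator that acts as `-Θ` on
the constant loops and as the identity modulo them. So all signs cancel, the index is `-deg Φ_J`,
and by excision it does not depend on the radius.

A non-degenerate curve is isolated since the derivative of `ℰ` at it is bounded below.
-/

noncomputable section

namespace CurveIndex

open MeasureTheory Module

/-! ### Divergence identities for determinants of derivatives -/

section Determinant

variable {E : Type*} [NormedAddCommGroup E] [NormedSpace ℝ E]
  {ι : Type*} [Fintype ι] [DecidableEq ι]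

/-- The determinant with respect to a basis, as a continuous alternating map. -/
def detCLM (b : Basis ι ℝ E) : E [⋀^ι]→L[ℝ] ℝ :=
  { b.det with
    cont := by
      have : FiniteDimensional ℝ E := b.finiteDimensional_of_finite
      change Continuous fun v : ι → E => b.det v
      simp only [Basis.det_apply]
      refine Continuous.matrix_det (continuous_matrix fun i j => ?_)
      exact (LinearMap.continuous_of_finiteDimensional (b.coord i)).comp (continuous_apply j) }

theorem detCLM_apply (b : Basis ι ℝ E) (v : ι → E) : detCLM b v = b.det v := rfl

/-- Cramer's rule in coordinate-free form. -/
theorem sum_det_update_smul (b : Basis ι ℝ E) (v : ι → E) (h : E) :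
    ∑ i, b.det (Function.update v i h) • v i = b.det v • h := by
  apply b.equivFun.injective
  have key := Matrix.mulVec_cramer (b.toMatrix v) (b.repr h)
  ext k
  have := congrFun key k
  simp only [Matrix.mulVec, dotProduct, Matrix.cramer_apply, Pi.smul_apply, smul_eq_mul] at this
  simp only [map_sum, map_smul, Basis.equivFun_apply, Finset.sum_apply, Pi.smul_apply, smul_eq_mul,
    Basis.det_apply, Basis.toMatrix_update]
  rw [← this]
  refine Finset.sum_congr rfl fun i _ => ?_
  rw [mul_comm]
  rfl

/-- The mixed second derivatives cancel in pairs by antisymmetry. -/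
theorem sum_sum_det_update_update_eq_zero (b : Basis ι ℝ E) (v : ι → E) (h : E)
    (w : ι → ι → E) (hw : ∀ i j, w i j = w j i) :
    ∑ i, ∑ j, (if j = i then 0 else
      b.det (Function.update (Function.update v i h) j (w i j))) = 0 := by
  set S := ∑ i, ∑ j, (if j = i then 0 else
      b.det (Function.update (Function.update v i h) j (w i j))) with hS
  have h1 : S = -S := by
    conv_lhs => rw [hS, Finset.sum_comm]
    rw [hS, ← Finset.sum_neg_distrib]
    refine Finset.sum_congr rfl fun i _ => ?_
    rw [← Finset.sum_neg_distrib]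
    refine Finset.sum_congr rfl fun j _ => ?_
    by_cases hij : j = i
    · simp [hij]
    · rw [if_neg hij, if_neg (Ne.symm hij), ← b.det.map_swap _ hij]
      congr 1
      ext k
      simp only [Function.comp_apply, Function.update_apply, Equiv.swap_apply_def]
      by_cases hkj : k = j
      · subst hkj; simp [hij, Ne.symm hij]
      · by_cases hki : k = i
        · subst hki; simp [hkj, hw j k]
        · simp [hkj, hki]
  linarith

theorem det_fderiv_eq (b : Basis ι ℝ E) (T : E →L[ℝ] E) :
    b.det (fun i => T (b i)) = T.det := by
  have := b.det_comp (T : E →ₗ[ℝ] E) b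
  rw [b.det_self, mul_one] at this
  exact this

/-- The divergence identity behind the homotopy invariance of the degree: the `t`-derivative of
`φ (g + t h) det D(g + t h)` is the divergence of the field whose `i`-th component is
`φ (g)` times the determinant of `Dg` with the `i`-th column replaced by `h`. -/
theorem sum_fderiv_det_update (b : Basis ι ℝ E) {g h : E → E} {φ : E → ℝ}
    (hg : ContDiff ℝ 2 g) (hh : ContDiff ℝ 1 h) (hφ : ContDiff ℝ 1 φ) (z : E) :
    ∑ i, fderiv ℝ (fun z => φ (g z) *
        detCLM b (Function.update (fun j => fderiv ℝ g z (b j)) i (h z))) z (b i) =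
      fderiv ℝ φ (g z) (h z) * detCLM b (fun j => fderiv ℝ g z (b j)) +
      φ (g z) * ∑ i, detCLM b
        (Function.update (fun j => fderiv ℝ g z (b j)) i (fderiv ℝ h z (b i))) := by
  set v : ι → E := fun j => fderiv ℝ g z (b j) with hv
  set w : ι → ι → E := fun i j => fderiv ℝ (fderiv ℝ g) z (b i) (b j) with hw
  have hsymm : ∀ i j, w i j = w j i := by
    intro i j
    exact (hg.contDiffAt.isSymmSndFDerivAt (by simp)) (b i) (b j)
  have hg1 : HasFDerivAt g (fderiv ℝ g z) z :=
    (hg.differentiable (by norm_num)).differentiableAt.hasFDerivAt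
  have hg2 : HasFDerivAt (fderiv ℝ g) (fderiv ℝ (fderiv ℝ g) z) z :=
    ((hg.fderiv_right (m := 1) (by norm_num)).differentiable
      (by norm_num)).differentiableAt.hasFDerivAt
  have hh1 : HasFDerivAt h (fderiv ℝ h z) z :=
    (hh.differentiable (by norm_num)).differentiableAt.hasFDerivAt
  have hφ1 : HasFDerivAt (fun z => φ (g z)) ((fderiv ℝ φ (g z)).comp (fderiv ℝ g z)) z :=
    ((hφ.differentiable (by norm_num)).differentiableAt.hasFDerivAt).comp z hg1
  have hu : ∀ i, HasFDerivAt (fun z => Function.update (fun j => fderiv ℝ g z (b j)) i (h z))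
      (ContinuousLinearMap.pi fun j => if j = i then fderiv ℝ h z else
        (fderiv ℝ (fderiv ℝ g) z).flip (b j)) z := by
    intro i
    rw [hasFDerivAt_pi']
    intro j
    by_cases hji : j = i
    · subst hji
      simp only [Function.update_self]
      convert hh1 using 1
      ext; simp
    · simp only [Function.update_of_ne hji]
      convert hg2.clm_apply (hasFDerivAt_const (b j) z) using 1
      ext; simp [hji]
  have hD : ∀ i, fderiv ℝ (fun z => φ (g z) *
        detCLM b (Function.update (fun j => fderiv ℝ g z (b j)) i (h z))) z (b i) =
      fderiv ℝ φ (g z) (detCLM b (Function.update v i (h z)) • v i) +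
      φ (g z) * (detCLM b (Function.update v i (fderiv ℝ h z (b i))) +
        ∑ j, (if j = i then 0 else
          detCLM b (Function.update (Function.update v i (h z)) j (w i j)))) := by
    intro i
    have h1 := ((detCLM b).hasFDerivAt (Function.update v i (h z))).comp z (hu i)
    have h2 := hφ1.mul h1
    rw [show (fun z => φ (g z) * detCLM b (Function.update (fun j => fderiv ℝ g z (b j)) i (h z)))
      = (fun z => φ (g z)) * ((detCLM b) ∘ fun z =>
        Function.update (fun j => fderiv ℝ g z (b j)) i (h z)) from rfl, h2.fderiv]
    simp only [_root_.add_apply, _root_.smul_apply,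
      ContinuousLinearMap.comp_apply, smul_eq_mul, map_smul, Function.comp_apply,
      ContinuousMultilinearMap.linearDeriv_apply, ContinuousLinearMap.coe_pi']
    rw [add_comm]
    congr 2
    rw [← Finset.add_sum_erase _ _ (Finset.mem_univ i)]
    rw [← Finset.add_sum_erase (a := i) _ (fun j => if j = i then (0 : ℝ) else _)
      (Finset.mem_univ i)]
    simp only [if_true, zero_add, Function.update_idem]
    congr 1
    refine Finset.sum_congr rfl fun j hj => ?_
    have hji : j ≠ i := Finset.ne_of_mem_erase hj
    simp only [hji, if_false, hw, ContinuousLinearMap.flip_apply]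
    rfl
  simp only [hD, Finset.sum_add_distrib, ← Finset.mul_sum]
  have e1 : ∑ i, fderiv ℝ φ (g z) (detCLM b (Function.update v i (h z)) • v i) =
      fderiv ℝ φ (g z) (h z) * detCLM b v := by
    rw [← map_sum]
    simp only [detCLM_apply]
    rw [sum_det_update_smul, map_smul, smul_eq_mul, mul_comm]
  have e2 : ∑ i, ∑ j, (if j = i then 0 else
          detCLM b (Function.update (Function.update v i (h z)) j (w i j))) = 0 :=
    sum_sum_det_update_update_eq_zero b v (h z) w hsymm
  rw [e1, e2, add_zero]

end Determinant

section ZeroIntegral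

variable {E : Type*} [NormedAddCommGroup E] [NormedSpace ℝ E]

theorem contDiff_indicator_of_eventuallyEq_zero {Ω : Set E} (hΩ : IsOpen Ω) {V : E → ℝ} {n : ℕ∞}
    (hV : ContDiff ℝ n V) (h0 : ∀ w ∈ frontier Ω, V =ᶠ[𝓝 w] 0) :
    ContDiff ℝ n (Ω.indicator V) := by
  rw [contDiff_iff_contDiffAt]
  intro z
  by_cases hz : z ∈ Ω
  · exact hV.contDiffAt.congr_of_eventuallyEq
      (Filter.eventuallyEq_of_mem (hΩ.mem_nhds hz) fun y hy => indicator_of_mem hy V)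
  · by_cases hz' : z ∈ closure Ω
    · have : z ∈ frontier Ω := ⟨hz', by rwa [hΩ.interior_eq]⟩
      refine contDiffAt_const (c := (0 : ℝ)) |>.congr_of_eventuallyEq ?_
      filter_upwards [h0 z this] with y hy
      by_cases hyΩ : y ∈ Ω <;> simp_all
    · refine contDiffAt_const (c := (0 : ℝ)) |>.congr_of_eventuallyEq ?_
      filter_upwards [isClosed_closure.isOpen_compl.mem_nhds hz'] with y hy
      exact indicator_of_notMem (fun h => hy (subset_closure h)) V

variable [FiniteDimensional ℝ E] [MeasurableSpace E] [BorelSpace E] (μ : Measure E)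
  [μ.IsAddHaarMeasure]

/-- The integral of a derivative over a bounded open set vanishes if the function vanishes near the
boundary, by extension with zero. -/
theorem setIntegral_fderiv_eq_zero {Ω : Set E} (hΩ : IsOpen Ω) (hb : Bornology.IsBounded Ω)
    {V : E → ℝ} (hV : ContDiff ℝ 1 V) (h0 : ∀ w ∈ frontier Ω, V =ᶠ[𝓝 w] 0) (v : E) :
    ∫ z in Ω, fderiv ℝ V z v ∂μ = 0 := by
  set W := Ω.indicator V with hW
  have hWs : ContDiff ℝ 1 W := contDiff_indicator_of_eventuallyEq_zero (n := 1) hΩ hV h0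
  have hWc : HasCompactSupport W := by
    refine HasCompactSupport.intro (K := closure Ω) hb.isCompact_closure fun z hz => ?_
    exact indicator_of_notMem (fun h => hz (subset_closure h)) V
  have hint : ∫ z in Ω, fderiv ℝ V z v ∂μ = ∫ z, fderiv ℝ W z v ∂μ := by
    rw [← integral_indicator hΩ.measurableSet]
    congr 1
    ext z
    by_cases hz : z ∈ Ω
    · rw [indicator_of_mem hz]
      have : W =ᶠ[𝓝 z] V :=
        Filter.eventuallyEq_of_mem (hΩ.mem_nhds hz) fun y hy => indicator_of_mem hy V
      rw [this.fderiv_eq]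
    · rw [indicator_of_notMem hz]
      have : W =ᶠ[𝓝 z] fun _ => 0 := by
        by_cases hz' : z ∈ closure Ω
        · filter_upwards [h0 z ⟨hz', by rwa [hΩ.interior_eq]⟩] with y hy
          by_cases hyΩ : y ∈ Ω <;> simp_all
        · filter_upwards [isClosed_closure.isOpen_compl.mem_nhds hz'] with y hy
          exact indicator_of_notMem (fun h => hy (subset_closure h)) V
      rw [this.fderiv_eq]
      simp
  have hc : Continuous fun z => fderiv ℝ W z v :=
    (hWs.continuous_fderiv (by norm_num)).clm_apply continuous_const
  have hcs : HasCompactSupport fun z => fderiv ℝ W z v := by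
    exact (hWc.fderiv (𝕜 := ℝ)).comp_left (g := fun T : E →L[ℝ] ℝ => T v) (by simp)
  have := integral_mul_fderiv_eq_neg_fderiv_mul_of_integrable (μ := μ) (f := fun _ : E => (1 : ℝ))
    (g := W) (v := v) (by simp) (by simpa using hc.integrable_of_hasCompactSupport hcs)
    (by simpa using hWs.continuous.integrable_of_hasCompactSupport hWc)
    (fun _ _ => differentiableAt_const _)
    (fun _ _ => (hWs.differentiable (by norm_num)).differentiableAt)
  rw [hint]
  simpa using this

end ZeroIntegral

/-! ### Homotopy invariance of the degree integral -/

section Homotopy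

variable {E : Type*} [NormedAddCommGroup E] [NormedSpace ℝ E]
  [FiniteDimensional ℝ E] [MeasurableSpace E] [BorelSpace E] (μ : Measure E)
  [μ.IsAddHaarMeasure]

/-- The integral `∫_Ω φ (g z) det Dg (z)`, which counts the zeros of `g` in `Ω` with sign when `φ`
is a bump function of integral one near the origin. -/
def degreeIntegral (φ : E → ℝ) (g : E → E) (Ω : Set E) : ℝ :=
  ∫ z in Ω, φ (g z) * (fderiv ℝ g z).det ∂μ

/-- Homotopy invariance of the degree integral along the segment from `g` to `g + h`, as long as it
avoids the support of `φ` on the boundary: the derivative of the integral in the parameter is the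
integral of a divergence. -/
theorem degreeIntegral_add_eq {Ω : Set E} (hΩ : IsOpen Ω) (hb : Bornology.IsBounded Ω)
    {g h : E → E} {φ : E → ℝ} (hg : ContDiff ℝ 2 g) (hh : ContDiff ℝ 2 h) (hφ : ContDiff ℝ 1 φ)
    (h0 : ∀ t ∈ Icc (0 : ℝ) 1, ∀ w ∈ frontier Ω, φ =ᶠ[𝓝 (g w + t • h w)] 0) :
    degreeIntegral μ φ (fun z => g z + h z) Ω = degreeIntegral μ φ g Ω := by
  let b := finBasis ℝ E
  let D : ℝ → E → Fin (finrank ℝ E) → E :=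
    fun t z j => fderiv ℝ g z (b j) + t • fderiv ℝ h z (b j)
  let F : ℝ → E → ℝ := fun t z => φ (g z + t • h z) * detCLM b (D t z)
  let F' : ℝ → E → ℝ := fun t z => fderiv ℝ φ (g z + t • h z) (h z) * detCLM b (D t z) +
      φ (g z + t • h z) * ∑ j, detCLM b (Function.update (D t z) j (fderiv ℝ h z (b j)))
  have hgd : Differentiable ℝ g := hg.differentiable (by norm_num)
  have hhd : Differentiable ℝ h := hh.differentiable (by norm_num)
  have cg := hg.continuous
  have ch := hh.continuous
  have cφ := hφ.continuous
  have cφ' : Continuous (fderiv ℝ φ) := hφ.continuous_fderiv (by norm_num)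
  have cg' : Continuous (fderiv ℝ g) := hg.continuous_fderiv (by norm_num)
  have ch' : Continuous (fderiv ℝ h) := hh.continuous_fderiv (by norm_num)
  have cdet : Continuous (detCLM b) := (detCLM b).cont
  have cD : Continuous fun p : ℝ × E => D p.1 p.2 := by
    refine continuous_pi fun j => ?_
    exact ((cg'.comp continuous_snd).clm_apply continuous_const).add
      (continuous_fst.smul ((ch'.comp continuous_snd).clm_apply continuous_const))
  have cgt : Continuous fun p : ℝ × E => g p.2 + p.1 • h p.2 :=
    (cg.comp continuous_snd).add (continuous_fst.smul (ch.comp continuous_snd))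
  have cF : Continuous fun p : ℝ × E => F p.1 p.2 := (cφ.comp cgt).mul (cdet.comp cD)
  have cF' : Continuous fun p : ℝ × E => F' p.1 p.2 := by
    refine Continuous.add (Continuous.mul ?_ (cdet.comp cD)) ((cφ.comp cgt).mul ?_)
    · exact (cφ'.comp cgt).clm_apply (ch.comp continuous_snd)
    · refine continuous_finsetSum _ fun j _ => cdet.comp (cD.update j ?_)
      exact (ch'.comp continuous_snd).clm_apply continuous_const
  have hder : ∀ t z, HasDerivAt (fun s => F s z) (F' t z) t := by
    intro t z
    have h1 : HasDerivAt (fun s : ℝ => g z + s • h z) (h z) t := by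
      simpa using ((hasDerivAt_id t).smul_const (h z)).const_add (g z)
    have h2 : HasDerivAt (fun s => φ (g z + s • h z)) (fderiv ℝ φ (g z + t • h z) (h z)) t :=
      ((hφ.differentiable (by norm_num)).differentiableAt.hasFDerivAt).comp_hasDerivAt t h1
    have h3 : HasDerivAt (fun s => D s z) (fun j => fderiv ℝ h z (b j)) t := by
      rw [hasDerivAt_pi]
      intro j
      have : HasDerivAt (fun s : ℝ => fderiv ℝ g z (b j) + s • fderiv ℝ h z (b j))
          (fderiv ℝ h z (b j)) t := by
        simpa using ((hasDerivAt_id t).smul_const (fderiv ℝ h z (b j))).const_add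
          (fderiv ℝ g z (b j))
      exact this
    have h4 := ((detCLM b).hasFDerivAt (D t z)).comp_hasDerivAt t h3
    refine HasDerivAt.congr_deriv (h2.mul h4) ?_
    rw [ContinuousMultilinearMap.linearDeriv_apply]
    rfl
  have hfin : IsFiniteMeasure (μ.restrict Ω) := ⟨by
    rw [Measure.restrict_apply_univ]; exact hb.measure_lt_top⟩
  have hint : ∀ G : E → ℝ, Continuous G → Integrable G (μ.restrict Ω) := by
    intro G hG
    exact (hG.continuousOn.integrableOn_compact hb.isCompact_closure).mono_set subset_closure
  have hI : ∀ t ∈ Icc (0 : ℝ) 1, HasDerivAt (fun s => ∫ z in Ω, F s z ∂μ) 0 t := by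
    intro t ht
    obtain ⟨C, hC⟩ := (isCompact_Icc (a := t - 1) (b := t + 1)).prod hb.isCompact_closure
      |>.exists_bound_of_continuousOn cF'.continuousOn
    have key := hasDerivAt_integral_of_dominated_loc_of_deriv_le (μ := μ.restrict Ω) (F := F)
      (F' := F') (x₀ := t) (s := Icc (t - 1) (t + 1)) (bound := fun _ => C)
      (Icc_mem_nhds (by linarith) (by linarith))
      (Filter.Eventually.of_forall fun s =>
        (cF.comp (Continuous.prodMk_right s)).aestronglyMeasurable)
      (hint _ (cF.comp (Continuous.prodMk_right t)))
      (cF'.comp (Continuous.prodMk_right t)).aestronglyMeasurable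
      ((ae_restrict_iff' hΩ.measurableSet).2 (Filter.Eventually.of_forall fun z hz s hs =>
        hC (s, z) ⟨hs, subset_closure hz⟩))
      (integrable_const C) (Filter.Eventually.of_forall fun z s _ => hder s z)
    have hz : ∫ z in Ω, F' t z ∂μ = 0 := by
      have hgt : ContDiff ℝ 2 fun z => g z + t • h z := hg.add (hh.const_smul t)
      have hDt : ∀ z j, fderiv ℝ (fun z => g z + t • h z) z (b j) = D t z j := by
        intro z j
        have : HasFDerivAt (fun z => g z + t • h z) (fderiv ℝ g z + t • fderiv ℝ h z) z :=
          (hgd z).hasFDerivAt.add ((hhd z).hasFDerivAt.const_smul t)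
        rw [this.fderiv]
        rfl
      have hdiv := fun z => sum_fderiv_det_update b hgt (hh.of_le (by norm_num)) hφ z
      have hF' : ∀ z, F' t z = ∑ i, fderiv ℝ (fun z => φ (g z + t • h z) * detCLM b
          (Function.update (fun j => fderiv ℝ (fun z => g z + t • h z) z (b j)) i (h z)))
            z (b i) := by
        intro z
        rw [hdiv z]
        simp only [hDt]
        rfl
      have hVs : ∀ i, ContDiff ℝ 1 fun z => φ (g z + t • h z) * detCLM b
          (Function.update (fun j => fderiv ℝ (fun z => g z + t • h z) z (b j)) i (h z)) := by
        intro i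
        refine (hφ.comp (hgt.of_le (by norm_num))).mul
          ((detCLM b).toContinuousMultilinearMap.contDiff.comp ?_)
        rw [contDiff_pi]
        intro j
        by_cases hji : j = i
        · subst hji
          simpa using hh.of_le (by norm_num)
        · simp only [Function.update_of_ne hji]
          exact (hgt.fderiv_right (m := 1) (by norm_num)).clm_apply contDiff_const
      simp only [hF']
      rw [integral_finsetSum]
      · refine Finset.sum_eq_zero fun i _ => ?_
        refine setIntegral_fderiv_eq_zero μ hΩ hb (hVs i) (fun w hw => ?_) (b i)
        have := hgt.continuous.continuousAt.eventually (h0 t ht w hw)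
        filter_upwards [this] with y hy
        simp only [Pi.zero_apply] at hy ⊢
        rw [hy, zero_mul]
      · intro i _
        exact hint _ (((hVs i).continuous_fderiv (by norm_num)).clm_apply continuous_const)
    rw [← hz]
    exact key.2
  have hconst := constant_of_has_deriv_right_zero (a := (0 : ℝ)) (b := 1)
    (f := fun s => ∫ z in Ω, F s z ∂μ)
    (fun t ht => (hI t ht).continuousAt.continuousWithinAt)
    (fun t ht => (hI t ⟨ht.1, ht.2.le⟩).hasDerivWithinAt) 1 (by simp)
  have e1 : degreeIntegral μ φ (fun z => g z + h z) Ω = ∫ z in Ω, F 1 z ∂μ := by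
    unfold degreeIntegral
    congr 1
    ext z
    have : fderiv ℝ (fun z => g z + h z) z = fderiv ℝ g z + fderiv ℝ h z :=
      ((hgd z).hasFDerivAt.add (hhd z).hasFDerivAt).fderiv
    rw [this, ← det_fderiv_eq b]
    simp [F, D, detCLM_apply]
  have e0 : degreeIntegral μ φ g Ω = ∫ z in Ω, F 0 z ∂μ := by
    unfold degreeIntegral
    congr 1
    ext z
    rw [← det_fderiv_eq b]
    simp [F, D, detCLM_apply]
  rw [e1, e0]
  exact hconst

end Homotopy

/-! ### The signed count of zeros -/

section Count

variable {E : Type*} [NormedAddCommGroup E] [NormedSpace ℝ E] [FiniteDimensional ℝ E]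

theorem exists_antilipschitzWith_of_det_ne_zero {T : E →L[ℝ] E} (hT : T.det ≠ 0) :
    ∃ C, AntilipschitzWith C T := by
  have := (T.toContinuousLinearEquivOfDetNeZero hT).antilipschitz
  exact ⟨_, this⟩

/-- The zeros of a map in a bounded open set are finite in number when they are all regular and
none lies on the boundary. -/
theorem finite_zeros {Ω : Set E} (hb : Bornology.IsBounded Ω) {g : E → E}
    (hg : ContDiff ℝ ∞ g) (h0 : ∀ w ∈ frontier Ω, g w ≠ 0)
    (hr : ∀ z ∈ Ω, g z = 0 → (fderiv ℝ g z).det ≠ 0) : {z | z ∈ Ω ∧ g z = 0}.Finite := by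
  by_contra hinf
  obtain ⟨x, hx, hacc⟩ := Set.Infinite.exists_accPt_of_subset_isCompact hinf hb.isCompact_closure
    fun z hz => subset_closure hz.1
  rw [accPt_iff_frequently_nhdsNE] at hacc
  have hgx : g x = 0 := by
    by_contra hne
    have : ∀ᶠ z in 𝓝[≠] x, g z ≠ 0 :=
      (hg.continuous.continuousAt.eventually_ne hne).filter_mono nhdsWithin_le_nhds
    exact hacc (this.mono fun z hz hz' => hz hz'.2)
  have hxΩ : x ∈ Ω := by
    by_contra hne
    exact h0 x ⟨hx, fun h => hne (interior_subset h)⟩ hgx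
  have := ((hg.differentiable (by simp)) x).hasFDerivAt.eventually_ne (c := 0)
    (exists_antilipschitzWith_of_det_ne_zero (hr x hxΩ hgx))
  exact hacc (this.mono fun z hz hz' => hz hz'.2)

/-- The inverse function theorem, in a neighbourhood on which the sign of the Jacobian determinant
is constant. -/
theorem exists_nhds_injOn_sign_eq {g : E → E} (hg : ContDiff ℝ ∞ g) {z : E}
    (hz : (fderiv ℝ g z).det ≠ 0) {V : Set E} (hV : V ∈ 𝓝 z) :
    ∃ U ⊆ V, IsOpen U ∧ z ∈ U ∧ InjOn g U ∧ g '' U ∈ 𝓝 (g z) ∧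
      ∀ y ∈ U, SignType.sign (fderiv ℝ g y).det = SignType.sign (fderiv ℝ g z).det := by
  have hs : HasStrictFDerivAt g
      (((fderiv ℝ g z).toContinuousLinearEquivOfDetNeZero hz : E ≃L[ℝ] E) : E →L[ℝ] E) z := by
    rw [ContinuousLinearMap.coe_toContinuousLinearEquivOfDetNeZero]
    exact hg.contDiffAt.hasStrictFDerivAt (by simp)
  let e := hs.toOpenPartialHomeomorph g
  have hec : (e : E → E) = g := hs.toOpenPartialHomeomorph_coe
  have hdet : Continuous fun y => (fderiv ℝ g y).det :=
    ContinuousLinearMap.continuous_det.comp (hg.continuous_fderiv (by simp))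
  have hsign : ∀ᶠ y in 𝓝 z,
      SignType.sign (fderiv ℝ g y).det = SignType.sign (fderiv ℝ g z).det := by
    rcases lt_or_gt_of_ne hz with h | h
    · filter_upwards [hdet.continuousAt.eventually_lt continuousAt_const h] with y hy
      rw [sign_neg hy, sign_neg h]
    · filter_upwards [continuousAt_const.eventually_lt hdet.continuousAt h] with y hy
      rw [sign_pos hy, sign_pos h]
  have hmem : e.source ∩ V ∩ {y | SignType.sign (fderiv ℝ g y).det =
      SignType.sign (fderiv ℝ g z).det} ∈ 𝓝 z :=
    Filter.inter_mem (Filter.inter_mem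
      (e.open_source.mem_nhds hs.mem_toOpenPartialHomeomorph_source) hV) hsign
  obtain ⟨U, hU, hUo, hzU⟩ := _root_.mem_nhds_iff.1 hmem
  refine ⟨U, fun y hy => (hU hy).1.2, hUo, hzU, ?_, ?_, fun y hy => (hU hy).2⟩
  · rw [← hec]
    exact e.injOn.mono fun y hy => (hU hy).1.1
  · rw [← hs.map_nhds_eq_of_equiv]
    exact Filter.image_mem_map (hUo.mem_nhds hzU)

variable [MeasurableSpace E] [BorelSpace E] (μ : Measure E) [μ.IsAddHaarMeasure]

/-- If `φ` has integral one and small support, then the degree integral is the signed count of the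
zeros: it localizes near the zeros, and each of them contributes its sign by the change of variables
formula. -/
theorem degreeIntegral_eq_signedCount {Ω : Set E} (hΩ : IsOpen Ω) (hb : Bornology.IsBounded Ω)
    {g : E → E} (hg : ContDiff ℝ ∞ g) (h0 : ∀ w ∈ frontier Ω, g w ≠ 0)
    (hr : ∀ z ∈ Ω, g z = 0 → (fderiv ℝ g z).det ≠ 0) :
    ∃ ρ > 0, ∀ φ : E → ℝ, Continuous φ → Function.support φ ⊆ ball 0 ρ → ∫ z, φ z ∂μ = 1 →
      degreeIntegral μ φ g Ω = signedCount g Ω 0 := by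
  classical
  have hfin := finite_zeros hb hg h0 hr
  set Z : Set E := {z | z ∈ Ω ∧ g z = 0} with hZ
  obtain ⟨W, hW, hWd⟩ := hfin.t2_separation
  have hloc : ∀ z ∈ Z, ∃ U ⊆ W z ∩ Ω, IsOpen U ∧ z ∈ U ∧ InjOn g U ∧ g '' U ∈ 𝓝 (0 : E) ∧
      ∀ y ∈ U, SignType.sign (fderiv ℝ g y).det = SignType.sign (fderiv ℝ g z).det := by
    intro z hz
    have := exists_nhds_injOn_sign_eq hg (hr z hz.1 hz.2)
      (((hW z).2.inter hΩ).mem_nhds ⟨(hW z).1, hz.1⟩)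
    rwa [hz.2] at this
  choose! U hUW hUo hzU hinj himg hsign using hloc
  -- `‖g‖` is bounded below by some `m > 0` away from the chosen neighbourhoods of the zeros
  have hK : IsCompact (closure Ω \ ⋃ z ∈ Z, U z) :=
    hb.isCompact_closure.diff (isOpen_biUnion fun z hz => hUo z hz)
  have hKne : ∀ z ∈ closure Ω \ ⋃ z ∈ Z, U z, 0 < ‖g z‖ := by
    rintro z ⟨hz, hzU'⟩
    rw [norm_pos_iff]
    intro hgz
    have hzΩ : z ∈ Ω := by
      by_contra hne
      exact h0 z ⟨hz, fun h => hne (interior_subset h)⟩ hgz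
    exact hzU' (mem_biUnion (show z ∈ Z from ⟨hzΩ, hgz⟩) (hzU z ⟨hzΩ, hgz⟩))
  obtain ⟨m, hm, hmK⟩ := hK.exists_forall_le' hg.continuous.norm.continuousOn hKne
  have himgs : ⋂ z ∈ Z, g '' U z ∈ 𝓝 (0 : E) := (Filter.biInter_mem hfin).2 himg
  obtain ⟨ρ', hρ', hball⟩ := Metric.mem_nhds_iff.1 himgs
  refine ⟨min m ρ', lt_min hm hρ', fun φ hφ hsupp hint => ?_⟩
  have hzero : ∀ z, φ z ≠ 0 → ‖z‖ < min m ρ' := fun z hz => by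
    simpa using hsupp (Function.mem_support.2 hz)
  have hdet : Continuous fun y => (fderiv ℝ g y).det :=
    ContinuousLinearMap.continuous_det.comp (hg.continuous_fderiv (by simp))
  have hsub : (⋃ z ∈ hfin.toFinset, U z) ⊆ Ω := by
    refine iUnion₂_subset fun z hz => ?_
    exact fun y hy => (hUW z (by simpa using hz) hy).2
  have h1 : degreeIntegral μ φ g Ω =
      ∫ z in ⋃ z ∈ hfin.toFinset, U z, φ (g z) * (fderiv ℝ g z).det ∂μ := by
    refine setIntegral_eq_of_subset_of_forall_sdiff_eq_zero hΩ.measurableSet hsub ?_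
    rintro z ⟨hz, hz'⟩
    have hmz : m ≤ ‖g z‖ := hmK z ⟨subset_closure hz, by simpa using hz'⟩
    have : φ (g z) = 0 := by
      by_contra hne
      exact absurd (hzero _ hne) (not_lt.2 ((min_le_left _ _).trans hmz))
    rw [this, zero_mul]
  rw [h1, integral_biUnion_finset]
  · have h2 : ∀ z ∈ hfin.toFinset, ∫ y in U z, φ (g y) * (fderiv ℝ g y).det ∂μ =
        (((SignType.sign (fderiv ℝ g z).det : SignType) : ℤ) : ℝ) := by
      intro z hz
      have hz : z ∈ Z := by simpa using hz
      have h3 : ∫ y in U z, φ (g y) * (fderiv ℝ g y).det ∂μ =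
          ∫ y in U z, (((SignType.sign (fderiv ℝ g z).det : SignType) : ℤ) : ℝ) *
            (|(fderiv ℝ g y).det| • φ (g y)) ∂μ := by
        refine setIntegral_congr_fun (hUo z hz).measurableSet fun y hy => ?_
        have := sign_mul_abs (fderiv ℝ g y).det
        simp only [smul_eq_mul]
        rw [← mul_assoc, ← hsign z hz y hy]
        rw [SignType.intCast_cast, this, mul_comm]
      rw [h3, integral_const_mul, ← integral_image_eq_integral_abs_det_fderiv_smul μ
        (hUo z hz).measurableSet
        (fun y _ => ((hg.differentiable (by simp)) y).hasFDerivAt.hasFDerivWithinAt) (hinj z hz)]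
      rw [setIntegral_eq_integral_of_forall_compl_eq_zero, hint, mul_one]
      intro y hy
      by_contra hne
      have : y ∈ ball (0 : E) ρ' := by
        simpa using (hzero y hne).trans_le (min_le_right _ _)
      exact hy (mem_iInter₂.1 (hball this) z hz)
    rw [Finset.sum_congr rfl h2, signedCount, finsum_mem_eq_finite_toFinset_sum _ hfin]
    push_cast
    rfl
  · intro z hz
    exact (hUo z (by simpa using hz)).measurableSet
  · intro z hz z' hz' hne
    simp only [Finite.coe_toFinset] at hz hz'
    exact (hWd hz hz' hne).mono (fun y hy => (hUW z hz hy).1) fun y hy => (hUW z' hz' hy).1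
  · intro z hz
    have : IntegrableOn (fun z => φ (g z) * (fderiv ℝ g z).det) (closure Ω) μ :=
      ((hφ.comp hg.continuous).mul hdet).continuousOn.integrableOn_compact hb.isCompact_closure
    exact this.mono_set fun y hy => subset_closure (hUW z (by simpa using hz) hy).2

end Count

section Segment

variable {E : Type*} [NormedAddCommGroup E] [NormedSpace ℝ E]

theorem signedCount_sub_const (g : E → E) (Ω : Set E) (y : E) :
    signedCount (fun z => g z - y) Ω 0 = signedCount g Ω y := by
  simp only [signedCount, sub_eq_zero, fderiv_sub_const]

/-- A segment of continuous maps without zeros on a compact set stays at positive distance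
from zero there. -/
theorem exists_pos_le_norm_segment {V : Type*} [TopologicalSpace V] {f h : V → E} {K : Set V}
    (hK : IsCompact K) (hf : ContinuousOn f K) (hh : ContinuousOn h K)
    (h0 : ∀ t ∈ Icc (0 : ℝ) 1, ∀ w ∈ K, f w + t • h w ≠ 0) :
    ∃ m > 0, ∀ t ∈ Icc (0 : ℝ) 1, ∀ w ∈ K, m ≤ ‖f w + t • h w‖ := by
  have hc : ContinuousOn (fun p : ℝ × V => ‖f p.2 + p.1 • h p.2‖) (Icc (0 : ℝ) 1 ×ˢ K) := by
    have h2 : MapsTo Prod.snd (Icc (0 : ℝ) 1 ×ˢ K) K := fun p hp => hp.2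
    exact ((hf.comp continuousOn_snd h2).add (continuousOn_fst.smul
      (hh.comp continuousOn_snd h2))).norm
  obtain ⟨m, hm, hmK⟩ := (isCompact_Icc.prod hK).exists_forall_le' hc (a := 0)
    fun p hp => norm_pos_iff.2 (h0 p.1 hp.1 p.2 hp.2)
  exact ⟨m, hm, fun t ht w hw => hmK (t, w) ⟨ht, hw⟩⟩

variable [FiniteDimensional ℝ E]

theorem frontier_isCompact {Ω : Set E} (hb : Bornology.IsBounded Ω) : IsCompact (frontier Ω) :=
  hb.isCompact_closure.of_isClosed_subset isClosed_frontier frontier_subset_closure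

/-- Homotopy invariance of the signed count, along segments. -/
theorem signedCount_eq_of_segment {Ω : Set E} (hΩ : IsOpen Ω) (hb : Bornology.IsBounded Ω) {y : E}
    {g₀ g₁ : E → E} (hg₀ : ContDiff ℝ ∞ g₀) (hg₁ : ContDiff ℝ ∞ g₁)
    (h0 : ∀ t ∈ Icc (0 : ℝ) 1, ∀ w ∈ frontier Ω, g₀ w + t • (g₁ w - g₀ w) ≠ y)
    (hr₀ : ∀ z ∈ Ω, g₀ z = y → (fderiv ℝ g₀ z).det ≠ 0)
    (hr₁ : ∀ z ∈ Ω, g₁ z = y → (fderiv ℝ g₁ z).det ≠ 0) :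
    signedCount g₀ Ω y = signedCount g₁ Ω y := by
  borelize E
  let μ : Measure E := Measure.addHaar
  have hf₀ : ContDiff ℝ ∞ fun z => g₀ z - y := hg₀.sub contDiff_const
  have hf₁ : ContDiff ℝ ∞ fun z => g₁ z - y := hg₁.sub contDiff_const
  have hseg : ∀ t ∈ Icc (0 : ℝ) 1, ∀ w ∈ frontier Ω,
      (g₀ w - y) + t • (g₁ w - g₀ w) ≠ 0 := by
    intro t ht w hw h
    apply h0 t ht w hw
    rw [← sub_eq_zero, ← h]
    abel
  obtain ⟨m, hm, hmK⟩ := exists_pos_le_norm_segment (f := fun z => g₀ z - y)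
    (h := fun z => g₁ z - g₀ z) (frontier_isCompact hb) hf₀.continuous.continuousOn
    (hg₁.sub hg₀).continuous.continuousOn hseg
  obtain ⟨ρ₀, hρ₀, H₀⟩ := degreeIntegral_eq_signedCount μ hΩ hb hf₀
    (fun w hw => by simpa using hseg 0 (by simp) w hw)
    (fun z hz h => by rw [fderiv_sub_const]; exact hr₀ z hz (sub_eq_zero.1 h))
  obtain ⟨ρ₁, hρ₁, H₁⟩ := degreeIntegral_eq_signedCount μ hΩ hb hf₁
    (fun w hw => by simpa using hseg 1 (by simp) w hw)
    (fun z hz h => by rw [fderiv_sub_const]; exact hr₁ z hz (sub_eq_zero.1 h))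
  set ρ := min m (min ρ₀ ρ₁) with hρdef
  have hρ : 0 < ρ := lt_min hm (lt_min hρ₀ hρ₁)
  let β : ContDiffBump (0 : E) := ⟨ρ / 3, ρ / 2, by positivity, by linarith⟩
  let φ := β.normed μ
  have hφ : ContDiff ℝ 1 φ := β.contDiff_normed (n := 1)
  have hsupp : Function.support φ = ball 0 (ρ / 2) := β.support_normed_eq
  have e₀ := H₀ φ hφ.continuous (hsupp.trans_subset (ball_subset_ball (by
    have : ρ ≤ ρ₀ := (min_le_right _ _).trans (min_le_left _ _)
    linarith))) β.integral_normed
  have e₁ := H₁ φ hφ.continuous (hsupp.trans_subset (ball_subset_ball (by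
    have : ρ ≤ ρ₁ := (min_le_right _ _).trans (min_le_right _ _)
    linarith))) β.integral_normed
  have hI := degreeIntegral_add_eq μ hΩ hb (g := fun z => g₀ z - y) (h := fun z => g₁ z - g₀ z)
    (φ := φ) (mod_cast contDiff_infty.1 hf₀ 2)
    (mod_cast contDiff_infty.1 (hg₁.sub hg₀) 2) hφ (by
      intro t ht w hw
      have hle : m ≤ ‖(g₀ w - y) + t • (g₁ w - g₀ w)‖ := hmK t ht w hw
      have hmem : (g₀ w - y) + t • (g₁ w - g₀ w) ∈ (closedBall (0 : E) (ρ / 2))ᶜ := by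
        simp only [mem_compl_iff, mem_closedBall, dist_zero_right, not_le]
        have : ρ ≤ m := min_le_left _ _
        linarith
      filter_upwards [isClosed_closedBall.isOpen_compl.mem_nhds hmem] with u hu
      by_contra hne
      have : u ∈ ball (0 : E) (ρ / 2) := hsupp ▸ Function.mem_support.2 hne
      exact hu (ball_subset_closedBall this))
  have hfun : (fun z => g₀ z - y + (g₁ z - g₀ z)) = fun z => g₁ z - y := by
    ext z; abel
  rw [hfun, e₀, e₁, signedCount_sub_const, signedCount_sub_const] at hI
  exact_mod_cast hI.symm

end Segment

/-! ### The Brouwer degree -/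

section Approximation

variable {E F : Type*} [NormedAddCommGroup E] [NormedSpace ℝ E] [FiniteDimensional ℝ E]
  [NormedAddCommGroup F] [NormedSpace ℝ F] [FiniteDimensional ℝ F]

/-- A continuous function on a closed set is uniformly approximated by smooth functions on the whole
space, by Tietze extension. -/
theorem exists_contDiff_norm_sub_lt {K : Set E} (hK : IsClosed K) {f : E → F}
    (hf : ContinuousOn f K) {δ : ℝ} (hδ : 0 < δ) :
    ∃ g : E → F, ContDiff ℝ ∞ g ∧ ∀ z ∈ K, ‖f z - g z‖ < δ := by
  have : TietzeExtension.{_, _} F := RCLike.instTietzeExtensionTVS (𝕜 := ℝ)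
  obtain ⟨f', hf'⟩ := ContinuousMap.exists_restrict_eq hK
    (⟨K.domRestrict f, hf.domRestrict⟩ : C(K, F))
  obtain ⟨g, hg, hgf, -⟩ := f'.continuous.exists_contDiff_approx ⊤ (ε := fun _ => δ)
    continuous_const (fun _ => hδ)
  refine ⟨g, hg, fun z hz => ?_⟩
  have h1 : f' z = f z := DFunLike.congr_fun hf' (⟨z, hz⟩ : K)
  rw [← h1, ← dist_eq_norm, dist_comm]
  exact hgf z

/-- Regular values are dense (Sard's lemma in equal dimensions). -/
theorem exists_regular_value {g : E → E} (hg : ContDiff ℝ ∞ g) (y : E) {δ : ℝ} (hδ : 0 < δ) :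
    ∃ c : E, ‖c‖ < δ ∧ ∀ z, g z = y + c → (fderiv ℝ g z).det ≠ 0 := by
  borelize E
  let μ : Measure E := Measure.addHaar
  have h0 : μ (g '' {z | (fderiv ℝ g z).det = 0}) = 0 :=
    addHaar_image_eq_zero_of_det_fderivWithin_eq_zero μ
      (fun z _ => ((hg.differentiable (by simp)) z).hasFDerivAt.hasFDerivWithinAt)
      fun z hz => hz
  have hd := μ.interior_eq_empty_of_null h0
  have : ¬ ball y δ ⊆ g '' {z | (fderiv ℝ g z).det = 0} := by
    intro h
    have := interior_maximal h isOpen_ball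
    rw [hd] at this
    exact this (mem_ball_self hδ)
  obtain ⟨u, hu, hu'⟩ := not_subset.1 this
  refine ⟨u - y, by simpa [dist_eq_norm] using hu, fun z hz hdet => hu' ⟨z, hdet, ?_⟩⟩
  rw [hz]; abel

/-- The smooth approximation can be shifted by a small vector so that `y` becomes regular. -/
theorem exists_contDiff_regular_norm_sub_lt {K : Set E} (hK : IsClosed K) {f : E → E}
    (hf : ContinuousOn f K) (y : E) {δ : ℝ} (hδ : 0 < δ) :
    ∃ g : E → E, ContDiff ℝ ∞ g ∧ (∀ z ∈ K, ‖f z - g z‖ < δ) ∧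
      ∀ z, g z = y → (fderiv ℝ g z).det ≠ 0 := by
  obtain ⟨g, hg, hgf⟩ := exists_contDiff_norm_sub_lt hK hf (half_pos hδ)
  obtain ⟨c, hc, hreg⟩ := exists_regular_value hg y (half_pos hδ)
  refine ⟨fun z => g z - c, hg.sub contDiff_const, fun z hz => ?_, fun z hz => ?_⟩
  · calc ‖f z - (g z - c)‖ = ‖(f z - g z) + c‖ := by congr 1; abel
      _ ≤ ‖f z - g z‖ + ‖c‖ := norm_add_le _ _
      _ < δ := by linarith [hgf z hz]
  · rw [fderiv_sub_const]
    exact hreg z (by rw [← hz]; exact (sub_add_cancel _ _).symm)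

end Approximation

theorem exists_pos_le_norm_sub {V E : Type*} [TopologicalSpace V]
    [NormedAddCommGroup E] {f : V → E} {K : Set V}
    (hK : IsCompact K) (hf : ContinuousOn f K) {y : E} (h0 : ∀ w ∈ K, f w ≠ y) :
    ∃ m > 0, ∀ w ∈ K, m ≤ ‖f w - y‖ :=
  hK.exists_forall_le' (hf.sub continuousOn_const).norm fun w hw =>
    norm_pos_iff.2 (sub_ne_zero.2 (h0 w hw))

section Brouwer

variable {E : Type*} [NormedAddCommGroup E] [NormedSpace ℝ E] [FiniteDimensional ℝ E]

/-- The Brouwer degree is the signed count of any regular approximation. -/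
theorem IsRegularApprox.brouwerDegree_eq {Ω : Set E} (hΩ : IsOpen Ω) (hb : Bornology.IsBounded Ω)
    {f g : E → E} {y : E} (hg : IsRegularApprox f Ω y g) :
    brouwerDegree f Ω y = signedCount g Ω y := by
  have h : ∃ g : E → E, IsRegularApprox f Ω y g := ⟨g, hg⟩
  rw [brouwerDegree, dif_pos h]
  obtain ⟨r₀, hr₀, hc₀⟩ := h.choose_spec.close
  obtain ⟨r₁, hr₁, hc₁⟩ := hg.close
  refine signedCount_eq_of_segment hΩ hb h.choose_spec.smooth hg.smooth ?_
    h.choose_spec.regular hg.regular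
  intro t ht w hw heq
  set g₀ := h.choose
  have h1 : f w - y = (1 - t) • (f w - g₀ w) + t • (f w - g w) := by
    rw [← heq]; module
  have hw' := frontier_subset_closure hw
  have h2 : ‖f w - y‖ ≤ (1 - t) * ‖f w - g₀ w‖ + t * ‖f w - g w‖ := by
    rw [h1]
    refine (norm_add_le _ _).trans (le_of_eq ?_)
    rw [norm_smul, norm_smul, Real.norm_of_nonneg ht.1, Real.norm_of_nonneg (by linarith [ht.2])]
  have h3 := (hc₀ w hw').trans_le (hr₀ w hw)
  have h4 := (hc₁ w hw').trans_le (hr₁ w hw)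
  rcases ht.1.eq_or_lt with h0 | h0
  · rw [← h0] at h2; linarith
  · nlinarith [mul_le_mul_of_nonneg_left h3.le (sub_nonneg.2 ht.2), mul_lt_mul_of_pos_left h4 h0]

/-- Homotopy invariance of the Brouwer degree, along segments. -/
theorem brouwerDegree_eq_of_segment {Ω : Set E} (hΩ : IsOpen Ω) (hb : Bornology.IsBounded Ω)
    {y : E} {f₀ f₁ : E → E} (hf₀ : ContinuousOn f₀ (closure Ω)) (hf₁ : ContinuousOn f₁ (closure Ω))
    (h0 : ∀ t ∈ Icc (0 : ℝ) 1, ∀ w ∈ frontier Ω, f₀ w + t • (f₁ w - f₀ w) ≠ y) :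
    brouwerDegree f₀ Ω y = brouwerDegree f₁ Ω y := by
  obtain ⟨m, hm, hmK⟩ := exists_pos_le_norm_segment (f := fun z => f₀ z - y)
    (h := fun z => f₁ z - f₀ z) (frontier_isCompact hb)
    ((hf₀.mono frontier_subset_closure).sub continuousOn_const)
    ((hf₁.sub hf₀).mono frontier_subset_closure) (by
      intro t ht w hw h
      apply h0 t ht w hw
      rw [← sub_eq_zero, ← h]
      abel)
  obtain ⟨g₀, hg₀, hc₀, hr₀⟩ := exists_contDiff_regular_norm_sub_lt isClosed_closure hf₀ y hm
  obtain ⟨g₁, hg₁, hc₁, hr₁⟩ := exists_contDiff_regular_norm_sub_lt isClosed_closure hf₁ y hm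
  have a₀ : IsRegularApprox f₀ Ω y g₀ :=
    ⟨hg₀, ⟨m, fun w hw => by simpa using hmK 0 (by simp) w hw, hc₀⟩, fun z _ h => hr₀ z h⟩
  have a₁ : IsRegularApprox f₁ Ω y g₁ :=
    ⟨hg₁, ⟨m, fun w hw => by simpa using hmK 1 (by simp) w hw, hc₁⟩, fun z _ h => hr₁ z h⟩
  rw [a₀.brouwerDegree_eq hΩ hb, a₁.brouwerDegree_eq hΩ hb]
  refine signedCount_eq_of_segment hΩ hb hg₀ hg₁ ?_ a₀.regular a₁.regular
  intro t ht w hw heq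
  have h1 : f₀ w - y + t • (f₁ w - f₀ w) = (1 - t) • (f₀ w - g₀ w) + t • (f₁ w - g₁ w) := by
    rw [← heq]; module
  have hw' := frontier_subset_closure hw
  have h2 : ‖f₀ w - y + t • (f₁ w - f₀ w)‖ ≤ (1 - t) * ‖f₀ w - g₀ w‖ + t * ‖f₁ w - g₁ w‖ := by
    rw [h1]
    refine (norm_add_le _ _).trans (le_of_eq ?_)
    rw [norm_smul, norm_smul, Real.norm_of_nonneg ht.1, Real.norm_of_nonneg (by linarith [ht.2])]
  have h3 := hc₀ w hw'
  have h4 := hc₁ w hw'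
  have h5 : m ≤ ‖f₀ w - y + t • (f₁ w - f₀ w)‖ := hmK t ht w hw
  rcases ht.1.eq_or_lt with h0 | h0
  · rw [← h0] at h2 h5; linarith
  · nlinarith [mul_le_mul_of_nonneg_left h3.le (sub_nonneg.2 ht.2), mul_lt_mul_of_pos_left h4 h0]

theorem brouwerDegree_linear_comp {Ω : Set E} (hΩ : IsOpen Ω) (hb : Bornology.IsBounded Ω)
    {f : E → E} (hf : ContinuousOn f (closure Ω)) (h0 : ∀ w ∈ frontier Ω, f w ≠ 0)
    {T : E →L[ℝ] E} (hT : T.det ≠ 0) :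
    brouwerDegree (fun z => T (f z)) Ω 0 =
      ((SignType.sign T.det : SignType) : ℤ) * brouwerDegree f Ω 0 := by
  have hinj : Function.Injective T := by
    obtain ⟨C, hC⟩ := exists_antilipschitzWith_of_det_ne_zero hT
    exact hC.injective
  have hT0 : ∀ u, T u = 0 → u = 0 := fun u hu => hinj (by rw [hu, map_zero])
  obtain ⟨m, hm, hmK⟩ := exists_pos_le_norm_sub (frontier_isCompact hb)
    (hf.mono frontier_subset_closure) h0
  obtain ⟨m', hm', hmK'⟩ := exists_pos_le_norm_sub (f := fun z => T (f z)) (y := 0)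
    (frontier_isCompact hb) (T.continuous.comp_continuousOn (hf.mono frontier_subset_closure))
    (fun w hw h => h0 w hw (hT0 _ h))
  have hδ : 0 < min m (m' / (‖T‖ + 1)) := lt_min hm (by positivity)
  obtain ⟨g, hg, hc, hr⟩ := exists_contDiff_regular_norm_sub_lt isClosed_closure hf 0 hδ
  have a : IsRegularApprox f Ω 0 g :=
    ⟨hg, ⟨m, hmK, fun z hz => (hc z hz).trans_le (min_le_left _ _)⟩, fun z _ h => hr z h⟩
  have hfd : ∀ z, fderiv ℝ (fun z => T (g z)) z = T.comp (fderiv ℝ g z) := fun z =>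
    (T.hasFDerivAt.comp z ((hg.differentiable (by simp)) z).hasFDerivAt).fderiv
  have hdet : ∀ z, (fderiv ℝ (fun z => T (g z)) z).det = T.det * (fderiv ℝ g z).det := by
    intro z
    rw [hfd]
    exact LinearMap.det_comp _ _
  have a' : IsRegularApprox (fun z => T (f z)) Ω 0 (fun z => T (g z)) := by
    refine ⟨T.contDiff.comp hg, ⟨m', hmK', fun z hz => ?_⟩, fun z _ h => ?_⟩
    · rw [← map_sub]
      have h1 := (hc z hz).trans_le (min_le_right _ _)
      rw [lt_div_iff₀ (by positivity)] at h1
      nlinarith [T.le_opNorm (f z - g z), norm_nonneg (f z - g z), norm_nonneg T]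
    · rw [hdet]
      exact mul_ne_zero hT (hr z (hT0 _ h))
  rw [a.brouwerDegree_eq hΩ hb, a'.brouwerDegree_eq hΩ hb, signedCount, signedCount,
    mul_finsum_mem]
  have hset : {z | z ∈ Ω ∧ T (g z) = 0} = {z | z ∈ Ω ∧ g z = 0} := by
    ext z
    exact and_congr_right fun _ => ⟨hT0 _, fun h => by rw [h, map_zero]⟩
  rw [hset]
  refine finsum_mem_congr rfl fun z _ => ?_
  rw [hdet, sign_mul, SignType.coe_mul]

theorem brouwerDegree_excision {Ω Ω' : Set E} (hΩ : IsOpen Ω) (hb : Bornology.IsBounded Ω)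
    (hΩ' : IsOpen Ω') (hsub : Ω' ⊆ Ω)
    {f : E → E} (hf : ContinuousOn f (closure Ω)) {y : E}
    (h0 : ∀ w ∈ closure Ω \ Ω', f w ≠ y) :
    brouwerDegree f Ω y = brouwerDegree f Ω' y := by
  obtain ⟨m, hm, hmK⟩ := exists_pos_le_norm_sub (hb.isCompact_closure.diff hΩ')
    (hf.mono sdiff_subset) h0
  obtain ⟨g, hg, hc, hr⟩ := exists_contDiff_regular_norm_sub_lt isClosed_closure hf y hm
  have a : IsRegularApprox f Ω y g := by
    refine ⟨hg, ⟨m, fun w hw => hmK w ⟨frontier_subset_closure hw, fun h => ?_⟩, hc⟩,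
      fun z _ h => hr z h⟩
    rw [hΩ.frontier_eq] at hw
    exact hw.2 (hsub h)
  have a' : IsRegularApprox f Ω' y g := by
    refine ⟨hg, ⟨m, fun w hw => hmK w ?_, fun z hz => hc z (closure_mono hsub hz)⟩,
      fun z _ h => hr z h⟩
    rw [hΩ'.frontier_eq] at hw
    exact ⟨closure_mono hsub hw.1, hw.2⟩
  rw [a.brouwerDegree_eq hΩ hb, a'.brouwerDegree_eq hΩ' (hb.subset hsub), signedCount, signedCount]
  congr 1
  ext z
  have hset : z ∈ {z | z ∈ Ω ∧ g z = y} ↔ z ∈ {z | z ∈ Ω' ∧ g z = y} := by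
    refine ⟨fun h => ⟨?_, h.2⟩, fun h => ⟨hsub h.1, h.2⟩⟩
    by_contra hne
    have h1 := hmK z ⟨subset_closure h.1, hne⟩
    have h2 := hc z (subset_closure h.1)
    rw [h.2] at h2
    linarith
  simp only [hset]

end Brouwer

section Reduction

variable {E F : Type*} [NormedAddCommGroup E] [NormedSpace ℝ E] [FiniteDimensional ℝ E]
  [NormedAddCommGroup F] [NormedSpace ℝ F] [FiniteDimensional ℝ F]

/-- The Weinstein–Aronszajn identity for linear maps. -/
theorem det_id_sub_comp_comm (A : F →ₗ[ℝ] E) (B : E →ₗ[ℝ] F) :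
    LinearMap.det (LinearMap.id - A ∘ₗ B) = LinearMap.det (LinearMap.id - B ∘ₗ A) := by
  classical
  let b := finBasis ℝ E
  let c := finBasis ℝ F
  rw [← LinearMap.det_toMatrix b, ← LinearMap.det_toMatrix c]
  simp only [map_sub, LinearMap.toMatrix_id, LinearMap.toMatrix_comp b c b,
    LinearMap.toMatrix_comp c b c]
  exact Matrix.det_one_sub_mul_comm _ _

/-- A map `id - k` whose nonlinear part `k` has values in a subspace `F` has the same degree on
the whole space as on `F`. -/
theorem brouwerDegree_reduction {Ω : Set E} (hΩ : IsOpen Ω) (hb : Bornology.IsBounded Ω)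
    (j : F →ₗᵢ[ℝ] E) {k : E → F} (hk : ContinuousOn k (closure Ω)) {y : F}
    (h0 : ∀ w ∈ frontier Ω, w - j (k w) ≠ j y) :
    brouwerDegree (fun z : F => z - k (j z)) (j ⁻¹' Ω) y =
      brouwerDegree (fun z : E => z - j (k z)) Ω (j y) := by
  have hjc : Continuous j := j.continuous
  have hΩF : IsOpen (j ⁻¹' Ω) := hΩ.preimage hjc
  have hbF : Bornology.IsBounded (j ⁻¹' Ω) := j.antilipschitz.isBounded_preimage hb
  obtain ⟨m, hm, hmK⟩ := exists_pos_le_norm_sub (f := fun w => w - j (k w)) (frontier_isCompact hb)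
    (continuousOn_id.sub (hjc.comp_continuousOn (hk.mono frontier_subset_closure))) h0
  obtain ⟨k₁, hk₁, hkc₁⟩ := exists_contDiff_norm_sub_lt isClosed_closure hk (half_pos hm)
  have hg₁ : ContDiff ℝ ∞ fun z : F => z - k₁ (j z) :=
    contDiff_id.sub (hk₁.comp j.contDiff)
  obtain ⟨c, hc, hreg⟩ := exists_regular_value hg₁ y (half_pos hm)
  let k₂ : E → F := fun z => k₁ z + c
  have hk₂ : ContDiff ℝ ∞ k₂ := hk₁.add contDiff_const
  have hkc₂ : ∀ z ∈ closure Ω, ‖k z - k₂ z‖ < m := by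
    intro z hz
    calc ‖k z - k₂ z‖ = ‖(k z - k₁ z) - c‖ := by simp only [k₂]; congr 1; abel
      _ ≤ ‖k z - k₁ z‖ + ‖c‖ := norm_sub_le _ _
      _ < m := by linarith [hkc₁ z hz]
  have hdk : ∀ z, HasFDerivAt k₂ (fderiv ℝ k₂ z) z := fun z =>
    ((hk₂.differentiable (by simp)) z).hasFDerivAt
  have hF : ∀ z : F, HasFDerivAt (fun z : F => z - k₂ (j z))
      (ContinuousLinearMap.id ℝ F -
        (fderiv ℝ k₂ (j z)).comp j.toContinuousLinearMap) z := fun z =>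
    (hasFDerivAt_id z).sub ((hdk (j z)).comp z j.toContinuousLinearMap.hasFDerivAt)
  have hE : ∀ z : E, HasFDerivAt (fun z : E => z - j (k₂ z))
      (ContinuousLinearMap.id ℝ E -
        j.toContinuousLinearMap.comp (fderiv ℝ k₂ z)) z := fun z =>
    (hasFDerivAt_id z).sub (j.toContinuousLinearMap.hasFDerivAt.comp z (hdk z))
  -- the solutions in `E` lie in `F`, and the two Jacobian determinants agree there
  have hdet : ∀ z : F, (fderiv ℝ (fun z : E => z - j (k₂ z)) (j z)).det =
      (fderiv ℝ (fun z : F => z - k₂ (j z)) z).det := by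
    intro z
    rw [(hF z).fderiv, (hE (j z)).fderiv]
    exact det_id_sub_comp_comm j.toLinearMap (fderiv ℝ k₂ (j z)).toLinearMap
  have hregF : ∀ z : F, z - k₂ (j z) = y → (fderiv ℝ (fun z : F => z - k₂ (j z)) z).det ≠ 0 := by
    intro z hz
    have h1 : (fun z : F => z - k₂ (j z)) = fun z => (z - k₁ (j z)) - c := by
      ext z; simp only [k₂]; abel
    rw [h1, fderiv_sub_const]
    apply hreg
    rw [← hz]; simp only [k₂]; abel
  have hsol : ∀ z : E, z - j (k₂ z) = j y → ∃ u : F, j u = z ∧ u - k₂ (j u) = y := by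
    intro z hz
    have hz' : j (y + k₂ z) = z := by rw [map_add, ← hz]; abel
    exact ⟨y + k₂ z, hz', by rw [hz']; abel⟩
  have aF : IsRegularApprox (fun z : F => z - k (j z)) (j ⁻¹' Ω) y (fun z : F => z - k₂ (j z)) := by
    refine ⟨contDiff_id.sub (hk₂.comp j.contDiff), ⟨m, fun w hw => ?_, fun z hz => ?_⟩,
      fun z _ h => hregF z h⟩
    · have := hmK (j w) (hjc.frontier_preimage_subset Ω hw)
      rwa [← map_sub, ← map_sub, j.norm_map] at this
    · rw [sub_sub_sub_cancel_left, norm_sub_rev]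
      exact hkc₂ (j z) (hjc.closure_preimage_subset Ω hz)
  have aE : IsRegularApprox (fun z : E => z - j (k z)) Ω (j y) (fun z : E => z - j (k₂ z)) := by
    refine ⟨contDiff_id.sub (j.contDiff.comp hk₂), ⟨m, hmK, fun z hz => ?_⟩, fun z _ h => ?_⟩
    · rw [sub_sub_sub_cancel_left, norm_sub_rev, ← map_sub, j.norm_map]
      exact hkc₂ z hz
    · obtain ⟨u, rfl, hu⟩ := hsol z h
      rw [hdet]
      exact hregF u hu
  rw [aF.brouwerDegree_eq hΩF hbF, aE.brouwerDegree_eq hΩ hb, signedCount, signedCount]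
  refine finsum_mem_eq_of_bijOn j ⟨fun z hz => ⟨hz.1, ?_⟩, j.injective.injOn, fun z hz => ?_⟩
    fun z _ => by rw [hdet]
  · rw [← hz.2, map_sub]
  · obtain ⟨u, rfl, hu⟩ := hsol z hz.2
    exact ⟨u, ⟨hz.1, hu⟩, rfl⟩

end Reduction

/-! ### The Leray-Schauder degree -/

theorem IsIdAddCompactOn.continuousOn {V : Type*} [NormedAddCommGroup V] {Φ : V → V} {S : Set V}
    (h : IsIdAddCompactOn Φ S) : ContinuousOn Φ S :=
  (continuousOn_id.sub h.1).congr fun z _ => (sub_sub_cancel z (Φ z)).symm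

theorem IsIdAddCompactOn.mono {V : Type*} [NormedAddCommGroup V] {Φ : V → V} {S S' : Set V}
    (h : IsIdAddCompactOn Φ S) (hS : S' ⊆ S) : IsIdAddCompactOn Φ S' :=
  ⟨h.1.mono hS, h.2.closure_of_subset ((image_mono hS).trans subset_closure)⟩

/-- A compact perturbation of the identity that omits the value `y` on a closed set stays at
positive distance from it there. -/
theorem IsIdAddCompactOn.exists_pos_le_norm_sub {V : Type*} [NormedAddCommGroup V]
    {Φ : V → V} {C : Set V}
    (h : IsIdAddCompactOn Φ C) (hC : IsClosed C) {y : V} (h0 : ∀ w ∈ C, Φ w ≠ y) :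
    ∃ m > 0, ∀ w ∈ C, m ≤ ‖Φ w - y‖ := by
  by_contra! hne
  have hseq : ∀ n : ℕ, ∃ w ∈ C, ‖Φ w - y‖ < 1 / ((n : ℝ) + 1) := fun n =>
    hne _ Nat.one_div_pos_of_nat
  choose w hwC hw using hseq
  have hlim : Filter.Tendsto (fun n => Φ (w n)) Filter.atTop (𝓝 y) := by
    rw [tendsto_iff_norm_sub_tendsto_zero]
    exact squeeze_zero (fun _ => norm_nonneg _) (fun n => (hw n).le)
      tendsto_one_div_add_atTop_nhds_zero_nat
  obtain ⟨u, -, s, hs, hsu⟩ := h.2.tendsto_subseq (x := fun n => w n - Φ (w n))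
    fun n => subset_closure (mem_image_of_mem _ (hwC n))
  have hw' : Filter.Tendsto (fun n => w (s n)) Filter.atTop (𝓝 (u + y)) := by
    have := hsu.add (hlim.comp hs.tendsto_atTop)
    simpa [Function.comp_def] using this
  have hmem : u + y ∈ C := hC.mem_of_tendsto hw' (Filter.Eventually.of_forall fun n => hwC _)
  refine h0 _ hmem (tendsto_nhds_unique ?_ (hlim.comp hs.tendsto_atTop))
  exact (h.continuousOn _ hmem).tendsto.comp
    (tendsto_nhdsWithin_iff.2 ⟨hw', Filter.Eventually.of_forall fun n => hwC _⟩)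

section LeraySchauder

variable {V : Type*} [NormedAddCommGroup V] [NormedSpace ℝ V]

theorem IsLSAdmissible.exists_pos_le {Φ : V → V} {Ω : Set V} {y : V} (h : IsLSAdmissible Φ Ω y) :
    ∃ m > 0, ∀ w ∈ frontier Ω, m ≤ ‖Φ w - y‖ :=
  (h.compact.mono frontier_subset_closure).exists_pos_le_norm_sub isClosed_frontier h.boundary

/-- On the boundary, the segment between two finite-dimensional approximations avoids `y`. -/
theorem FiniteDimApprox.ne {Φ : V → V} {Ω : Set V} {y : V} (A : FiniteDimApprox Φ Ω y) {t : ℝ}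
    (A' : FiniteDimApprox Φ Ω y) (ht : t ∈ Icc (0 : ℝ) 1) {w : V} (hw : w ∈ frontier Ω) :
    w - (A.k w : V) + t • ((A.k w : V) - A'.k w) ≠ y := by
  intro heq
  obtain ⟨r₀, hr₀, hc₀⟩ := A.close
  obtain ⟨r₁, hr₁, hc₁⟩ := A'.close
  have h1 : Φ w - y = -((1 - t) • ((w - Φ w) - (A.k w : V)) + t • ((w - Φ w) - (A'.k w : V))) := by
    refine (congrArg (fun u => Φ w - u) heq.symm).trans ?_
    module
  have hw' := frontier_subset_closure hw
  have h2 : ‖Φ w - y‖ ≤ (1 - t) * ‖(w - Φ w) - (A.k w : V)‖ + t * ‖(w - Φ w) - (A'.k w : V)‖ := by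
    rw [h1, norm_neg]
    refine (norm_add_le _ _).trans (le_of_eq ?_)
    rw [norm_smul, norm_smul, Real.norm_of_nonneg ht.1, Real.norm_of_nonneg (by linarith [ht.2])]
  have h3 := (hc₀ w hw').trans_le (hr₀ w hw)
  have h4 := (hc₁ w hw').trans_le (hr₁ w hw)
  rcases ht.1.eq_or_lt with h0 | h0
  · rw [← h0] at h2; linarith
  · nlinarith [mul_le_mul_of_nonneg_left h3.le (sub_nonneg.2 ht.2), mul_lt_mul_of_pos_left h4 h0]

theorem isBounded_coe_preimage {Ω : Set V} (hb : Bornology.IsBounded Ω) (G : Submodule ℝ V) :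
    Bornology.IsBounded {z : G | (z : V) ∈ Ω} :=
  G.subtypeₗᵢ.antilipschitz.isBounded_preimage hb

theorem mem_closure_of_mem_coe_preimage {Ω : Set V} {G : Submodule ℝ V} {z : G}
    (hz : z ∈ closure {z : G | (z : V) ∈ Ω}) : (z : V) ∈ closure Ω :=
  continuous_subtype_val.closure_preimage_subset Ω hz

theorem mem_frontier_of_mem_coe_preimage {Ω : Set V} {G : Submodule ℝ V} {z : G}
    (hz : z ∈ frontier {z : G | (z : V) ∈ Ω}) : (z : V) ∈ frontier Ω :=
  continuous_subtype_val.frontier_preimage_subset Ω hz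

/-- The degree of an approximation may be computed in any larger finite-dimensional subspace. -/
theorem FiniteDimApprox.degree_eq_of_le {Φ : V → V} {Ω : Set V} {y : V} (hΩ : IsOpen Ω)
    (hb : Bornology.IsBounded Ω) (A : FiniteDimApprox Φ Ω y) {G : Submodule ℝ V}
    [FiniteDimensional ℝ G] (hG : A.F ≤ G) :
    A.degree = brouwerDegree (fun z : G => z - Submodule.inclusion hG (A.k z))
      {z : G | (z : V) ∈ Ω} (Submodule.inclusion hG A.point) := by
  have := A.finiteDimensional
  let j : A.F →ₗᵢ[ℝ] G := ⟨Submodule.inclusion hG, fun _ => rfl⟩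
  refine brouwerDegree_reduction (hΩ.preimage continuous_subtype_val)
    (isBounded_coe_preimage hb G) j (k := fun z : G => A.k z) ?_ ?_
  · exact A.continuousOn.comp continuous_subtype_val.continuousOn
      fun z hz => mem_closure_of_mem_coe_preimage hz
  · intro w hw heq
    have h1 := A.ne A (t := 0) (by simp) (mem_frontier_of_mem_coe_preimage hw)
    apply h1
    rw [zero_smul, add_zero]
    exact (congrArg Subtype.val heq).trans A.point_eq

/-- All finite-dimensional approximations have the same degree. -/
theorem FiniteDimApprox.degree_eq {Φ : V → V} {Ω : Set V} {y : V} (hΩ : IsOpen Ω)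
    (hb : Bornology.IsBounded Ω) (A A' : FiniteDimApprox Φ Ω y) : A.degree = A'.degree := by
  have := A.finiteDimensional
  have := A'.finiteDimensional
  have hy : Submodule.inclusion (le_sup_right : A'.F ≤ A.F ⊔ A'.F) A'.point =
      Submodule.inclusion (le_sup_left : A.F ≤ A.F ⊔ A'.F) A.point :=
    Subtype.ext (A'.point_eq.trans A.point_eq.symm)
  rw [A.degree_eq_of_le hΩ hb (G := A.F ⊔ A'.F) le_sup_left,
    A'.degree_eq_of_le hΩ hb (G := A.F ⊔ A'.F) le_sup_right, hy]
  have hcl : MapsTo (Subtype.val : ↥(A.F ⊔ A'.F) → V)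
      (closure {z : ↥(A.F ⊔ A'.F) | (z : V) ∈ Ω}) (closure Ω) :=
    fun z hz => mem_closure_of_mem_coe_preimage hz
  refine brouwerDegree_eq_of_segment (hΩ.preimage continuous_subtype_val)
    (isBounded_coe_preimage hb _) ?_ ?_ ?_
  · refine continuousOn_id.sub (Continuous.comp_continuousOn ?_
      (A.continuousOn.comp continuous_subtype_val.continuousOn hcl))
    exact LinearMap.continuous_of_finiteDimensional _
  · refine continuousOn_id.sub (Continuous.comp_continuousOn ?_
      (A'.continuousOn.comp continuous_subtype_val.continuousOn hcl))
    exact LinearMap.continuous_of_finiteDimensional _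
  · intro t ht w hw heq
    apply A.ne A' ht (mem_frontier_of_mem_coe_preimage hw)
    have h2 : (w : V) - A.k w + t • ((w : V) - A'.k w - ((w : V) - A.k w)) = A.point :=
      congrArg Subtype.val heq
    refine Eq.trans ?_ (h2.trans A.point_eq)
    module

theorem FiniteDimApprox.lsDegree_eq {Φ : V → V} {Ω : Set V} {y : V} (hΩ : IsOpen Ω)
    (hb : Bornology.IsBounded Ω) (A : FiniteDimApprox Φ Ω y) : lsDegree Φ Ω y = A.degree := by
  have h : Nonempty (FiniteDimApprox Φ Ω y) := ⟨A⟩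
  rw [lsDegree, dif_pos h]
  exact FiniteDimApprox.degree_eq hΩ hb _ _

/-- The Schauder projection: compact maps are uniform limits of maps with values in
finite-dimensional subspaces. -/
theorem exists_finiteDim_approx {K : V → V} {S : Set V} (hK : IsCompactMapOn K S)
    {F₀ : Submodule ℝ V} [FiniteDimensional ℝ F₀] {δ : ℝ} (hδ : 0 < δ) :
    ∃ F : Submodule ℝ V, FiniteDimensional ℝ F ∧ F₀ ≤ F ∧ ∃ k : V → F, ContinuousOn k S ∧
      ∀ z ∈ S, ‖K z - (k z : V)‖ < δ := by
  obtain ⟨N, -, hNf, hcov⟩ := hK.2.finite_cover_balls hδ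
  set t := hNf.toFinset
  let F : Submodule ℝ V := F₀ ⊔ Submodule.span ℝ (t : Set V)
  have hmem : ∀ v ∈ t, v ∈ F := fun v hv =>
    Submodule.mem_sup_right (Submodule.subset_span hv)
  let φ : V → V → ℝ := fun v u => max 0 (δ - ‖u - v‖)
  have hφ : ∀ v, Continuous (φ v) := fun v => by fun_prop
  have hφ0 : ∀ v u, 0 ≤ φ v u := fun v u => le_max_left _ _
  let σ : V → ℝ := fun u => ∑ v ∈ t, φ v u
  have hσ : Continuous σ := continuous_finsetSum _ fun v _ => hφ v
  have hσpos : ∀ z ∈ S, 0 < σ (K z) := by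
    intro z hz
    have h1 := hcov (subset_closure (mem_image_of_mem K hz))
    obtain ⟨v, hv, hvz⟩ := mem_iUnion₂.1 h1
    rw [mem_ball, dist_eq_norm] at hvz
    refine Finset.sum_pos' (fun v _ => hφ0 v _) ⟨v, by simpa [t] using hv, ?_⟩
    exact lt_max_of_lt_right (sub_pos.2 hvz)
  let k : V → F := fun z => ∑ v ∈ t.attach, (φ v (K z) / σ (K z)) • (⟨v, hmem v v.2⟩ : F)
  have hkv : ∀ z, (k z : V) = ∑ v ∈ t, (φ v (K z) / σ (K z)) • v := by
    intro z
    simp only [k, Submodule.coe_sum, Submodule.coe_smul]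
    exact Finset.sum_attach t fun v => (φ v (K z) / σ (K z)) • v
  refine ⟨F, inferInstance, le_sup_left, k, ?_, fun z hz => ?_⟩
  · refine continuousOn_finsetSum _ fun v _ => ?_
    exact (((hφ v).comp_continuousOn hK.1).div (hσ.comp_continuousOn hK.1)
      fun z hz => (hσpos z hz).ne').smul continuousOn_const
  · have hs := hσpos z hz
    have h1 : K z = ∑ v ∈ t, (φ v (K z) / σ (K z)) • K z := by
      rw [← Finset.sum_smul, ← Finset.sum_div, div_self hs.ne', one_smul]
    have h2 : K z - (k z : V) = ∑ v ∈ t, (φ v (K z) / σ (K z)) • (K z - v) := by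
      simp only [smul_sub, Finset.sum_sub_distrib]
      rw [← h1, hkv]
    rw [h2]
    have hterm : ∀ v, φ v (K z) ≠ 0 → ‖K z - v‖ < δ := by
      intro v hv
      by_contra hge
      exact hv (max_eq_left (by linarith [not_lt.1 hge]))
    have hle : ∀ v ∈ t, ‖(φ v (K z) / σ (K z)) • (K z - v)‖ ≤ (φ v (K z) / σ (K z)) * δ := by
      intro v _
      rw [norm_smul, Real.norm_of_nonneg (div_nonneg (hφ0 _ _) hs.le)]
      by_cases hv : φ v (K z) = 0
      · simp [hv]
      · exact mul_le_mul_of_nonneg_left (hterm v hv).le (div_nonneg (hφ0 _ _) hs.le)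
    obtain ⟨v₀, hv₀, hpos⟩ : ∃ v ∈ t, 0 < φ v (K z) := by
      by_contra! hne
      exact absurd hs (not_lt.2 (Finset.sum_nonpos hne))
    have hlt : ‖(φ v₀ (K z) / σ (K z)) • (K z - v₀)‖ < (φ v₀ (K z) / σ (K z)) * δ := by
      rw [norm_smul, Real.norm_of_nonneg (div_nonneg (hφ0 _ _) hs.le)]
      exact mul_lt_mul_of_pos_left (hterm v₀ hpos.ne') (div_pos hpos hs)
    calc ‖∑ v ∈ t, (φ v (K z) / σ (K z)) • (K z - v)‖
        ≤ ∑ v ∈ t, ‖(φ v (K z) / σ (K z)) • (K z - v)‖ := norm_sum_le _ _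
      _ < ∑ v ∈ t, (φ v (K z) / σ (K z)) * δ := Finset.sum_lt_sum hle ⟨v₀, hv₀, hlt⟩
      _ = δ := by rw [← Finset.sum_mul, ← Finset.sum_div, div_self hs.ne', one_mul]

/-- Approximations exist, with any prescribed accuracy and containing any prescribed
finite-dimensional subspace. -/
theorem IsLSAdmissible.exists_approx {Φ : V → V} {Ω : Set V} {y : V} (h : IsLSAdmissible Φ Ω y)
    (F₀ : Submodule ℝ V) [FiniteDimensional ℝ F₀] {δ : ℝ} (hδ : 0 < δ) :
    ∃ A : FiniteDimApprox Φ Ω y, F₀ ≤ A.F ∧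
      ∀ z ∈ closure Ω, ‖(z - Φ z) - (A.k z : V)‖ < δ := by
  obtain ⟨m, hm, hmK⟩ := h.exists_pos_le
  obtain ⟨F, hF, hF₀, k, hk, hkc⟩ := exists_finiteDim_approx h.compact
    (F₀ := F₀ ⊔ Submodule.span ℝ {y}) (lt_min hm hδ)
  have hy : y ∈ F := hF₀ (Submodule.mem_sup_right (Submodule.mem_span_singleton_self y))
  exact ⟨⟨F, hF, ⟨y, hy⟩, rfl, k, hk, m, hmK, fun z hz => (hkc z hz).trans_le (min_le_left _ _)⟩,
    le_sup_left.trans hF₀, fun z hz => (hkc z hz).trans_le (min_le_right _ _)⟩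

/-- The degree is locally constant in `Φ`: an approximation of `Φ` that is accurate up to `m / 4` is
also an approximation of each nearby `Φ'`. -/
theorem lsDegree_eq_of_near {Φ Φ' : V → V} {Ω : Set V} {y : V} (h : IsLSAdmissible Φ Ω y)
    {m : ℝ} (hm : 0 < m) (hmK : ∀ w ∈ frontier Ω, m ≤ ‖Φ w - y‖)
    (hnear : ∀ z ∈ closure Ω, ‖Φ z - Φ' z‖ ≤ m / 4) :
    lsDegree Φ' Ω y = lsDegree Φ Ω y := by
  obtain ⟨A, -, hA⟩ := h.exists_approx ⊥ (δ := m / 4) (by positivity)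
  let A' : FiniteDimApprox Φ' Ω y :=
    { F := A.F
      finiteDimensional := A.finiteDimensional
      point := A.point
      point_eq := A.point_eq
      k := A.k
      continuousOn := A.continuousOn
      close := by
        refine ⟨3 * m / 4, fun w hw => ?_, fun z hz => ?_⟩
        · have h1 := hmK w hw
          have h2 := hnear w (frontier_subset_closure hw)
          have h3 : ‖Φ w - y‖ ≤ ‖Φ w - Φ' w‖ + ‖Φ' w - y‖ := norm_sub_le_norm_sub_add_norm_sub ..
          linarith
        · have h1 := hA z hz
          have h2 := hnear z hz
          have h3 : z - Φ' z - (A.k z : V) = (z - Φ z - (A.k z : V)) + (Φ z - Φ' z) := by abel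
          rw [h3]
          linarith [norm_add_le (z - Φ z - (A.k z : V)) (Φ z - Φ' z)] }
  rw [A.lsDegree_eq h.isOpen h.bounded, A'.lsDegree_eq h.isOpen h.bounded]
  rfl

theorem lsDegree_excision {Φ : V → V} {Ω Ω' : Set V} {y : V} (h : IsLSAdmissible Φ Ω y)
    (hΩ' : IsOpen Ω') (hsub : Ω' ⊆ Ω) (h0 : ∀ w ∈ closure Ω \ Ω', Φ w ≠ y) :
    lsDegree Φ Ω y = lsDegree Φ Ω' y := by
  have hcl : IsClosed (closure Ω \ Ω') := isClosed_closure.sdiff hΩ'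
  obtain ⟨m, hm, hmK⟩ := (h.compact.mono sdiff_subset).exists_pos_le_norm_sub hcl h0
  obtain ⟨A, -, hA⟩ := h.exists_approx ⊥ (δ := m) hm
  have := A.finiteDimensional
  let A' : FiniteDimApprox Φ Ω' y :=
    { F := A.F
      finiteDimensional := A.finiteDimensional
      point := A.point
      point_eq := A.point_eq
      k := A.k
      continuousOn := A.continuousOn.mono (closure_mono hsub)
      close := by
        refine ⟨m, fun w hw => hmK w ?_, fun z hz => hA z (closure_mono hsub hz)⟩
        rw [hΩ'.frontier_eq] at hw
        exact ⟨closure_mono hsub hw.1, hw.2⟩ }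
  rw [A.lsDegree_eq h.isOpen h.bounded, A'.lsDegree_eq hΩ' (h.bounded.subset hsub)]
  refine brouwerDegree_excision (h.isOpen.preimage continuous_subtype_val)
    (isBounded_coe_preimage h.bounded _) (hΩ'.preimage continuous_subtype_val)
    (fun z hz => hsub hz) ?_ ?_
  · exact continuousOn_id.sub (A.continuousOn.comp continuous_subtype_val.continuousOn
      fun z hz => mem_closure_of_mem_coe_preimage hz)
  · rintro w ⟨hw, hw'⟩ heq
    have hwc := mem_closure_of_mem_coe_preimage hw
    have h1 := hmK w ⟨hwc, hw'⟩
    have h2 := hA w hwc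
    have h3 : (w : V) - A.k w = y := (congrArg Subtype.val heq).trans A.point_eq
    have h4 : Φ w - y = -((w : V) - Φ w - A.k w) := by
      refine (congrArg (fun u => Φ w - u) h3.symm).trans ?_
      abel
    rw [h4, norm_neg] at h1
    linarith

theorem IsLSAdmissible.linear_comp {Φ : V → V} {Ω : Set V} (h : IsLSAdmissible Φ Ω 0)
    {T : V →L[ℝ] V} (hT : IsCompactOperator (T - 1 : V →L[ℝ] V)) (hinj : Function.Injective T) :
    IsLSAdmissible (fun z => T (Φ z)) Ω 0 := by
  refine ⟨h.isOpen, h.bounded, ⟨?_, ?_⟩, fun w hw heq => h.boundary w hw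
    (hinj (by rw [map_zero]; exact heq))⟩
  · exact continuousOn_id.sub (T.continuous.comp_continuousOn h.compact.continuousOn)
  · obtain ⟨C, hC, hCsub⟩ := IsCompactOperator.image_subset_compact_of_bounded
      (f := (T - 1 : V →L[ℝ] V).toLinearMap) hT h.bounded.closure
    set K₁ := closure ((fun z => z - Φ z) '' closure Ω) with hK₁
    have hcomp : IsCompact ((fun p : V × V => T p.1 - p.2) '' (K₁ ×ˢ C)) :=
      (h.compact.2.prod hC).image ((T.continuous.comp continuous_fst).sub continuous_snd)
    refine hcomp.closure_of_subset ?_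
    rintro _ ⟨z, hz, rfl⟩
    refine ⟨(z - Φ z, (T - 1) z), ⟨subset_closure (mem_image_of_mem _ hz),
      hCsub (mem_image_of_mem _ hz)⟩, ?_⟩
    simp

theorem isCompactOperator_of_forall_mem {R : V →L[ℝ] V} (N : Submodule ℝ V)
    [FiniteDimensional ℝ N] (hR : ∀ v, R v ∈ N) : IsCompactOperator R :=
  IsCompactOperator.clm_comp (f := R.codRestrict N hR)
    (isCompactOperator_of_locallyCompactSpace_dom (R.codRestrict N hR)) N.subtypeL

/-- The Leray-Schauder degree is multiplied by the sign of the determinant of a linear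
isomorphism that differs from the identity by an operator with range in a finite-dimensional
subspace `N`. -/
theorem lsDegree_linear_comp_of_finiteDim {Φ : V → V} {Ω : Set V} (h : IsLSAdmissible Φ Ω 0)
    {T : V →L[ℝ] V} (hinj : Function.Injective T) (N : Submodule ℝ V) [FiniteDimensional ℝ N]
    (hTN : ∀ v, T v - v ∈ N) (hN : ∀ v ∈ N, T v ∈ N) :
    lsDegree (fun z => T (Φ z)) Ω 0 =
      ((SignType.sign (LinearMap.det ((T : V →ₗ[ℝ] V).restrict hN)) : SignType) : ℤ) *
        lsDegree Φ Ω 0 := by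
  have hTc : IsCompactOperator (T - 1 : V →L[ℝ] V) := isCompactOperator_of_forall_mem N hTN
  have h' := h.linear_comp hTc hinj
  obtain ⟨m, hm, hmK⟩ := h'.exists_pos_le
  obtain ⟨A, hNA, hA⟩ := h.exists_approx N (δ := m / (‖T‖ + 1)) (by positivity)
  have := A.finiteDimensional
  have hAF : ∀ v ∈ A.F, T v ∈ A.F := fun v hv => by
    have := A.F.add_mem (hNA (hTN v)) hv
    rwa [sub_add_cancel] at this
  have hmemk : ∀ z, (z - T z) + T (A.k z) ∈ A.F := fun z => by
    refine A.F.add_mem ?_ (hAF _ (A.k z).2)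
    rw [← neg_sub]
    exact A.F.neg_mem (hNA (hTN z))
  let A' : FiniteDimApprox (fun z => T (Φ z)) Ω 0 :=
    { F := A.F
      finiteDimensional := A.finiteDimensional
      point := A.point
      point_eq := A.point_eq
      k := fun z => ⟨(z - T z) + T (A.k z), hmemk z⟩
      continuousOn := by
        rw [Topology.IsInducing.subtypeVal.continuousOn_iff]
        exact (continuousOn_id.sub T.continuous.continuousOn).add
          ((T.continuous.comp continuous_subtype_val).comp_continuousOn A.continuousOn)
      close := by
        refine ⟨m, hmK, fun z hz => ?_⟩
        have h1 := hA z hz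
        rw [lt_div_iff₀ (by positivity)] at h1
        have h2 : z - T (Φ z) - ((z - T z) + T (A.k z)) = T (z - Φ z - A.k z) := by
          simp only [map_sub]; abel
        change ‖z - T (Φ z) - ((z - T z) + T (A.k z))‖ < m
        rw [h2]
        nlinarith [T.le_opNorm (z - Φ z - A.k z), norm_nonneg (z - Φ z - A.k z), norm_nonneg T] }
  have hp : A.point = 0 := Subtype.ext A.point_eq
  let TF : A.F →L[ℝ] A.F := LinearMap.toContinuousLinearMap ((T : V →ₗ[ℝ] V).restrict hAF)
  -- `T` induces the identity on `A.F / N`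
  have hTFdet : TF.det = LinearMap.det ((T : V →ₗ[ℝ] V).restrict hN) := by
    let B : A.F →ₗ[ℝ] N := -((T - 1 : V →L[ℝ] V).toLinearMap.codRestrict N hTN ∘ₗ A.F.subtype)
    have h1 := det_id_sub_comp_comm (Submodule.inclusion hNA) B
    have e1 : LinearMap.id - Submodule.inclusion hNA ∘ₗ B = (T : V →ₗ[ℝ] V).restrict hAF := by
      ext v
      simp [B]
    have e2 : LinearMap.id - B ∘ₗ Submodule.inclusion hNA = (T : V →ₗ[ℝ] V).restrict hN := by
      ext v
      simp [B]
    rw [e1, e2] at h1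
    exact h1
  have hdet : TF.det ≠ 0 := by
    have : LinearMap.ker (TF : A.F →ₗ[ℝ] A.F) = ⊥ := by
      rw [LinearMap.ker_eq_bot]
      intro a b hab
      exact Subtype.ext (hinj (congrArg Subtype.val hab))
    intro h0
    exact (LinearMap.bot_lt_ker_of_det_eq_zero h0).ne this.symm
  have hfc : ContinuousOn (fun z : A.F => z - A.k z) (closure {z : A.F | (z : V) ∈ Ω}) :=
    continuousOn_id.sub (A.continuousOn.comp continuous_subtype_val.continuousOn
      fun z hz => mem_closure_of_mem_coe_preimage hz)
  have hne : ∀ w ∈ frontier {z : A.F | (z : V) ∈ Ω}, w - A.k w ≠ 0 := by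
    intro w hw heq
    apply A.ne A (t := 0) (by simp) (mem_frontier_of_mem_coe_preimage hw)
    have := congrArg Subtype.val heq
    simpa using this
  rw [A.lsDegree_eq h.isOpen h.bounded, A'.lsDegree_eq h.isOpen h.bounded,
    FiniteDimApprox.degree, FiniteDimApprox.degree, ← hTFdet]
  change brouwerDegree (fun z : A.F => z - (⟨((z : V) - T z) + T (A.k z), hmemk z⟩ : A.F))
    {z : A.F | (z : V) ∈ Ω} A.point = _ * brouwerDegree _ _ A.point
  rw [hp, ← brouwerDegree_linear_comp (h.isOpen.preimage continuous_subtype_val)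
    (isBounded_coe_preimage h.bounded _) hfc hne hdet]
  congr 1
  ext z
  simp only [TF, Submodule.coe_sub, LinearMap.coe_toContinuousLinearMap', map_sub,
    LinearMap.coe_restrict_apply, ContinuousLinearMap.coe_coe]
  abel

theorem isLSAdmissible_id_ball : IsLSAdmissible (fun z : V => z) (ball 0 1) 0 := by
  refine ⟨isOpen_ball, isBounded_ball, ⟨?_, ?_⟩, ?_⟩
  · simpa using continuousOn_const
  · refine (isCompact_singleton (x := (0 : V))).closure_of_subset ?_
    rintro _ ⟨z, -, rfl⟩
    simp
  · intro w hw h0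
    rw [h0, isOpen_ball.frontier_eq] at hw
    exact hw.2 (mem_ball_self one_pos)

theorem lsDegree_id_ball : lsDegree (fun z : V => z) (ball 0 1) 0 = 1 := by
  have h := isLSAdmissible_id_ball (V := V)
  obtain ⟨m, hm, hmK⟩ := h.exists_pos_le
  let A : FiniteDimApprox (fun z : V => z) (ball 0 1) 0 :=
    { F := ⊥
      finiteDimensional := inferInstance
      point := 0
      point_eq := rfl
      k := fun _ => 0
      continuousOn := continuousOn_const
      close := ⟨m, hmK, fun z _ => by simpa using hm⟩ }
  -- the approximation by the zero map with values in the zero subspace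
  rw [A.lsDegree_eq h.isOpen h.bounded, FiniteDimApprox.degree]
  change brouwerDegree (fun z : (⊥ : Submodule ℝ V) => z - 0) {z | (z : V) ∈ ball 0 1} 0 = 1
  have hr : IsRegularApprox (fun z : (⊥ : Submodule ℝ V) => z - 0) {z | (z : V) ∈ ball 0 1} 0
      (fun z => z) := by
    refine ⟨contDiff_id, ⟨m, fun w hw => ?_, fun z _ => by simpa using hm⟩, fun z _ _ => ?_⟩
    · simpa using hmK _ (mem_frontier_of_mem_coe_preimage hw)
    · rw [fderiv_fun_id, ContinuousLinearMap.det, ContinuousLinearMap.coe_id, LinearMap.det_id]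
      exact one_ne_zero
  rw [hr.brouwerDegree_eq (isOpen_ball.preimage continuous_subtype_val)
    (isBounded_coe_preimage isBounded_ball _), signedCount]
  have hset : {z : (⊥ : Submodule ℝ V) | z ∈ {z : (⊥ : Submodule ℝ V) | (z : V) ∈ ball 0 1} ∧
      z = 0} = {0} := by
    ext z
    simp only [mem_ofPred_eq, mem_singleton_iff]
    refine ⟨fun h => h.2, fun h => ⟨?_, h⟩⟩
    rw [h]
    simp
  rw [hset, finsum_mem_singleton, fderiv_fun_id, ContinuousLinearMap.det,
    ContinuousLinearMap.coe_id, LinearMap.det_id]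
  simp

end LeraySchauder

/-! ### Negative eigenvalues of compact perturbations of the identity -/

section Morse

variable {V : Type*} [NormedAddCommGroup V] [NormedSpace ℝ V]

/-- The sum of the generalized eigenspaces of `A` for its negative eigenvalues. -/
def negSpace (A : V →L[ℝ] V) : Submodule ℝ V :=
  ⨆ l ∈ Iio (0 : ℝ), Module.End.maxGenEigenspace (A : V →ₗ[ℝ] V) l

theorem maxGenEigenspace_le_negSpace (A : V →L[ℝ] V) {l : ℝ} (hl : l < 0) :
    Module.End.maxGenEigenspace (A : V →ₗ[ℝ] V) l ≤ negSpace A :=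
  le_iSup₂_of_le (f := fun l (_ : l ∈ Iio (0 : ℝ)) =>
    Module.End.maxGenEigenspace (A : V →ₗ[ℝ] V) l) l hl le_rfl

theorem sub_smul_mem_maxGenEigenspace (A : V →L[ℝ] V) (l μ : ℝ) {v : V}
    (hv : v ∈ Module.End.maxGenEigenspace (A : V →ₗ[ℝ] V) μ) :
    A v - l • v ∈ Module.End.maxGenEigenspace (A : V →ₗ[ℝ] V) μ := by
  have hc : Commute (A : V →ₗ[ℝ] V) ((A : V →ₗ[ℝ] V) - algebraMap ℝ (Module.End ℝ V) l) :=
    Algebra.mul_sub_algebraMap_commutes _ _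
  have := Module.End.mapsTo_maxGenEigenspace_of_comm hc μ hv
  simpa [Algebra.algebraMap_eq_smul_one] using this

theorem map_mem_negSpace (A : V →L[ℝ] V) {v : V} (hv : v ∈ negSpace A) : A v ∈ negSpace A := by
  refine Submodule.iSup_induction' (p := fun l => ⨆ _ : l ∈ Iio (0 : ℝ),
    Module.End.maxGenEigenspace (A : V →ₗ[ℝ] V) l) (motive := fun v _ => A v ∈ negSpace A)
    ?_ ?_ ?_ hv
  · intro l v hv
    by_cases hl : l < 0
    · rw [iSup_pos (show l ∈ Iio (0 : ℝ) from hl)] at hv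
      refine maxGenEigenspace_le_negSpace A hl ?_
      simpa using sub_smul_mem_maxGenEigenspace A 0 l hv
    · rw [iSup_neg (show ¬ l ∈ Iio (0 : ℝ) from hl), Submodule.mem_bot] at hv
      rw [hv, map_zero]
      exact zero_mem _
  · rw [map_zero]; exact zero_mem _
  · intro v w _ _ hv hw
    rw [map_add]
    exact add_mem hv hw

/-- The compactness argument of Riesz: there is no strictly increasing chain of invariant
finite-dimensional subspaces such that `A` acts on each quotient of consecutive ones as
multiplication with a nonpositive number. -/
theorem no_riesz_chain {A : V →L[ℝ] V} (hA : IsCompactOperator (A - 1 : V →L[ℝ] V))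
    (G : ℕ → Submodule ℝ V) (hfin : ∀ n, FiniteDimensional ℝ (G n))
    (hlt : ∀ n, G n < G (n + 1)) (hinv : ∀ n, ∀ v ∈ G n, A v ∈ G n)
    (hl : ∀ n, ∃ l : ℝ, l ≤ 0 ∧ ∀ v ∈ G (n + 1), A v - l • v ∈ G n) : False := by
  have hmono : Monotone G := monotone_nat_of_le_succ fun n => (hlt n).le
  have hu : ∀ n, ∃ u ∈ G (n + 1), ‖u‖ ≤ 3 ∧ ∀ y ∈ G n, 1 ≤ ‖u - y‖ := by
    intro n
    obtain ⟨x, hx, hx'⟩ := SetLike.exists_of_lt (hlt n)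
    have hcl : IsClosed (((G n).comap (G (n + 1)).subtype : Submodule ℝ (G (n + 1))) :
        Set (G (n + 1))) :=
      (Submodule.closed_of_finiteDimensional (G n)).preimage continuous_subtype_val
    obtain ⟨u, hu, hu'⟩ := riesz_lemma_of_norm_lt (c := (2 : ℝ)) (R := 3) (by norm_num)
      (by norm_num) hcl ⟨⟨x, hx⟩, hx'⟩
    exact ⟨u, u.2, hu, fun y hy => hu' ⟨y, hmono n.le_succ hy⟩ hy⟩
  choose u huG hu3 hu1 using hu
  choose l hl0 hlG using hl
  obtain ⟨C, hC, hCsub⟩ := IsCompactOperator.image_closedBall_subset_compact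
    (f := (A - 1 : V →L[ℝ] V).toLinearMap) hA 3
  obtain ⟨a, -, s, hs, hsa⟩ := hC.tendsto_subseq (x := fun n => (A - 1 : V →L[ℝ] V) (u n))
    fun n => hCsub (mem_image_of_mem _ (by simpa using hu3 n))
  have hsep : ∀ m n, m < n → 1 ≤ ‖(A - 1 : V →L[ℝ] V) (u n) - (A - 1 : V →L[ℝ] V) (u m)‖ := by
    intro m n hmn
    have hum : u m ∈ G n := hmono hmn (huG m)
    have hmem : (A - 1 : V →L[ℝ] V) (u m) - (A (u n) - l n • u n) ∈ G n := by
      refine sub_mem ?_ (hlG n _ (huG n))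
      exact sub_mem (hinv n _ hum) hum
    have h1 : 1 ≤ 1 - l n := by linarith [hl0 n]
    have hne : (1 - l n) ≠ 0 := by linarith
    have h2 := hu1 n _ ((G n).smul_mem (-(1 - l n)⁻¹) hmem)
    have h3 : (A - 1 : V →L[ℝ] V) (u n) - (A - 1 : V →L[ℝ] V) (u m) =
        -((1 - l n) • (u n - -(1 - l n)⁻¹ •
          ((A - 1 : V →L[ℝ] V) (u m) - (A (u n) - l n • u n)))) := by
      rw [smul_sub, smul_smul, mul_neg, mul_inv_cancel₀ hne]
      simp only [_root_.sub_apply, one_apply_eq_self]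
      module
    rw [h3, norm_neg, norm_smul, Real.norm_of_nonneg (by linarith)]
    nlinarith
  obtain ⟨N, hN⟩ := Metric.cauchySeq_iff.1 hsa.cauchySeq 1 one_pos
  have h1 := hN (N + 1) (by simp) N le_rfl
  rw [dist_eq_norm] at h1
  exact absurd h1 (not_lt.2 (hsep _ _ (hs (Nat.lt_succ_self N))))

/-- Otherwise every finite-dimensional invariant subspace of `negSpace A` could be enlarged by one
generalized eigenvector, to a chain as in `no_riesz_chain`. -/
theorem finiteDimensional_negSpace {A : V →L[ℝ] V}
    (hA : IsCompactOperator (A - 1 : V →L[ℝ] V)) : FiniteDimensional ℝ (negSpace A) := by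
  by_contra hinf
  let P : Submodule ℝ V → Prop := fun G =>
    FiniteDimensional ℝ G ∧ G ≤ negSpace A ∧ ∀ v ∈ G, A v ∈ G
  have hstep : ∀ G : {G // P G}, ∃ G' : {G // P G}, G.1 < G'.1 ∧
      ∃ l : ℝ, l ≤ 0 ∧ ∀ v ∈ G'.1, A v - l • v ∈ G.1 := by
    rintro ⟨G, hGf, hGN, hGA⟩
    obtain ⟨l, hl, hlG⟩ : ∃ l < 0, ¬ Module.End.maxGenEigenspace (A : V →ₗ[ℝ] V) l ≤ G := by
      by_contra! hall
      have : negSpace A = G := le_antisymm (iSup₂_le hall) hGN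
      exact hinf (this ▸ hGf)
    obtain ⟨v, hv, hvG⟩ := SetLike.not_le_iff_exists.1 hlG
    obtain ⟨k, hk⟩ := (Module.End.mem_maxGenEigenspace _ _ _).1 hv
    classical
    have hex : ∃ k : ℕ, (((A : V →ₗ[ℝ] V) - l • (1 : Module.End ℝ V)) ^ k) v ∈ G :=
      ⟨k, hk ▸ zero_mem G⟩
    have hpos : Nat.find hex ≠ 0 := by
      intro h0
      have := Nat.find_spec hex
      rw [h0] at this
      exact hvG (by simpa using this)
    obtain ⟨m, hm⟩ := Nat.exists_eq_succ_of_ne_zero hpos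
    set u := (((A : V →ₗ[ℝ] V) - l • (1 : Module.End ℝ V)) ^ m) v with hu
    have huG : u ∉ G := Nat.find_min hex (by omega)
    have huA : A u - l • u ∈ G := by
      have := Nat.find_spec hex
      rw [hm, Nat.succ_eq_add_one, pow_succ', Module.End.mul_apply, ← hu] at this
      simpa using this
    have huN : u ∈ negSpace A := by
      refine maxGenEigenspace_le_negSpace A hl ?_
      refine Module.End.mapsTo_maxGenEigenspace_of_comm (f := (A : V →ₗ[ℝ] V)) ?_ l hv
      exact Commute.pow_right ((Commute.refl _).sub_right
        ((Commute.one_right _).smul_right l)) m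
    have hG' : ∀ w ∈ G ⊔ Submodule.span ℝ {u}, A w - l • w ∈ G := by
      intro w hw
      obtain ⟨g, hg, c, hc, rfl⟩ := Submodule.mem_sup.1 hw
      obtain ⟨r, rfl⟩ := Submodule.mem_span_singleton.1 hc
      have : A (g + r • u) - l • (g + r • u) = (A g - l • g) + r • (A u - l • u) := by
        simp only [map_add, map_smul]; module
      rw [this]
      exact add_mem (sub_mem (hGA g hg) (G.smul_mem l hg)) (G.smul_mem r huA)
    refine ⟨⟨G ⊔ Submodule.span ℝ {u}, inferInstance,
      sup_le hGN ((Submodule.span_singleton_le_iff_mem _ _).2 huN), fun w hw => ?_⟩, ?_,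
      l, hl.le, hG'⟩
    · have := add_mem (Submodule.mem_sup_left (hG' w hw)) (Submodule.smul_mem _ l hw)
      rwa [sub_add_cancel] at this
    · refine lt_of_le_of_ne le_sup_left fun h => huG ?_
      change G = G ⊔ Submodule.span ℝ {u} at h
      have hu' : u ∈ G ⊔ Submodule.span ℝ {u} :=
        Submodule.mem_sup_right (Submodule.mem_span_singleton_self u)
      rwa [← h] at hu'
  choose f hf using hstep
  have hP0 : P ⊥ := ⟨inferInstance, bot_le, fun v hv => by
    rw [(Submodule.mem_bot ℝ).1 hv, map_zero]; exact zero_mem _⟩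
  let G : ℕ → {G // P G} := fun n => Nat.rec ⟨⊥, hP0⟩ (fun _ G => f G) n
  exact no_riesz_chain hA (fun n => (G n).1) (fun n => (G n).2.1) (fun n => (hf (G n)).1)
    (fun n => (G n).2.2.2) (fun n => (hf (G n)).2)

theorem finite_setOf_maxGenEigenspace_ne_bot {A : V →L[ℝ] V}
    (hA : IsCompactOperator (A - 1 : V →L[ℝ] V)) :
    {l : ℝ | l < 0 ∧ Module.End.maxGenEigenspace (A : V →ₗ[ℝ] V) l ≠ ⊥}.Finite := by
  have := finiteDimensional_negSpace hA
  set S := {l : ℝ | l < 0 ∧ Module.End.maxGenEigenspace (A : V →ₗ[ℝ] V) l ≠ ⊥} with hS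
  have hex : ∀ l : S, ∃ v ∈ Module.End.maxGenEigenspace (A : V →ₗ[ℝ] V) (l : ℝ), v ≠ 0 :=
    fun l => (Submodule.ne_bot_iff _).1 l.2.2
  choose v hv hv0 using hex
  have hind : LinearIndependent ℝ v :=
    iSupIndep.linearIndependent (fun l : S => Module.End.maxGenEigenspace (A : V →ₗ[ℝ] V) (l : ℝ))
      ((Module.End.independent_maxGenEigenspace (A : V →ₗ[ℝ] V)).comp Subtype.val_injective) hv hv0
  let v' : S → negSpace A := fun l => ⟨v l, maxGenEigenspace_le_negSpace A l.2.1 (hv l)⟩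
  have hind' : LinearIndependent ℝ v' := LinearIndependent.of_comp (negSpace A).subtype hind
  have : Finite S := hind'.finite
  exact S.toFinite

theorem hasFiniteMorseIndex_of_isCompactOperator {A : V →L[ℝ] V}
    (hA : IsCompactOperator (A - 1 : V →L[ℝ] V)) : HasFiniteMorseIndex A := by
  have := finiteDimensional_negSpace hA
  refine ⟨(finite_setOf_maxGenEigenspace_ne_bot hA).subset fun l hl => ⟨hl.1, fun h => hl.2 ?_⟩,
    fun l hl => Submodule.finiteDimensional_of_le (maxGenEigenspace_le_negSpace A hl)⟩
  exact le_bot_iff.1 (Module.End.eigenspace_le_maxGenEigenspace.trans h.le)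

theorem finrank_biSup_of_iSupIndep {ι : Type*} {p : ι → Submodule ℝ V} (hp : iSupIndep p)
    (s : Finset ι) (hfin : ∀ i ∈ s, FiniteDimensional ℝ (p i)) :
    finrank ℝ ↥(⨆ i ∈ s, p i) = ∑ i ∈ s, finrank ℝ (p i) := by
  classical
  induction s using Finset.induction_on with
  | empty =>
    have : ⨆ i ∈ (∅ : Finset ι), p i = ⊥ := by simp
    rw [this, finrank_bot, Finset.sum_empty]
  | insert a s ha ih =>
    have h1 := hfin a (Finset.mem_insert_self a s)
    have h2 : ∀ i ∈ s, FiniteDimensional ℝ (p i) := fun i hi => hfin i (Finset.mem_insert_of_mem hi)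
    have h3 : FiniteDimensional ℝ ↥(⨆ i ∈ s, p i) :=
      Module.Finite.iff_fg.2 (Submodule.fg_biSup s p fun i hi => Module.Finite.iff_fg.1 (h2 i hi))
    have hd : Disjoint (p a) (⨆ i ∈ s, p i) :=
      hp.disjoint_biSup (y := (s : Set ι)) (by simpa using ha)
    have h4 := Submodule.finrank_sup_add_finrank_inf_eq (p a) (⨆ i ∈ s, p i)
    rw [hd.eq_bot, finrank_bot, add_zero, ih h2] at h4
    rw [Finset.sum_insert ha, ← h4, Finset.iSup_insert]

/-- The Morse index is the dimension of the sum of the generalized eigenspaces. -/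
theorem morseIndex_eq_finrank {A : V →L[ℝ] V} (hA : IsCompactOperator (A - 1 : V →L[ℝ] V)) :
    morseIndex A = finrank ℝ (negSpace A) := by
  have hfin := finite_setOf_maxGenEigenspace_ne_bot hA
  set S := {l : ℝ | l < 0 ∧ Module.End.maxGenEigenspace (A : V →ₗ[ℝ] V) l ≠ ⊥} with hS
  have h1 : negSpace A =
      ⨆ l ∈ hfin.toFinset, Module.End.maxGenEigenspace (A : V →ₗ[ℝ] V) l := by
    refine le_antisymm (iSup₂_le fun l hl => ?_) (iSup₂_le fun l hl => ?_)
    · by_cases h : Module.End.maxGenEigenspace (A : V →ₗ[ℝ] V) l = ⊥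
      · rw [h]; exact bot_le
      · exact le_iSup₂_of_le (f := fun l (_ : l ∈ hfin.toFinset) =>
          Module.End.maxGenEigenspace (A : V →ₗ[ℝ] V) l) l (by simpa [hS] using ⟨hl, h⟩) le_rfl
    · have hl : l ∈ S := by simpa using hl
      exact maxGenEigenspace_le_negSpace A hl.1
  rw [h1, finrank_biSup_of_iSupIndep (Module.End.independent_maxGenEigenspace (A : V →ₗ[ℝ] V)),
    morseIndex]
  · refine finsum_mem_eq_sum_of_inter_support_eq _ ?_
    ext l
    simp only [mem_inter_iff, Function.mem_support, Finite.coe_toFinset]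
    refine and_congr_left fun hl => ⟨fun h => ⟨h, fun hbot => hl ?_⟩, fun h => h.1⟩
    rw [hbot, finrank_bot]
  · intro l hl
    have hl : l ∈ S := by simpa using hl
    exact (hasFiniteMorseIndex_of_isCompactOperator hA).2 l hl.1

/-- The quotient by `negSpace A` carries no nonpositive eigenvalue of an injective `A`. -/
theorem mem_negSpace_of_sub_smul_mem {A : V →L[ℝ] V}
    (hA : IsCompactOperator (A - 1 : V →L[ℝ] V)) (hinj : Function.Injective A) {l : ℝ}
    (hl : l ≤ 0) {u : V} (hu : A u - l • u ∈ negSpace A) : u ∈ negSpace A := by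
  have := finiteDimensional_negSpace hA
  have hle : Module.End.maxGenEigenspace (A : V →ₗ[ℝ] V) l ≤ negSpace A := by
    rcases hl.lt_or_eq with h | h
    · exact maxGenEigenspace_le_negSpace A h
    · intro v hv
      obtain ⟨k, hk⟩ := (Module.End.mem_maxGenEigenspace _ _ _).1 hv
      rw [h, zero_smul, sub_zero, Module.End.pow_apply] at hk
      have h0 : v = 0 := by
        refine (hinj.iterate k) ?_
        exact hk.trans (Function.iterate_fixed (map_zero A) k).symm
      rw [h0]
      exact zero_mem _
  -- modulo the generalized eigenspace for `l`, the operator `A - l` maps `negSpace A` onto itself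
  have key : ∀ w ∈ negSpace A, ∃ v ∈ negSpace A,
      (A v - l • v) - w ∈ Module.End.maxGenEigenspace (A : V →ₗ[ℝ] V) l := by
    intro w hw
    refine Submodule.iSup_induction' (p := fun l => ⨆ _ : l ∈ Iio (0 : ℝ),
      Module.End.maxGenEigenspace (A : V →ₗ[ℝ] V) l) (motive := fun w _ => ∃ v ∈ negSpace A,
      (A v - l • v) - w ∈ Module.End.maxGenEigenspace (A : V →ₗ[ℝ] V) l) ?_ ?_ ?_ hw
    · intro μ w hw
      by_cases hμ : μ < 0
      · rw [iSup_pos (show μ ∈ Iio (0 : ℝ) from hμ)] at hw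
        by_cases hμl : μ = l
        · refine ⟨0, zero_mem _, ?_⟩
          rw [map_zero, smul_zero, sub_zero, zero_sub, ← hμl]
          exact neg_mem hw
        · have hfd : FiniteDimensional ℝ (Module.End.maxGenEigenspace (A : V →ₗ[ℝ] V) μ) :=
            (hasFiniteMorseIndex_of_isCompactOperator hA).2 μ hμ
          let T : Module.End.maxGenEigenspace (A : V →ₗ[ℝ] V) μ →ₗ[ℝ]
              Module.End.maxGenEigenspace (A : V →ₗ[ℝ] V) μ :=
            ((A : V →ₗ[ℝ] V) - l • LinearMap.id).restrict fun v hv =>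
              sub_smul_mem_maxGenEigenspace A l μ hv
          have hT : Function.Injective T := by
            rw [← LinearMap.ker_eq_bot, Submodule.eq_bot_iff]
            intro v hv
            have h1 : A v - l • (v : V) = 0 := congrArg Subtype.val (LinearMap.mem_ker.1 hv)
            have h2 : (v : V) ∈ Module.End.maxGenEigenspace (A : V →ₗ[ℝ] V) l :=
              Module.End.eigenspace_le_maxGenEigenspace
                (Module.End.mem_eigenspace_iff.2 (sub_eq_zero.1 h1))
            have h3 := Module.End.disjoint_genEigenspace (A : V →ₗ[ℝ] V) hμl ⊤ ⊤
            exact Subtype.ext (Submodule.disjoint_def.1 h3 v v.2 h2)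
          obtain ⟨v, hv⟩ := LinearMap.injective_iff_surjective.1 hT ⟨w, hw⟩
          refine ⟨v, maxGenEigenspace_le_negSpace A hμ v.2, ?_⟩
          have h1 : A v - l • (v : V) = w := congrArg Subtype.val hv
          rw [h1, sub_self]
          exact zero_mem _
      · rw [iSup_neg (show ¬ μ ∈ Iio (0 : ℝ) from hμ), Submodule.mem_bot] at hw
        refine ⟨0, zero_mem _, ?_⟩
        rw [hw, map_zero, smul_zero, sub_zero, sub_zero]
        exact zero_mem _
    · refine ⟨0, zero_mem _, ?_⟩
      rw [map_zero, smul_zero, sub_zero, sub_zero]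
      exact zero_mem _
    · rintro w w' - - ⟨v, hv, hvw⟩ ⟨v', hv', hvw'⟩
      refine ⟨v + v', add_mem hv hv', ?_⟩
      have : A (v + v') - l • (v + v') - (w + w') =
          (A v - l • v - w) + (A v' - l • v' - w') := by
        simp only [map_add]; module
      rw [this]
      exact add_mem hvw hvw'
  obtain ⟨v, hv, hvw⟩ := key _ hu
  have h1 : v - u ∈ Module.End.maxGenEigenspace (A : V →ₗ[ℝ] V) l := by
    have h2 : A v - l • v - (A u - l • u) =
        ((A : V →ₗ[ℝ] V) - l • (1 : Module.End ℝ V)) (v - u) := by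
      simp only [LinearMap.sub_apply, LinearMap.smul_apply, Module.End.one_apply,
        ContinuousLinearMap.coe_coe, map_sub]
    rw [h2] at hvw
    obtain ⟨k, hk⟩ := (Module.End.mem_maxGenEigenspace _ _ _).1 hvw
    refine (Module.End.mem_maxGenEigenspace _ _ _).2 ⟨k + 1, ?_⟩
    rw [pow_succ, Module.End.mul_apply]
    exact hk
  have h2 := sub_mem hv (hle h1)
  rwa [sub_sub_cancel] at h2

/-- On the sum of the generalized eigenspaces for negative eigenvalues, the determinant has the
sign of `(-1) ^ dim`, by deformation to `-1`. -/
theorem sign_det_restrict_negSpace {A : V →L[ℝ] V}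
    (hA : IsCompactOperator (A - 1 : V →L[ℝ] V)) :
    ((SignType.sign (LinearMap.det ((A : V →ₗ[ℝ] V).restrict
      fun _ hv => map_mem_negSpace A hv)) : SignType) : ℤ) = (-1) ^ finrank ℝ (negSpace A) := by
  have := finiteDimensional_negSpace hA
  set B : negSpace A →ₗ[ℝ] negSpace A :=
    (A : V →ₗ[ℝ] V).restrict fun _ hv => map_mem_negSpace A hv with hB
  -- `(1 - s) B - s` is injective, as its kernel would give a nonnegative eigenvalue on `negSpace A`
  let D : ℝ → ℝ := fun s => LinearMap.det ((1 - s) • B - s • LinearMap.id)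
  have hDc : Continuous D := by
    let b := finBasis ℝ (negSpace A)
    have : D = fun s => ((1 - s) • LinearMap.toMatrix b b B - s • 1).det := by
      ext s
      simp only [D]
      rw [← LinearMap.det_toMatrix b, map_sub, map_smul, map_smul, LinearMap.toMatrix_id]
    rw [this]
    fun_prop
  have hD0 : ∀ s ∈ Icc (0 : ℝ) 1, D s ≠ 0 := by
    intro s hs h0
    have hker := LinearMap.bot_lt_ker_of_det_eq_zero h0
    obtain ⟨v, hv, hv0⟩ := (Submodule.ne_bot_iff _).1 hker.ne'
    have h1 : (1 - s) • A v - s • (v : V) = 0 := congrArg Subtype.val (LinearMap.mem_ker.1 hv)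
    have hv0' : (v : V) ≠ 0 := fun h => hv0 (Subtype.ext h)
    rcases hs.2.eq_or_lt with h | h
    · rw [h, sub_self, zero_smul, one_smul, zero_sub, neg_eq_zero] at h1
      exact hv0' h1
    · have hs' : (1 - s) ≠ 0 := by linarith
      have h2 : A v = (s / (1 - s)) • (v : V) := by
        rw [sub_eq_zero] at h1
        rw [div_eq_inv_mul, mul_smul, ← h1, smul_smul, inv_mul_cancel₀ hs', one_smul]
      have hc : 0 ≤ s / (1 - s) := div_nonneg hs.1 (by linarith)
      have h3 : (v : V) ∈ Module.End.maxGenEigenspace (A : V →ₗ[ℝ] V) (s / (1 - s)) :=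
        Module.End.eigenspace_le_maxGenEigenspace (Module.End.mem_eigenspace_iff.2 h2)
      have hd := (Module.End.independent_maxGenEigenspace (A : V →ₗ[ℝ] V)).disjoint_biSup
        (x := s / (1 - s)) (y := Iio 0) (by simpa using hc)
      exact hv0' (Submodule.disjoint_def.1 hd v h3 v.2)
  have hsign : SignType.sign (D 0) = SignType.sign (D 1) := by
    refine (isPreconnected_Icc (a := (0 : ℝ)) (b := 1)).constant (f := fun s => SignType.sign (D s))
      (fun s hs => ?_) (by simp) (by simp)
    exact ((continuousAt_sign_of_ne_zero (hD0 s hs)).comp hDc.continuousAt).continuousWithinAt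
  have e0 : D 0 = LinearMap.det B := by simp [D]
  have e1 : D 1 = (-1) ^ finrank ℝ (negSpace A) := by
    simp only [D, sub_self, zero_smul, zero_sub, one_smul]
    rw [← neg_one_smul ℝ, LinearMap.det_smul, LinearMap.det_id, mul_one]
  rw [← e0, hsign, e1, sign_pow, Left.sign_neg, sign_one, SignType.coe_pow]
  rfl

/-- The degree of `T ∘ Φ` does not change along a path of injective linear maps `T` that differ
from the identity by compact operators. -/
theorem lsDegree_linear_comp_path {Φ : V → V} {Ω : Set V} (h : IsLSAdmissible Φ Ω 0)
    {T : ℝ → V →L[ℝ] V} (hTc : Continuous T)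
    (hT : ∀ s ∈ Icc (0 : ℝ) 1, IsCompactOperator (T s - 1 : V →L[ℝ] V))
    (hinj : ∀ s ∈ Icc (0 : ℝ) 1, Function.Injective (T s)) :
    lsDegree (fun z => T 0 (Φ z)) Ω 0 = lsDegree (fun z => T 1 (Φ z)) Ω 0 := by
  obtain ⟨C, hC⟩ : ∃ C, ∀ z ∈ closure Ω, ‖Φ z‖ ≤ C := by
    obtain ⟨C₁, hC₁⟩ := h.bounded.closure.exists_norm_le
    obtain ⟨C₂, hC₂⟩ := h.compact.2.isBounded.exists_norm_le
    refine ⟨C₁ + C₂, fun z hz => ?_⟩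
    have h1 : Φ z = z - (z - Φ z) := (sub_sub_cancel _ _).symm
    rw [h1]
    exact (norm_sub_le _ _).trans (add_le_add (hC₁ z hz)
      (hC₂ _ (subset_closure (mem_image_of_mem _ hz))))
  refine (isPreconnected_Icc (a := (0 : ℝ)) (b := 1)).constant
    (f := fun s => lsDegree (fun z => T s (Φ z)) Ω 0) (fun s hs => ?_) (by simp) (by simp)
  have hs' := h.linear_comp (hT s hs) (hinj s hs)
  obtain ⟨m, hm, hmK⟩ := hs'.exists_pos_le
  have hnear : ∀ᶠ t in 𝓝 s, ‖T s - T t‖ * |C| < m / 4 := by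
    have : Continuous fun t => ‖T s - T t‖ * |C| := by fun_prop
    exact this.continuousAt.eventually_lt continuousAt_const (by simpa using hm)
  refine ContinuousAt.continuousWithinAt ?_
  refine (continuousAt_const (y := lsDegree (fun z => T s (Φ z)) Ω 0)).congr ?_
  filter_upwards [hnear] with t ht
  refine (lsDegree_eq_of_near hs' hm hmK fun z hz => ?_).symm
  rw [← _root_.sub_apply]
  refine ((T s - T t).le_opNorm _).trans (le_trans ?_ ht.le)
  exact mul_le_mul_of_nonneg_left ((hC z hz).trans (le_abs_self C)) (norm_nonneg _)

/-- The Leray-Schauder degree is multiplied by `(-1) ^ morseIndex A` under composition with an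
injective linear map `A` that is a compact perturbation of the identity: with a projection `P`
onto the sum of the generalized eigenspaces for negative eigenvalues, `A` is deformed to
`A P + (1 - P)`. -/
theorem lsDegree_linear_comp {Φ : V → V} {Ω : Set V} (h : IsLSAdmissible Φ Ω 0)
    {A : V →L[ℝ] V} (hA : IsCompactOperator (A - 1 : V →L[ℝ] V)) (hinj : Function.Injective A) :
    lsDegree (fun z => A (Φ z)) Ω 0 = (-1) ^ morseIndex A * lsDegree Φ Ω 0 := by
  have := finiteDimensional_negSpace hA
  obtain ⟨P, hP⟩ := Submodule.ClosedComplemented.of_finiteDimensional (𝕜 := ℝ) (negSpace A)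
  let Q : V →L[ℝ] V := 1 - (negSpace A).subtypeL.comp P
  have hQ : ∀ v, Q v = v - P v := fun v => rfl
  have hQN : ∀ v ∈ negSpace A, Q v = 0 := fun v hv => by
    rw [hQ, hP ⟨v, hv⟩, sub_self]
  have hPQ : ∀ v, P (Q v) = 0 := fun v => by rw [hQ, map_sub, hP, sub_self]
  let T : ℝ → V →L[ℝ] V := fun s => A + s • ((1 - A) * Q)
  have hTv : ∀ s v, T s v = A v + s • (Q v - A (Q v)) := fun s v => rfl
  have hTc : Continuous T := by fun_prop
  have hT : ∀ s, IsCompactOperator (T s - 1 : V →L[ℝ] V) := by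
    intro s
    have e : T s - 1 = (A - 1) - s • ((A - 1) * Q) := by
      simp only [T, sub_mul, one_mul, smul_sub]
      abel
    rw [e]
    exact hA.sub ((hA.comp_clm Q).smul s)
  have hTinj : ∀ s ∈ Icc (0 : ℝ) 1, Function.Injective (T s) := by
    intro s hs
    rw [injective_iff_map_eq_zero]
    intro v hv
    have hvd : v = P v + Q v := by rw [hQ]; abel
    have h1 : (1 - s) • A (Q v) + s • Q v = -A (P v) := by
      rw [hTv, hvd, map_add, ← hvd] at hv
      rw [eq_neg_iff_add_eq_zero, ← hv]
      module
    have h2 : A (P v) ∈ negSpace A := map_mem_negSpace A (P v).2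
    -- `Q v` is an eigenvector modulo `negSpace A`, for the nonpositive number `-s / (1 - s)`
    have hQmem : Q v ∈ negSpace A := by
      rcases hs.2.eq_or_lt with hs1 | hs1
      · rw [hs1, sub_self, zero_smul, zero_add, one_smul] at h1
        rw [h1]
        exact neg_mem h2
      · have hs' : (1 - s) ≠ 0 := by linarith
        refine mem_negSpace_of_sub_smul_mem hA hinj (l := -(s / (1 - s))) ?_ ?_
        · exact neg_nonpos.2 (div_nonneg hs.1 (by linarith))
        · have h3 : A (Q v) - (-(s / (1 - s))) • Q v = (1 - s)⁻¹ • (-A (P v)) := by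
            rw [← h1, smul_add, smul_smul, smul_smul, inv_mul_cancel₀ hs', one_smul, neg_smul,
              sub_neg_eq_add, div_eq_inv_mul]
          rw [h3]
          exact Submodule.smul_mem _ _ (neg_mem h2)
    have hQ0 : Q v = 0 := by
      have h3 := hQ (Q v)
      rw [hPQ, hQN _ hQmem] at h3
      simpa using h3.symm
    rw [hQ0, map_zero, smul_zero, smul_zero, zero_add, eq_comm, neg_eq_zero] at h1
    have h4 : (P v : V) = 0 := hinj (by rw [h1, map_zero])
    rw [hvd, hQ0, h4, zero_add]
  have hpath := lsDegree_linear_comp_path h hTc (fun s _ => hT s) hTinj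
  have e0 : T 0 = A := by simp [T]
  have h1v : ∀ v, T 1 v = A (P v) + Q v := by
    intro v
    rw [hTv, one_smul]
    have : A v = A (P v) + A (Q v) := by rw [← map_add]; congr 1; rw [hQ]; abel
    rw [this]; abel
  have h1N : ∀ v ∈ negSpace A, T 1 v = A v := fun v hv => by
    rw [h1v, hQN v hv, hP ⟨v, hv⟩, add_zero]
  have h1inv : ∀ v ∈ negSpace A, T 1 v ∈ negSpace A := fun v hv => by
    rw [h1N v hv]; exact map_mem_negSpace A hv
  rw [e0] at hpath
  rw [hpath, lsDegree_linear_comp_of_finiteDim h (hTinj 1 (by simp)) (negSpace A) ?_ h1inv,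
    morseIndex_eq_finrank hA, ← sign_det_restrict_negSpace hA]
  · congr 4
    ext v
    exact h1N v v.2
  · intro v
    have : T 1 v - v = A (P v) - P v := by rw [h1v, hQ]; abel
    rw [this]
    exact sub_mem (map_mem_negSpace A (P v).2) (P v).2

/-- The parity of the Morse index is the degree of the operator itself on the unit ball. -/
theorem lsDegree_linear_ball {A : V →L[ℝ] V} (hA : IsCompactOperator (A - 1 : V →L[ℝ] V))
    (hinj : Function.Injective A) : lsDegree (fun z => A z) (ball 0 1) 0 = (-1) ^ morseIndex A := by
  rw [lsDegree_linear_comp isLSAdmissible_id_ball hA hinj, lsDegree_id_ball, mul_one]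

theorem isCompactOperator_mul_sub_one {T A : V →L[ℝ] V}
    (hT : IsCompactOperator (T - 1 : V →L[ℝ] V)) (hA : IsCompactOperator (A - 1 : V →L[ℝ] V)) :
    IsCompactOperator (T * A - 1 : V →L[ℝ] V) := by
  have e : T * A - 1 = (T - 1) * A + (A - 1) := by rw [sub_mul, one_mul]; abel
  rw [e]
  exact (hT.comp_clm A).add hA

/-- The parity of the Morse index is multiplicative. -/
theorem neg_one_pow_morseIndex_mul {T A : V →L[ℝ] V}
    (hT : IsCompactOperator (T - 1 : V →L[ℝ] V)) (hA : IsCompactOperator (A - 1 : V →L[ℝ] V))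
    (hTi : Function.Injective T) (hAi : Function.Injective A) :
    (-1 : ℤ) ^ morseIndex (T * A) = (-1) ^ morseIndex T * (-1) ^ morseIndex A := by
  rw [← lsDegree_linear_ball (isCompactOperator_mul_sub_one hT hA) (hTi.comp hAi),
    ← lsDegree_linear_ball hA hAi, ← lsDegree_linear_comp
      (isLSAdmissible_id_ball.linear_comp hA hAi) hT hTi]
  rfl

/-- The parity of the Morse index is constant along paths of injective operators. -/
theorem neg_one_pow_morseIndex_path {T : ℝ → V →L[ℝ] V} (hTc : Continuous T)
    (hT : ∀ s ∈ Icc (0 : ℝ) 1, IsCompactOperator (T s - 1 : V →L[ℝ] V))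
    (hinj : ∀ s ∈ Icc (0 : ℝ) 1, Function.Injective (T s)) :
    (-1 : ℤ) ^ morseIndex (T 0) = (-1) ^ morseIndex (T 1) := by
  rw [← lsDegree_linear_ball (hT 0 (by simp)) (hinj 0 (by simp)),
    ← lsDegree_linear_ball (hT 1 (by simp)) (hinj 1 (by simp))]
  exact lsDegree_linear_comp_path isLSAdmissible_id_ball hTc hT hinj

theorem neg_one_pow_morseIndex_of_finiteDim {T : V →L[ℝ] V} (hinj : Function.Injective T)
    (N : Submodule ℝ V) [FiniteDimensional ℝ N] (hTN : ∀ v, T v - v ∈ N)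
    (hN : ∀ v ∈ N, T v ∈ N) :
    (-1 : ℤ) ^ morseIndex T =
      ((SignType.sign (LinearMap.det ((T : V →ₗ[ℝ] V).restrict hN)) : SignType) : ℤ) := by
  rw [← lsDegree_linear_ball (isCompactOperator_of_forall_mem N hTN) hinj,
    lsDegree_linear_comp_of_finiteDim isLSAdmissible_id_ball hinj N hTN hN, lsDegree_id_ball,
    mul_one]

end Morse

/-! ### Spaces of loops -/

section Loops

theorem hasDerivAt_incl (x : C1) (t : ℝ) :
    HasDerivAt (fun s : ℝ => incl x (s : UnitAddCircle)) (ddt x (t : UnitAddCircle)) t :=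
  x.2 t

theorem C1.ext_incl {x y : C1} (h : incl x = incl y) : x = y := by
  have hd : ddt x = ddt y := by
    ext1 t
    obtain ⟨t, rfl⟩ := QuotientAddGroup.mk_surjective t
    have h1 := hasDerivAt_incl x t
    rw [h] at h1
    exact h1.unique (hasDerivAt_incl y t)
  exact Subtype.ext (Prod.ext h hd)

theorem norm_incl_le (x : C1) : ‖incl x‖ ≤ ‖x‖ := norm_fst_le (x.1 : C0 × C0)

theorem norm_ddt_le (x : C1) : ‖ddt x‖ ≤ ‖x‖ := norm_snd_le (x.1 : C0 × C0)

theorem continuous_coe_loop (f : C0) : Continuous fun s : ℝ => f (s : UnitAddCircle) :=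
  f.continuous.comp (AddCircle.continuous_mk' 1)

theorem isClosed_C1Pairs : IsClosed (C1Pairs : Set (C0 × C0)) := by
  refine IsSeqClosed.isClosed fun p q hp hpq => ?_
  have h1 := (continuous_fst.tendsto q).comp hpq
  have h2 := (continuous_snd.tendsto q).comp hpq
  rw [ContinuousMap.tendsto_iff_tendstoUniformly] at h1 h2
  intro t
  exact hasDerivAt_of_tendstoUniformly (f := fun n (s : ℝ) => (p n).1 (s : UnitAddCircle))
    (f' := fun n (s : ℝ) => (p n).2 (s : UnitAddCircle))
    (g' := fun s : ℝ => q.2 (s : UnitAddCircle))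
    (h2.comp (fun s : ℝ => (s : UnitAddCircle)))
    (Filter.Eventually.of_forall fun n s => hp n s) (fun s => h1.tendsto_at (s : UnitAddCircle)) t

instance : CompleteSpace C1 := isClosed_C1Pairs.completeSpace_coe

/-- A periodic function on the line with continuous periodic derivative defines a `C¹` loop. -/
theorem exists_C1_of_hasDerivAt {u : ℝ → Plane} {v : C0} (hu : Function.Periodic u 1)
    (hd : ∀ t : ℝ, HasDerivAt u (v (t : UnitAddCircle)) t) :
    ∃ x : C1, (∀ t : ℝ, incl x (t : UnitAddCircle) = u t) ∧ ddt x = v := by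
  have hc : Continuous u := continuous_iff_continuousAt.2 fun t => (hd t).continuousAt
  have hc' : Continuous (hu.lift : UnitAddCircle → Plane) := by
    rw [← (QuotientAddGroup.isOpenQuotientMap_mk (N := AddSubgroup.zmultiples (1 : ℝ))
      ).continuous_comp_iff]
    exact hc
  exact ⟨⟨(⟨hu.lift, hc'⟩, v), fun t => hd t⟩, fun t => rfl, rfl⟩

/-- The constant loops, as elements of `C⁰`. -/
def constC0 : Plane →L[ℝ] C0 where
  toFun c := ContinuousMap.const _ c
  map_add' _ _ := rfl
  map_smul' _ _ := rfl
  cont := ContinuousMap.continuous_const'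

@[simp] theorem constC0_apply (c : Plane) (t : UnitAddCircle) : constC0 c t = c := rfl

/-- The constant loops, as elements of `C¹`. -/
def constC1 : Plane →L[ℝ] C1 where
  toFun c := ⟨(constC0 c, 0), fun t => hasDerivAt_const t c⟩
  map_add' c d := C1.ext_incl rfl
  map_smul' a c := C1.ext_incl rfl
  cont := by
    refine Continuous.subtype_mk ?_ _
    exact constC0.continuous.prodMk continuous_const

@[simp] theorem incl_constC1 (c : Plane) : incl (constC1 c) = constC0 c := rfl

@[simp] theorem ddt_constC1 (c : Plane) : ddt (constC1 c) = 0 := rfl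

theorem norm_constC1_le (c : Plane) : ‖constC1 c‖ ≤ ‖c‖ := by
  change max ‖constC0 c‖ ‖(0 : C0)‖ ≤ ‖c‖
  refine max_le ?_ (by simp)
  exact (ContinuousMap.norm_le _ (norm_nonneg c)).2 fun t => le_rfl

/-- The mean value of a loop. -/
def mean : C0 →L[ℝ] Plane :=
  LinearMap.mkContinuous
    { toFun := fun f => ∫ s in (0 : ℝ)..1, f (s : UnitAddCircle)
      map_add' := fun f g => intervalIntegral.integral_add
        ((continuous_coe_loop f).intervalIntegrable _ _)
        ((continuous_coe_loop g).intervalIntegrable _ _)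
      map_smul' := fun c f =>
        intervalIntegral.integral_smul c fun s : ℝ => f (s : UnitAddCircle) } 1 fun f => by
    have := intervalIntegral.norm_integral_le_of_norm_le_const (a := (0 : ℝ)) (b := 1)
      (f := fun s : ℝ => f (s : UnitAddCircle)) (C := ‖f‖) fun s _ => f.norm_coe_le_norm s
    simpa using this

theorem mean_apply (f : C0) : mean f = ∫ s in (0 : ℝ)..1, f (s : UnitAddCircle) := rfl

@[simp] theorem mean_constC0 (c : Plane) : mean (constC0 c) = c := by
  simp [mean_apply]

@[simp] theorem mean_ddt (x : C1) : mean (ddt x) = 0 := by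
  rw [mean_apply, intervalIntegral.integral_eq_sub_of_hasDerivAt
    (fun t _ => hasDerivAt_incl x t) ((continuous_coe_loop _).intervalIntegrable _ _)]
  have : ((1 : ℝ) : UnitAddCircle) = ((0 : ℝ) : UnitAddCircle) := by
    simp
  rw [this, sub_self]

/-- The mean value of a `C¹` loop, as a constant loop. -/
def meanLoop : C1 →L[ℝ] C0 := (constC0.comp mean).comp incl

theorem meanLoop_apply (x : C1) : meanLoop x = constC0 (mean (incl x)) := rfl

/-- The operator `x ↦ x' + (mean of x)`, an isomorphism from `C¹` to `C⁰`. -/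
def ddtAddMean : C1 →L[ℝ] C0 := ddt + meanLoop

theorem ddtAddMean_apply (x : C1) : ddtAddMean x = ddt x + meanLoop x := rfl

/-- A loop with vanishing derivative is constant, hence zero if its mean vanishes. -/
theorem eq_zero_of_ddt_eq_zero {x : C1} (hd : ddt x = 0) (hm : mean (incl x) = 0) : x = 0 := by
  have hc : ∀ t : ℝ, incl x (t : UnitAddCircle) = incl x ((0 : ℝ) : UnitAddCircle) := by
    have h1 : ∀ t : ℝ, HasDerivAt (fun s : ℝ => incl x (s : UnitAddCircle)) 0 t := fun t => by
      have := hasDerivAt_incl x t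
      rwa [hd] at this
    intro t
    exact is_const_of_deriv_eq_zero (fun t => (h1 t).differentiableAt) (fun t => (h1 t).deriv) t 0
  have h2 : incl x = constC0 (incl x ((0 : ℝ) : UnitAddCircle)) := by
    ext1 t
    obtain ⟨t, rfl⟩ := QuotientAddGroup.mk_surjective t
    exact hc t
  have h3 : incl x ((0 : ℝ) : UnitAddCircle) = 0 := by
    rw [h2, mean_constC0] at hm
    exact hm
  refine C1.ext_incl ?_
  rw [h2, h3, map_zero, map_zero]

theorem ddtAddMean_injective : Function.Injective ddtAddMean := by
  rw [injective_iff_map_eq_zero]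
  intro x hx
  have hm : mean (incl x) = 0 := by
    have := congrArg mean hx
    rwa [ddtAddMean_apply, map_add, mean_ddt, zero_add, meanLoop_apply, mean_constC0,
      map_zero] at this
  rw [ddtAddMean_apply, meanLoop_apply, hm, map_zero, add_zero] at hx
  exact eq_zero_of_ddt_eq_zero hx hm

theorem ddtAddMean_surjective : Function.Surjective ddtAddMean := by
  intro f
  -- a primitive of the part of mean zero is periodic; a constant then adjusts the mean
  let f₀ : C0 := f - constC0 (mean f)
  have hf₀ : ∫ s in (0 : ℝ)..1, f₀ (s : UnitAddCircle) = 0 := by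
    rw [← mean_apply, map_sub, mean_constC0, sub_self]
  have hc := continuous_coe_loop f₀
  have hper : Function.Periodic (fun s : ℝ => f₀ (s : UnitAddCircle)) 1 := fun s => by
    simp
  let u : ℝ → Plane := fun t => ∫ s in (0 : ℝ)..t, f₀ (s : UnitAddCircle)
  have hu : Function.Periodic u 1 := by
    intro t
    simp only [u]
    rw [← intervalIntegral.integral_add_adjacent_intervals (hc.intervalIntegrable 0 t)
      (hc.intervalIntegrable t (t + 1)), hper.intervalIntegral_add_eq t 0, zero_add, hf₀, add_zero]
  have hd : ∀ t : ℝ, HasDerivAt u (f₀ (t : UnitAddCircle)) t := fun t =>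
    intervalIntegral.integral_hasDerivAt_right (hc.intervalIntegrable 0 t)
      (hc.stronglyMeasurableAtFilter _ _) hc.continuousAt
  obtain ⟨x, -, hx⟩ := exists_C1_of_hasDerivAt hu hd
  refine ⟨x + constC1 (mean f - mean (incl x)), ?_⟩
  rw [ddtAddMean_apply, meanLoop_apply, map_add, map_add, map_add, hx, ddt_constC1, incl_constC1,
    mean_constC0, add_zero, add_sub_cancel]
  exact sub_add_cancel _ _

/-- The inverse of `x ↦ x' + (mean of x)`, the parametrix used as reference. -/
def stdParametrix : C0 ≃L[ℝ] C1 :=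
  (ContinuousLinearEquiv.ofBijective ddtAddMean (LinearMap.ker_eq_bot.2 ddtAddMean_injective)
    (LinearMap.range_eq_top.2 ddtAddMean_surjective)).symm

@[simp] theorem stdParametrix_ddtAddMean (x : C1) : stdParametrix (ddtAddMean x) = x :=
  (ContinuousLinearEquiv.ofBijective ddtAddMean (LinearMap.ker_eq_bot.2 ddtAddMean_injective)
    (LinearMap.range_eq_top.2 ddtAddMean_surjective)).symm_apply_apply x

@[simp] theorem ddtAddMean_stdParametrix (f : C0) : ddtAddMean (stdParametrix f) = f :=
  (ContinuousLinearEquiv.ofBijective ddtAddMean (LinearMap.ker_eq_bot.2 ddtAddMean_injective)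
    (LinearMap.range_eq_top.2 ddtAddMean_surjective)).apply_symm_apply f

theorem stdParametrix_constC0 (c : Plane) : stdParametrix (constC0 c) = constC1 c := by
  have : ddtAddMean (constC1 c) = constC0 c := by
    rw [ddtAddMean_apply, ddt_constC1, meanLoop_apply, incl_constC1, mean_constC0, zero_add]
  rw [← this, stdParametrix_ddtAddMean]

theorem nhds_coe_unitAddCircle (s : ℝ) :
    𝓝 (s : UnitAddCircle) = Filter.map (fun t : ℝ => (t : UnitAddCircle)) (𝓝 s) :=
  ((QuotientAddGroup.isOpenQuotientMap_mk (N := AddSubgroup.zmultiples (1 : ℝ))).map_nhds_eq s).symm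

/-- The inclusion `C¹ → C⁰` is compact, by the Arzelà-Ascoli theorem. -/
theorem isCompactOperator_incl : IsCompactOperator incl := by
  refine (isCompactOperator_iff_isCompact_closure_image_closedBall (incl : C1 →ₗ[ℝ] C0)
    one_pos).2 ?_
  let e := ContinuousMap.isometryEquivBoundedOfCompact UnitAddCircle Plane
  set S : Set C0 := incl '' closedBall 0 1 with hS
  have hlip : ∀ x ∈ closedBall (0 : C1) 1, ∀ s t : ℝ,
      ‖incl x (t : UnitAddCircle) - incl x (s : UnitAddCircle)‖ ≤ 1 * ‖t - s‖ := by
    intro x hx s t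
    have hx1 : ‖x‖ ≤ 1 := by simpa using hx
    refine Convex.norm_image_sub_le_of_norm_hasDerivWithin_le (s := univ)
      (fun r _ => (hasDerivAt_incl x r).hasDerivWithinAt) (fun r _ => ?_) convex_univ
      (mem_univ s) (mem_univ t)
    exact ((ddt x).norm_coe_le_norm _).trans ((norm_ddt_le x).trans hx1)
  have key : IsCompact (closure (e '' S)) := by
    refine BoundedContinuousFunction.arzela_ascoli (closedBall (0 : Plane) 1)
      (isCompact_closedBall _ _) _ ?_ ?_
    · rintro _ t ⟨_, ⟨x, hx, rfl⟩, rfl⟩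
      rw [mem_closedBall_zero_iff] at hx ⊢
      exact ((incl x).norm_coe_le_norm t).trans ((norm_incl_le x).trans hx)
    · intro s
      obtain ⟨s, rfl⟩ := QuotientAddGroup.mk_surjective s
      rw [Metric.equicontinuousAt_iff_right]
      intro ε hε
      have : ∀ᶠ t : ℝ in 𝓝 s, dist t s < ε := ball_mem_nhds s hε
      change ∀ᶠ b in 𝓝 ((s : ℝ) : UnitAddCircle), _
      rw [nhds_coe_unitAddCircle, Filter.eventually_map]
      filter_upwards [this] with t ht
      rintro ⟨_, _, ⟨x, hx, rfl⟩, rfl⟩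
      rw [dist_comm, dist_eq_norm]
      refine lt_of_le_of_lt (hlip x hx s t) ?_
      rw [one_mul, ← dist_eq_norm]
      exact ht
  have hcl : closure S = e.symm '' closure (e '' S) := by
    have h : e.symm '' closure (e '' S) = closure (e.symm '' (e '' S)) :=
      e.symm.toHomeomorph.image_closure (e '' S)
    have h' : e.symm '' (e '' S) = S := e.toEquiv.symm_image_image S
    rw [h, h']
  change IsCompact (closure S)
  rw [hcl]
  exact key.image e.symm.continuous

end Loops

/-! ### Compactness of the nonlinear term, and admissible parametrices -/

section Nonlinear

variable {U : Set Plane} {X : Plane → UnitAddCircle → Plane}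

theorem IsSmoothField.continuousOn (hX : IsSmoothField U X) (hU : IsOpen U) :
    ContinuousOn (fun p : Plane × UnitAddCircle => X p.1 p.2) (U ×ˢ univ) := by
  rintro ⟨p, t⟩ ⟨hp, -⟩
  obtain ⟨s, rfl⟩ := QuotientAddGroup.mk_surjective t
  refine ContinuousAt.continuousWithinAt ?_
  have h1 : ContinuousAt (fun p : Plane × ℝ => X p.1 (p.2 : UnitAddCircle)) (p, s) :=
    (ContDiffOn.continuousOn hX).continuousAt
      ((hU.prod isOpen_univ).mem_nhds ⟨hp, mem_univ _⟩)
  have h2 : 𝓝 (p, (s : UnitAddCircle)) =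
      Filter.map (Prod.map id fun t : ℝ => (t : UnitAddCircle)) (𝓝 (p, s)) := by
    rw [nhds_prod_eq, nhds_prod_eq, nhds_coe_unitAddCircle, ← Filter.prod_map_map_eq',
      Filter.map_id]
  change Filter.Tendsto _ (𝓝 (p, (s : UnitAddCircle))) _
  rw [h2, Filter.tendsto_map'_iff]
  exact h1

open Classical in
/-- The loop `t ↦ X (z (t), t)` for a continuous loop `z`, with the same convention as in
`alongLoop`. -/
def superpose (X : Plane → UnitAddCircle → Plane) (z : C0) : C0 :=
  if h : Continuous (fun t : UnitAddCircle => X (z t) t) then ⟨_, h⟩ else 0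

theorem continuousOn_superpose (hX : IsSmoothField U X) (hU : IsOpen U) :
    ContinuousOn (superpose X) {z : C0 | ∀ t, z t ∈ U} := by
  have hXc := hX.continuousOn hU
  have happ : ∀ z : {z : C0 | ∀ t, z t ∈ U}, ∀ t, superpose X (z : C0) t = X ((z : C0) t) t := by
    intro z t
    have hz : Continuous (fun t : UnitAddCircle => X ((z : C0) t) t) :=
      hXc.comp_continuous ((z : C0).continuous.prodMk continuous_id) fun t =>
        ⟨z.2 t, mem_univ _⟩
    rw [superpose, dif_pos hz]
    rfl
  rw [continuousOn_iff_continuous_domRestrict]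
  refine ContinuousMap.continuous_of_continuous_uncurry _ ?_
  have : Continuous fun p : {z : C0 | ∀ t, z t ∈ U} × UnitAddCircle =>
      X ((p.1 : C0) p.2) p.2 :=
    hXc.comp_continuous
      ((continuous_eval.comp ((continuous_subtype_val.comp continuous_fst).prodMk
        continuous_snd)).prodMk continuous_snd) fun p => ⟨p.1.2 p.2, mem_univ _⟩
  exact this.congr fun p => (happ p.1 p.2).symm

variable {x : C1} {ε : ℝ}

/-- If a `C¹`-ball about `x` consists of loops in `U`, then so does its closure with respect to the
`C⁰`-norm: the values of the latter are attained by loops `x + c` in the ball with `c` constant. -/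
theorem mem_of_mem_closure_image_incl (hin : ∀ y ∈ closedBall x ε, StaysIn U y) {z : C0}
    (hz : z ∈ closure (incl '' closedBall x ε)) (t : UnitAddCircle) : z t ∈ U := by
  have hcl : IsClosed {z : C0 | ‖z t - incl x t‖ ≤ ε} :=
    isClosed_le (by fun_prop) continuous_const
  have hsub : incl '' closedBall x ε ⊆ {z : C0 | ‖z t - incl x t‖ ≤ ε} := by
    rintro _ ⟨y, hy, rfl⟩
    rw [mem_closedBall, dist_eq_norm] at hy
    have h1 : ‖incl (y - x) t‖ ≤ ‖y - x‖ :=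
      ((incl (y - x)).norm_coe_le_norm t).trans (norm_incl_le _)
    rw [map_sub] at h1
    exact h1.trans hy
  have h := closure_minimal hsub hcl hz
  have h2 : x + constC1 (z t - incl x t) ∈ closedBall x ε := by
    rw [mem_closedBall, dist_eq_norm, add_sub_cancel_left]
    exact (norm_constC1_le _).trans h
  have h3 := hin _ h2 t
  rw [map_add, incl_constC1, ContinuousMap.add_apply, constC0_apply, add_sub_cancel] at h3
  exact h3

/-- The nonlinear term `x ↦ X (x, ·)` is a compact map from a closed `C¹`-ball to `C⁰`. -/
theorem isCompactMapOn_alongLoop (hX : IsSmoothField U X) (hU : IsOpen U)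
    (hin : ∀ y ∈ closedBall x ε, StaysIn U y) :
    IsCompactMapOn (alongLoop X) (closedBall x ε) := by
  have hc := continuousOn_superpose hX hU
  have hK : IsCompact (closure (incl '' closedBall x ε)) :=
    IsCompactOperator.isCompact_closure_image_of_bounded (f := (incl : C1 →ₗ[ℝ] C0))
      isCompactOperator_incl isBounded_closedBall
  have hKU : closure (incl '' closedBall x ε) ⊆ {z : C0 | ∀ t, z t ∈ U} := fun z hz t =>
    mem_of_mem_closure_image_incl hin hz t
  -- `alongLoop X y` is by definition `superpose X (incl y)`
  refine ⟨hc.comp incl.continuous.continuousOn fun y hy => hin y hy, ?_⟩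
  refine (hK.image_of_continuousOn (hc.mono hKU)).closure_of_subset ?_
  rintro _ ⟨y, hy, rfl⟩
  exact ⟨incl y, subset_closure ⟨y, hy, rfl⟩, rfl⟩

/-- If `M ℰ` is of the form identity plus compact near `x`, then the linear operator `M d/dt` is a
compact perturbation of the identity. -/
theorem isCompactOperator_parametrix_ddt (hX : IsSmoothField U X) (hU : IsOpen U) (hε : 0 < ε)
    (hin : ∀ y ∈ closedBall x ε, StaysIn U y) {M : C0 ≃L[ℝ] C1}
    (hM : IsIdAddCompactOn (parametrixMap X M) (closedBall x ε)) :
    IsCompactOperator ((M : C0 →L[ℝ] C1).comp ddt - 1 : C1 →L[ℝ] C1) := by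
  have hA := isCompactMapOn_alongLoop hX hU hin
  set K₁ := closure ((fun z => z - parametrixMap X M z) '' closedBall x ε) with hK₁
  set K₂ := closure (alongLoop X '' closedBall x ε) with hK₂
  let r : C1 := M (ddt x) - x
  refine (isCompactOperator_iff_exists_mem_nhds_image_subset_compact _).2
    ⟨closedBall 0 ε, closedBall_mem_nhds _ hε, _,
      (hM.2.prod hA.2).image (f := fun p : C1 × C0 => M p.2 - p.1 - r) (by fun_prop), ?_⟩
  rintro _ ⟨v, hv, rfl⟩
  have hxv : x + v ∈ closedBall x ε := by simpa using hv
  refine ⟨(_, _), ⟨subset_closure ⟨x + v, hxv, rfl⟩, subset_closure ⟨x + v, hxv, rfl⟩⟩, ?_⟩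
  change M (alongLoop X (x + v)) - (x + v - M (ddt (x + v) - alongLoop X (x + v)))
    - (M (ddt x) - x) = M (ddt v) - v
  rw [map_sub, map_add, map_add]
  abel

/-- The converse of `isCompactOperator_parametrix_ddt`. -/
theorem isIdAddCompactOn_parametrixMap (hX : IsSmoothField U X) (hU : IsOpen U)
    (hin : ∀ y ∈ closedBall x ε, StaysIn U y) {M : C0 ≃L[ℝ] C1}
    (hM : IsCompactOperator ((M : C0 →L[ℝ] C1).comp ddt - 1 : C1 →L[ℝ] C1)) :
    IsIdAddCompactOn (parametrixMap X M) (closedBall x ε) := by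
  have hA := isCompactMapOn_alongLoop hX hU hin
  obtain ⟨C, hC, hCsub⟩ := IsCompactOperator.image_subset_compact_of_bounded
    (f := ((M : C0 →L[ℝ] C1).comp ddt - 1 : C1 →L[ℝ] C1).toLinearMap) hM
      (isBounded_closedBall (x := x) (r := ε))
  have hval : ∀ y, y - parametrixMap X M y = M (alongLoop X y) - (M (ddt y) - y) := fun y => by
    change y - M (ddt y - alongLoop X y) = _
    rw [map_sub]
    abel
  constructor
  · refine ContinuousOn.congr (f := fun y => M (alongLoop X y) - (M (ddt y) - y)) ?_
      fun y _ => hval y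
    have h1 : ContinuousOn (fun y => M (alongLoop X y)) (closedBall x ε) :=
      M.continuous.comp_continuousOn hA.1
    have h2 : Continuous fun y : C1 => M (ddt y) - y := by fun_prop
    exact h1.sub h2.continuousOn
  · refine ((hA.2.prod hC).image (f := fun p : C0 × C1 => M p.1 - p.2)
      (by fun_prop)).closure_of_subset ?_
    rintro _ ⟨y, hy, rfl⟩
    refine ⟨(alongLoop X y, M (ddt y) - y), ⟨subset_closure ⟨y, hy, rfl⟩, hCsub ⟨y, hy, rfl⟩⟩, ?_⟩
    exact (hval y).symm

theorem isCompactOperator_clm_comp_incl (B : C0 →L[ℝ] C1) :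
    IsCompactOperator (B.comp incl : C1 →L[ℝ] C1) :=
  isCompactOperator_incl.clm_comp B

theorem isCompactOperator_linearModel_sub_one {M : C0 ≃L[ℝ] C1}
    (hM : IsCompactOperator ((M : C0 →L[ℝ] C1).comp ddt - 1 : C1 →L[ℝ] C1))
    (Θ : Matrix (Fin 2) (Fin 2) ℝ) :
    IsCompactOperator (linearModel M Θ - 1 : C1 →L[ℝ] C1) := by
  have h := hM.sub (isCompactOperator_clm_comp_incl ((M : C0 →L[ℝ] C1).comp (matrixMul Θ)))
  refine (congrArg IsCompactOperator (funext fun v => ?_)).mpr h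
  change M (ddt v - matrixMul Θ (incl v)) - v = M (ddt v) - v - M (matrixMul Θ (incl v))
  rw [map_sub]
  abel

/-- The change of parametrix `S` with `M = S J`, where `J` is the reference parametrix. -/
def changeParametrix (M : C0 ≃L[ℝ] C1) : C1 →L[ℝ] C1 := (M : C0 →L[ℝ] C1).comp ddtAddMean

theorem changeParametrix_stdParametrix (M : C0 ≃L[ℝ] C1) (f : C0) :
    changeParametrix M (stdParametrix f) = M f := by
  change M (ddtAddMean (stdParametrix f)) = M f
  rw [ddtAddMean_stdParametrix]

theorem changeParametrix_injective (M : C0 ≃L[ℝ] C1) :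
    Function.Injective (changeParametrix M) :=
  M.injective.comp ddtAddMean_injective

theorem isCompactOperator_changeParametrix_sub_one {M : C0 ≃L[ℝ] C1}
    (hM : IsCompactOperator ((M : C0 →L[ℝ] C1).comp ddt - 1 : C1 →L[ℝ] C1)) :
    IsCompactOperator (changeParametrix M - 1 : C1 →L[ℝ] C1) := by
  have h := hM.add (isCompactOperator_clm_comp_incl
    ((M : C0 →L[ℝ] C1).comp (constC0.comp mean)))
  refine (congrArg IsCompactOperator (funext fun v => ?_)).mpr h
  change M (ddt v + meanLoop v) - v = M (ddt v) - v + M (meanLoop v)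
  rw [map_add]
  abel

theorem isCompactOperator_stdParametrix_ddt :
    IsCompactOperator ((stdParametrix : C0 →L[ℝ] C1).comp ddt - 1 : C1 →L[ℝ] C1) := by
  have h := (isCompactOperator_clm_comp_incl
    ((stdParametrix : C0 →L[ℝ] C1).comp (constC0.comp mean))).neg
  refine (congrArg IsCompactOperator (funext fun v => ?_)).mpr h
  change stdParametrix (ddt v) - v = -stdParametrix (meanLoop v)
  have := stdParametrix_ddtAddMean v
  rw [ddtAddMean_apply, map_add] at this
  nth_rewrite 2 [← this]
  abel

theorem linearModel_eq_mul (M : C0 ≃L[ℝ] C1) (Θ : Matrix (Fin 2) (Fin 2) ℝ) :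
    linearModel M Θ = changeParametrix M * linearModel stdParametrix Θ := by
  ext1 v
  exact (changeParametrix_stdParametrix M (ddt v - matrixMul Θ (incl v))).symm

theorem parametrixMap_eq (M : C0 ≃L[ℝ] C1) (y : C1) :
    parametrixMap X M y = changeParametrix M (parametrixMap X stdParametrix y) :=
  (changeParametrix_stdParametrix M (defect X y)).symm

end Nonlinear

/-! ### The parity of the Morse index of the linear model -/

section LinearModel

/-- The scalar equation `w' = a w` has no non-zero 1-periodic solution of mean zero unless
`a ∈ 2πi ℤ \ {0}`. -/
theorem eq_zero_of_hasDerivAt_mul {w : ℝ → ℂ} {a : ℂ} (hw : ∀ t, HasDerivAt w (a * w t) t)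
    (hper : w 1 = w 0) (hint : ∫ s in (0 : ℝ)..1, w s = 0)
    (ha : ∀ k : ℤ, k ≠ 0 → a ≠ 2 * Real.pi * k * Complex.I) (t : ℝ) : w t = 0 := by
  have hd : ∀ t : ℝ, HasDerivAt (fun s : ℝ => Complex.exp (-a * s) * w s) 0 t := fun t => by
    have h1 : HasDerivAt (fun s : ℝ => -a * (s : ℂ)) (-a * 1) t :=
      (Complex.ofRealCLM.hasDerivAt (x := t)).const_mul (-a)
    exact (h1.cexp.mul (hw t)).congr_deriv (by ring)
  have hconst : ∀ t : ℝ, Complex.exp (-a * t) * w t = w 0 := fun t => by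
    have := is_const_of_deriv_eq_zero (fun t => (hd t).differentiableAt) (fun t => (hd t).deriv) t 0
    simpa using this
  have hsol : ∀ t : ℝ, w t = Complex.exp (a * t) * w 0 := fun t => by
    rw [← hconst t, ← mul_assoc, ← Complex.exp_add]
    simp
  have h0 : w 0 = 0 := by
    by_contra h
    have h1 : Complex.exp a = 1 := by
      have := hsol 1
      rw [hper, Complex.ofReal_one, mul_one] at this
      exact mul_right_cancel₀ h (by rw [one_mul]; exact this.symm)
    obtain ⟨k, hk⟩ := Complex.exp_eq_one_iff.1 h1
    have hk0 : k = 0 := by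
      by_contra hk0
      exact ha k hk0 (by rw [hk]; ring)
    have ha0 : a = 0 := by simpa [hk0] using hk
    have : ∀ t, w t = w 0 := fun t => by simpa [ha0] using hsol t
    rw [funext this] at hint
    exact h (by simpa using hint)
  rw [hsol, h0, mul_zero]

theorem matrixMul_apply (P : Matrix (Fin 2) (Fin 2) ℝ) (f : C0) (t : UnitAddCircle) (i : Fin 2) :
    matrixMul P f t i = P i 0 * f t 0 + P i 1 * f t 1 := by
  have : matrixMul P f t i = (P.mulVec (WithLp.ofLp (f t))) i := rfl
  rw [this, Matrix.mulVec, dotProduct, Fin.sum_univ_two]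

/-- The equation `y' = P y` has no non-zero 1-periodic solution of mean zero if `P` has no
eigenvalue in `2πi ℤ \ {0}`. -/
theorem eq_zero_of_ddt_eq_matrixMul {P : Matrix (Fin 2) (Fin 2) ℝ}
    (hP : ∀ k : ℤ, k ≠ 0 → (2 * Real.pi * k * Complex.I : ℂ) ^ 2
      - P.trace * (2 * Real.pi * k * Complex.I) + P.det ≠ 0)
    {y : C1} (hm : mean (incl y) = 0) (hy : ddt y = matrixMul P (incl y)) : y = 0 := by
  let u : Fin 2 → ℝ → ℂ := fun i t => ((incl y (t : UnitAddCircle) i : ℝ) : ℂ)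
  have hu : ∀ i t, HasDerivAt (u i) (P i 0 * u 0 t + P i 1 * u 1 t) t := fun i t => by
    have h1 := (EuclideanSpace.proj i : Plane →L[ℝ] ℝ).hasFDerivAt.comp_hasDerivAt
      t (hasDerivAt_incl y t)
    rw [hy] at h1
    have h2 := h1.ofReal_comp
    have h3 : (EuclideanSpace.proj i : Plane →L[ℝ] ℝ)
        (matrixMul P (incl y) (t : UnitAddCircle)) = P i 0 * incl y (t : UnitAddCircle) 0
          + P i 1 * incl y (t : UnitAddCircle) 1 := matrixMul_apply P (incl y) t i
    rw [h3] at h2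
    push_cast at h2
    exact h2
  have hper : ∀ i, u i 1 = u i 0 := fun i => by
    have : ((1 : ℝ) : UnitAddCircle) = ((0 : ℝ) : UnitAddCircle) := by simp
    simp only [u, this]
  have huc : ∀ i, Continuous (u i) := fun i =>
    continuous_iff_continuousAt.2 fun t => (hu i t).continuousAt
  have hint : ∀ i, ∫ s in (0 : ℝ)..1, u i s = 0 := fun i => by
    have h1 := (EuclideanSpace.proj i : Plane →L[ℝ] ℝ).intervalIntegral_comp_comm
      ((continuous_coe_loop (incl y)).intervalIntegrable (μ := volume) 0 1)
    rw [← mean_apply, hm, map_zero] at h1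
    simp only [u]
    rw [intervalIntegral.integral_ofReal]
    exact_mod_cast h1
  -- `a` and `b` are the complex eigenvalues of `P`
  obtain ⟨s, hs⟩ := IsAlgClosed.exists_pow_nat_eq ((P.trace : ℂ) ^ 2 - 4 * P.det) two_pos
  obtain ⟨a, hadef⟩ : ∃ a : ℂ, a = (P.trace + s) / 2 := ⟨_, rfl⟩
  obtain ⟨b, hbdef⟩ : ∃ b : ℂ, b = (P.trace - s) / 2 := ⟨_, rfl⟩
  have ha : ∀ k : ℤ, k ≠ 0 → a ≠ 2 * Real.pi * k * Complex.I := fun k hk h => hP k hk (by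
    rw [← h, hadef]
    linear_combination hs / 4)
  have hb : ∀ k : ℤ, k ≠ 0 → b ≠ 2 * Real.pi * k * Complex.I := fun k hk h => hP k hk (by
    rw [← h, hbdef]
    linear_combination hs / 4)
  have hsum : a + b = P 0 0 + P 1 1 := by
    have : (P.trace : ℂ) = P 0 0 + P 1 1 := by
      rw [Matrix.trace_fin_two]; push_cast; rfl
    rw [hadef, hbdef, ← this]
    ring
  have hprod : a * b = P 0 0 * P 1 1 - P 0 1 * P 1 0 := by
    have : (P.det : ℂ) = P 0 0 * P 1 1 - P 0 1 * P 1 0 := by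
      rw [Matrix.det_fin_two]; push_cast; rfl
    rw [hadef, hbdef, ← this]
    linear_combination -hs / 4
  -- the components of `(P - b) y` solve the scalar equation with coefficient `a`, by the
  -- Cayley-Hamilton theorem, so that `y` solves the equation with coefficient `b`
  have hv : ∀ (i : Fin 2) (t : ℝ), P i 0 * u 0 t + P i 1 * u 1 t - b * u i t = 0 := fun i t => by
    refine eq_zero_of_hasDerivAt_mul (w := fun t => P i 0 * u 0 t + P i 1 * u 1 t - b * u i t)
      (a := a) (fun t => ?_) ?_ ?_ ha t
    · refine ((((hu 0 t).const_mul (P i 0 : ℂ)).add ((hu 1 t).const_mul (P i 1 : ℂ))).sub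
        ((hu i t).const_mul b)).congr_deriv ?_
      symm
      fin_cases i
      · change a * (P 0 0 * u 0 t + P 0 1 * u 1 t - b * u 0 t) =
          P 0 0 * (P 0 0 * u 0 t + P 0 1 * u 1 t) + P 0 1 * (P 1 0 * u 0 t + P 1 1 * u 1 t)
            - b * (P 0 0 * u 0 t + P 0 1 * u 1 t)
        linear_combination (P 0 0 * u 0 t + P 0 1 * u 1 t) * hsum - u 0 t * hprod
      · change a * (P 1 0 * u 0 t + P 1 1 * u 1 t - b * u 1 t) =
          P 1 0 * (P 0 0 * u 0 t + P 0 1 * u 1 t) + P 1 1 * (P 1 0 * u 0 t + P 1 1 * u 1 t)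
            - b * (P 1 0 * u 0 t + P 1 1 * u 1 t)
        linear_combination (P 1 0 * u 0 t + P 1 1 * u 1 t) * hsum - u 1 t * hprod
    · simp only [hper]
    · have hi : ∀ (c : ℂ) j, IntervalIntegrable (fun s => c * u j s) volume 0 1 := fun c j =>
        (continuous_const.mul (huc j)).intervalIntegrable _ _
      rw [intervalIntegral.integral_sub ((hi _ _).add (hi _ _)) (hi _ _),
        intervalIntegral.integral_add (hi _ _) (hi _ _)]
      simp [hint]
  have hu0 : ∀ (i : Fin 2) (t : ℝ), u i t = 0 := fun i t =>
    eq_zero_of_hasDerivAt_mul (a := b)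
      (fun t => by have := hu i t; rwa [sub_eq_zero.1 (hv i t)] at this) (hper i) (hint i) hb t
  refine C1.ext_incl ?_
  ext t i
  obtain ⟨t, rfl⟩ := QuotientAddGroup.mk_surjective t
  exact Complex.ofReal_eq_zero.1 (hu0 i t)

theorem IsAdmissibleMatrix.charpoly_ne_zero {Θ : Matrix (Fin 2) (Fin 2) ℝ}
    (hΘ : IsAdmissibleMatrix Θ) (k : ℤ) :
    (2 * Real.pi * k * Complex.I : ℂ) ^ 2 - Θ.trace * (2 * Real.pi * k * Complex.I) + Θ.det
      ≠ 0 := by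
  have hk := hΘ k
  revert hk
  generalize (2 * Real.pi * k * Complex.I : ℂ) = z
  intro hk h
  refine hk ?_
  rw [spectrum.mem_iff, Matrix.isUnit_iff_isUnit_det, isUnit_iff_ne_zero, not_not]
  rw [Matrix.trace_fin_two, Matrix.det_fin_two] at h
  push_cast at h
  rw [Matrix.det_fin_two]
  simp [Matrix.algebraMap_matrix_apply]
  linear_combination h

theorem IsAdmissibleMatrix.det_ne_zero {Θ : Matrix (Fin 2) (Fin 2) ℝ}
    (hΘ : IsAdmissibleMatrix Θ) : Θ.det ≠ 0 := by
  have := hΘ.charpoly_ne_zero 0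
  simpa using this

/-- A real `2 × 2` matrix of non-zero trace has no non-zero eigenvalue on the imaginary axis. -/
theorem charpoly_ne_zero_of_trace_ne_zero {P : Matrix (Fin 2) (Fin 2) ℝ} (hP : P.trace ≠ 0)
    {k : ℤ} (hk : k ≠ 0) :
    (2 * Real.pi * k * Complex.I : ℂ) ^ 2 - P.trace * (2 * Real.pi * k * Complex.I) + P.det
      ≠ 0 := by
  intro h
  have him := congrArg Complex.im h
  have hcast : (2 * Real.pi * k * Complex.I : ℂ) = ((2 * Real.pi * k : ℝ) : ℂ) * Complex.I := by
    push_cast; ring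
  rw [hcast] at him
  simp [pow_two, hP, Real.pi_ne_zero, hk] at him

theorem matrixMul_constC0 (P : Matrix (Fin 2) (Fin 2) ℝ) (c : Plane) :
    matrixMul P (constC0 c) = constC0 (Matrix.toEuclideanCLM (𝕜 := ℝ) P c) := rfl

theorem mean_matrixMul (P : Matrix (Fin 2) (Fin 2) ℝ) (f : C0) :
    mean (matrixMul P f) = Matrix.toEuclideanCLM (𝕜 := ℝ) P (mean f) :=
  (Matrix.toEuclideanCLM (𝕜 := ℝ) P).intervalIntegral_comp_comm
    ((continuous_coe_loop f).intervalIntegrable 0 1)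

theorem det_toEuclideanCLM (P : Matrix (Fin 2) (Fin 2) ℝ) :
    LinearMap.det (Matrix.toEuclideanCLM (𝕜 := ℝ) P : Plane →ₗ[ℝ] Plane) = P.det := by
  rw [Matrix.coe_toEuclideanCLM_eq_toEuclideanLin]
  exact LinearMap.det_toLpLin 2 P

theorem toEuclideanCLM_injective {P : Matrix (Fin 2) (Fin 2) ℝ} (hP : P.det ≠ 0) :
    Function.Injective (Matrix.toEuclideanCLM (𝕜 := ℝ) P) := by
  rw [← det_toEuclideanCLM] at hP
  exact (LinearMap.equivOfDetNeZero _ hP).injective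

/-- The operator `d/dt - Θ` acting on the mean value of a loop, combined with `d/dt - P` acting
on the part of mean zero, composed with the reference parametrix. -/
def splitModel (Θ : Matrix (Fin 2) (Fin 2) ℝ) (P : C0 →L[ℝ] C0) : C1 →L[ℝ] C1 :=
  (stdParametrix : C0 →L[ℝ] C1).comp
    (ddt - ((matrixMul Θ).comp meanLoop + P.comp (incl - meanLoop)))

theorem splitModel_apply (Θ : Matrix (Fin 2) (Fin 2) ℝ) (P : C0 →L[ℝ] C0) (v : C1) :
    splitModel Θ P v =
      stdParametrix (ddt v - (matrixMul Θ (meanLoop v) + P (incl v - meanLoop v))) := rfl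

theorem isCompactOperator_splitModel_sub_one (Θ : Matrix (Fin 2) (Fin 2) ℝ) (P : C0 →L[ℝ] C0) :
    IsCompactOperator (splitModel Θ P - 1 : C1 →L[ℝ] C1) := by
  have h := isCompactOperator_stdParametrix_ddt.sub (isCompactOperator_clm_comp_incl
    ((stdParametrix : C0 →L[ℝ] C1).comp
      ((matrixMul Θ).comp (constC0.comp mean) + P.comp (1 - constC0.comp mean))))
  refine (congrArg IsCompactOperator (funext fun v => ?_)).mpr h
  change stdParametrix (ddt v - (matrixMul Θ (meanLoop v) + P (incl v - meanLoop v))) - v =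
    stdParametrix (ddt v) - v
      - stdParametrix (matrixMul Θ (meanLoop v) + P (incl v - meanLoop v))
  rw [map_sub]
  abel

theorem splitModel_injective {Θ P : Matrix (Fin 2) (Fin 2) ℝ} (hΘ : Θ.det ≠ 0)
    (hP : ∀ k : ℤ, k ≠ 0 → (2 * Real.pi * k * Complex.I : ℂ) ^ 2
      - P.trace * (2 * Real.pi * k * Complex.I) + P.det ≠ 0) :
    Function.Injective (splitModel Θ (matrixMul P)) := by
  rw [injective_iff_map_eq_zero]
  intro v hv
  rw [splitModel_apply, EmbeddingLike.map_eq_zero_iff] at hv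
  have hm : mean (incl v) = 0 := by
    have := congrArg mean hv
    rw [map_sub, map_add, mean_ddt, mean_matrixMul, mean_matrixMul, map_sub, meanLoop_apply,
      mean_constC0, sub_self, map_zero, map_zero, add_zero, zero_sub, neg_eq_zero] at this
    exact toEuclideanCLM_injective hΘ (by rw [this, map_zero])
  rw [meanLoop_apply, hm, map_zero, map_zero, zero_add, sub_zero, sub_eq_zero] at hv
  exact eq_zero_of_ddt_eq_matrixMul hP hm hv

theorem splitModel_matrixMul (Θ : Matrix (Fin 2) (Fin 2) ℝ) :
    splitModel Θ (matrixMul Θ) = linearModel stdParametrix Θ := by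
  ext1 v
  change stdParametrix (ddt v - (matrixMul Θ (meanLoop v) + matrixMul Θ (incl v - meanLoop v))) =
    stdParametrix (ddt v - matrixMul Θ (incl v))
  rw [map_sub (matrixMul Θ), add_sub_cancel]

theorem splitModel_zero_sub (Θ : Matrix (Fin 2) (Fin 2) ℝ) (v : C1) :
    splitModel Θ 0 v - v =
      constC1 (-(mean (incl v) + Matrix.toEuclideanCLM (𝕜 := ℝ) Θ (mean (incl v)))) := by
  have h : splitModel Θ 0 v = stdParametrix (ddtAddMean v) - stdParametrix (constC0
      (mean (incl v) + Matrix.toEuclideanCLM (𝕜 := ℝ) Θ (mean (incl v)))) := by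
    rw [splitModel_apply, ← map_sub, ddtAddMean_apply, map_add, ← matrixMul_constC0,
      ← meanLoop_apply, _root_.zero_apply]
    congr 1
    abel
  rw [h, stdParametrix_ddtAddMean, stdParametrix_constC0, map_neg]
  abel

theorem constC1_injective : Function.Injective constC1 := fun c d h => by
  have := congrArg (fun v => mean (incl v)) h
  simpa using this

theorem splitModel_zero_constC1 (Θ : Matrix (Fin 2) (Fin 2) ℝ) (c : Plane) :
    splitModel Θ 0 (constC1 c) = constC1 (-(Matrix.toEuclideanCLM (𝕜 := ℝ) Θ c)) := by
  have h := splitModel_zero_sub Θ (constC1 c)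
  rw [sub_eq_iff_eq_add, incl_constC1, mean_constC0, ← map_add] at h
  rw [h]
  congr 1
  abel

/-- On the constant loops, `splitModel Θ 0` acts as `-Θ`, and it differs from the identity by an
operator with values in the constant loops. -/
theorem neg_one_pow_morseIndex_splitModel_zero {Θ : Matrix (Fin 2) (Fin 2) ℝ}
    (hinj : Function.Injective (splitModel Θ 0)) :
    (-1 : ℤ) ^ morseIndex (splitModel Θ 0) = ((SignType.sign Θ.det : SignType) : ℤ) := by
  let N : Submodule ℝ C1 := LinearMap.range (constC1 : Plane →ₗ[ℝ] C1)
  have hN : ∀ v ∈ N, splitModel Θ 0 v ∈ N := by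
    rintro _ ⟨c, rfl⟩
    exact ⟨_, (splitModel_zero_constC1 Θ c).symm⟩
  rw [neg_one_pow_morseIndex_of_finiteDim hinj N
    (fun v => ⟨_, (splitModel_zero_sub Θ v).symm⟩) hN]
  let e : Plane ≃ₗ[ℝ] N := LinearEquiv.ofInjective (constC1 : Plane →ₗ[ℝ] C1) constC1_injective
  have he : ((splitModel Θ 0 : C1 →L[ℝ] C1) : C1 →ₗ[ℝ] C1).restrict hN =
      (e : Plane →ₗ[ℝ] N) ∘ₗ (-(Matrix.toEuclideanCLM (𝕜 := ℝ) Θ : Plane →ₗ[ℝ] Plane)) ∘ₗ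
        (e.symm : N →ₗ[ℝ] Plane) := by
    refine LinearMap.ext fun v => ?_
    obtain ⟨c, rfl⟩ := e.surjective v
    refine Subtype.ext ?_
    change splitModel Θ 0 (constC1 c) =
      constC1 (-(Matrix.toEuclideanCLM (𝕜 := ℝ) Θ (e.symm (e c))))
    rw [e.symm_apply_apply, splitModel_zero_constC1]
  rw [he, LinearMap.det_conj]
  have : LinearMap.det (-(Matrix.toEuclideanCLM (𝕜 := ℝ) Θ : Plane →ₗ[ℝ] Plane)) = Θ.det := by
    rw [← neg_one_smul ℝ, LinearMap.det_smul, finrank_euclideanSpace_fin, det_toEuclideanCLM]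
    norm_num
  rw [this]

/-- The parity of the Morse index of `J (d/dt - Θ)` is the sign of `det Θ`: on the loops of mean
zero, `Θ` is deformed to `0` through matrices of non-zero trace, which therefore have no non-zero
eigenvalue in `2πi ℤ`. -/
theorem neg_one_pow_morseIndex_linearModel_stdParametrix {Θ : Matrix (Fin 2) (Fin 2) ℝ}
    (hΘ : IsAdmissibleMatrix Θ) :
    (-1 : ℤ) ^ morseIndex (linearModel stdParametrix Θ) =
      ((SignType.sign Θ.det : SignType) : ℤ) := by
  -- the sign of `e` is that of the trace, so that adding multiples of `e` to `Θ` cannot cancel it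
  obtain ⟨e, he⟩ : ∃ e : ℝ, ∀ s : ℝ, 0 < s → Θ.trace + 2 * (s * e) ≠ 0 := by
    rcases le_total 0 Θ.trace with h | h
    · exact ⟨1, fun s hs => by linarith [mul_one s] |> ne_of_gt⟩
    · exact ⟨-1, fun s hs => by linarith [mul_one s] |> ne_of_lt⟩
  let P : ℝ → Matrix (Fin 2) (Fin 2) ℝ := fun s => (1 - s) • (Θ + (s * e) • 1)
  have hmul : ∀ s, matrixMul (P s) = (1 - s) • (matrixMul Θ + (s * e) • 1) := fun s => by
    ext f t i
    rw [matrixMul_apply]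
    change _ = (1 - s) * (matrixMul Θ f t i + s * e * f t i)
    rw [matrixMul_apply]
    fin_cases i <;> simp [P] <;> ring
  have htr : ∀ s, (P s).trace = (1 - s) * (Θ.trace + 2 * (s * e)) := fun s => by
    simp only [P, Matrix.trace_smul, Matrix.trace_add, Matrix.trace_one, Fintype.card_fin,
      smul_eq_mul]
    push_cast
    ring
  have hP : ∀ s ∈ Icc (0 : ℝ) 1, ∀ k : ℤ, k ≠ 0 → (2 * Real.pi * k * Complex.I : ℂ) ^ 2
      - (P s).trace * (2 * Real.pi * k * Complex.I) + (P s).det ≠ 0 := by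
    intro s hs k hk
    rcases hs.1.eq_or_lt with rfl | h0
    · have : P 0 = Θ := by simp [P]
      rw [this]
      exact hΘ.charpoly_ne_zero k
    rcases hs.2.eq_or_lt with rfl | h1
    · have : P 1 = 0 := by simp [P]
      rw [this]
      simp [hk, Real.pi_ne_zero]
    · refine charpoly_ne_zero_of_trace_ne_zero ?_ hk
      rw [htr]
      exact mul_ne_zero (by linarith) (he s h0)
  let T : ℝ → C1 →L[ℝ] C1 := fun s => splitModel Θ ((1 - s) • (matrixMul Θ + (s * e) • 1))
  have hTinj : ∀ s ∈ Icc (0 : ℝ) 1, Function.Injective (T s) := fun s hs => by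
    have := splitModel_injective (P := P s) hΘ.det_ne_zero (hP s hs)
    rwa [hmul] at this
  have hTc : Continuous T := by
    simp only [T, splitModel]
    fun_prop
  have h := neg_one_pow_morseIndex_path hTc
    (fun s _ => isCompactOperator_splitModel_sub_one Θ _) hTinj
  have h0 : T 0 = linearModel stdParametrix Θ := by
    rw [← splitModel_matrixMul]
    simp [T]
  have h1 : T 1 = splitModel Θ 0 := by simp [T]
  rw [h0, h1] at h
  rw [h]
  exact neg_one_pow_morseIndex_splitModel_zero (h1 ▸ hTinj 1 (by simp))

theorem linearModel_stdParametrix_injective {Θ : Matrix (Fin 2) (Fin 2) ℝ}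
    (hΘ : IsAdmissibleMatrix Θ) : Function.Injective (linearModel stdParametrix Θ) := by
  rw [← splitModel_matrixMul]
  exact splitModel_injective hΘ.det_ne_zero fun k _ => hΘ.charpoly_ne_zero k

end LinearModel

/-! ### The index of an isolated closed integral curve -/

section Index

variable {U : Set Plane} {X : Plane → UnitAddCircle → Plane} {x : C1} {ε : ℝ}
  {M : C0 ≃L[ℝ] C1} {Θ : Matrix (Fin 2) (Fin 2) ℝ}

theorem IsNondegenerate.isIsolated (h : IsNondegenerate X x) : IsIsolated U X x := by
  obtain ⟨A, hA⟩ := h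
  have hdiff : DifferentiableAt ℝ (defect X) x := by
    -- otherwise the junk value `0` of `fderiv` would be an isomorphism of non-trivial spaces
    by_contra hnd
    rw [fderiv_zero_of_not_differentiableAt hnd] at hA
    have h0 : ∀ v, A v = 0 := fun v => DFunLike.congr_fun hA v
    obtain ⟨c, hc⟩ := exists_ne (0 : Plane)
    refine hc (constC1_injective ?_)
    rw [map_zero]
    exact A.injective (by rw [h0, h0])
  have hev := hdiff.hasFDerivAt.eventually_ne (c := 0) (by rw [← hA]; exact ⟨_, A.antilipschitz⟩)
  rw [eventually_nhdsWithin_iff, Metric.eventually_nhds_iff_ball] at hev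
  obtain ⟨r, hr, hball⟩ := hev
  exact ⟨r, hr, fun y hy hyc => by_contra fun hne => hball y hy hne hyc.2⟩

theorem IsIsolated.exists_isIsolatingRadius (hU : IsOpen U) (hx : StaysIn U x)
    (h : IsIsolated U X x) : ∃ ε, IsIsolatingRadius U X x ε := by
  obtain ⟨r, hr, hiso⟩ := h
  obtain ⟨δ, hδ, hsub⟩ := (isCompact_range (incl x).continuous).exists_cthickening_subset_open hU
    (by rintro _ ⟨t, rfl⟩; exact hx t)
  refine ⟨min δ (r / 2), lt_min hδ (half_pos hr), fun y hy => ?_⟩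
  have hy' : ‖y - x‖ ≤ min δ (r / 2) := by rwa [mem_closedBall, dist_eq_norm] at hy
  have hyU : StaysIn U y := fun t => by
    refine hsub (closedBall_subset_cthickening (mem_range_self t) δ ?_)
    rw [mem_closedBall, dist_eq_norm]
    calc ‖incl y t - incl x t‖ = ‖incl (y - x) t‖ := by rw [map_sub]; rfl
      _ ≤ ‖y - x‖ := ((incl (y - x)).norm_coe_le_norm t).trans (norm_incl_le _)
      _ ≤ δ := hy'.trans (min_le_left _ _)
  refine ⟨hyU, fun h0 => hiso y ?_ ⟨hyU, h0⟩⟩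
  rw [mem_ball, dist_eq_norm]
  linarith [min_le_right δ (r / 2)]

theorem isAdmissibleMatrix_one : IsAdmissibleMatrix 1 := by
  intro k hk
  rw [Matrix.map_one _ (map_zero _) (map_one _), spectrum.one_eq, mem_singleton_iff] at hk
  simpa using congrArg Complex.re hk

theorem IsIsolatingRadius.isLSAdmissible (hr : IsIsolatingRadius U X x ε)
    (hM : IsIdAddCompactOn (parametrixMap X M) (closedBall x ε)) :
    IsLSAdmissible (parametrixMap X M) (ball x ε) 0 := by
  refine ⟨isOpen_ball, isBounded_ball, hM.mono closure_ball_subset_closedBall, fun w hw h0 => ?_⟩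
  have hws : w ∈ sphere x ε := frontier_ball_subset_sphere hw
  have hwx : w = x := (hr.2 w (sphere_subset_closedBall hws)).2 (M.map_eq_zero_iff.1 h0)
  rw [hwx, mem_sphere, dist_self] at hws
  exact hr.1.ne hws

theorem IsIsolatingRadius.isLSAdmissible_stdParametrix (hX : IsSmoothField U X) (hU : IsOpen U)
    (hr : IsIsolatingRadius U X x ε) :
    IsLSAdmissible (parametrixMap X stdParametrix) (ball x ε) 0 :=
  hr.isLSAdmissible (isIdAddCompactOn_parametrixMap hX hU (fun y hy => (hr.2 y hy).1)
    isCompactOperator_stdParametrix_ddt)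

theorem IsAdmissibleChoice.isCompactOperator (hX : IsSmoothField U X) (hU : IsOpen U)
    (h : IsAdmissibleChoice U X x M Θ ε) :
    IsCompactOperator ((M : C0 →L[ℝ] C1).comp ddt - 1 : C1 →L[ℝ] C1) :=
  isCompactOperator_parametrix_ddt hX hU h.radius.1 (fun y hy => (h.radius.2 y hy).1) h.parametrix

/-- All signs cancel against those of the reference parametrix `J`: the change of parametrix `S`
contributes `(-1) ^ β (S)` both to the Morse index of `M (d/dt - Θ) = S J (d/dt - Θ)` and to the
degree of `Φ_M = S Φ_J`, and the remaining parity of `J (d/dt - Θ)` is the sign of `det Θ`. -/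
theorem IsAdmissibleChoice.index_eq (hX : IsSmoothField U X) (hU : IsOpen U)
    (h : IsAdmissibleChoice U X x M Θ ε) :
    index X x M Θ ε = -lsDegree (parametrixMap X stdParametrix) (ball x ε) 0 := by
  have hM := h.isCompactOperator hX hU
  have hS := isCompactOperator_changeParametrix_sub_one hM
  have hdeg : lsDegree (parametrixMap X M) (ball x ε) 0 =
      (-1) ^ morseIndex (changeParametrix M) *
        lsDegree (parametrixMap X stdParametrix) (ball x ε) 0 := by
    rw [← lsDegree_linear_comp (h.radius.isLSAdmissible_stdParametrix hX hU) hS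
      (changeParametrix_injective M)]
    exact congrArg (fun Φ => lsDegree Φ (ball x ε) 0) (funext (parametrixMap_eq M))
  have hβ := neg_one_pow_morseIndex_mul hS
    (isCompactOperator_linearModel_sub_one isCompactOperator_stdParametrix_ddt Θ)
    (changeParametrix_injective M) (linearModel_stdParametrix_injective h.matrix)
  rw [← linearModel_eq_mul, neg_one_pow_morseIndex_linearModel_stdParametrix h.matrix] at hβ
  have hsq : ((SignType.sign Θ.det : SignType) : ℤ) *
      ((SignType.sign Θ.det : SignType) : ℤ) = 1 := by
    rcases h.matrix.det_ne_zero.lt_or_gt with hd | hd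
    · simp [sign_neg hd]
    · simp [sign_pos hd]
  have hpow : ((-1 : ℤ) ^ morseIndex (changeParametrix M)) *
      (-1) ^ morseIndex (changeParametrix M) = 1 := by
    rw [← mul_pow]; simp
  rw [index, hdeg, hβ]
  linear_combination (-lsDegree (parametrixMap X stdParametrix) (ball x ε) 0) *
    (hsq + ((SignType.sign Θ.det : SignType) : ℤ) * ((SignType.sign Θ.det : SignType) : ℤ) *
      hpow)

/-- The degree on an isolating ball does not depend on the radius, by excision. -/
theorem lsDegree_ball_eq_of_le (hX : IsSmoothField U X) (hU : IsOpen U) {δ : ℝ}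
    (hδ : 0 < δ) (hr : IsIsolatingRadius U X x ε) (hle : δ ≤ ε) :
    lsDegree (parametrixMap X stdParametrix) (ball x ε) 0 =
      lsDegree (parametrixMap X stdParametrix) (ball x δ) 0 := by
  refine lsDegree_excision (hr.isLSAdmissible_stdParametrix hX hU) isOpen_ball
    (ball_subset_ball hle) fun w hw h0 => hw.2 ?_
  have hwx : w = x := (hr.2 w (closure_ball_subset_closedBall hw.1)).2
    (stdParametrix.map_eq_zero_iff.1 h0)
  rw [hwx]
  exact mem_ball_self hδ

end Index

end CurveIndex

end

theorem mainTheorem5 (U : Set CurveIndex.Plane) (hU : IsOpen U)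
    (X : CurveIndex.Plane → UnitAddCircle → CurveIndex.Plane)
    (hX : CurveIndex.IsSmoothField U X)
    (x : CurveIndex.C1) (hx : CurveIndex.IsClosedIntegralCurve U X x) :
    (CurveIndex.IsNondegenerate X x → CurveIndex.IsIsolated U X x) ∧
    (CurveIndex.IsIsolated U X x →
      (∀ (M : CurveIndex.C0 ≃L[ℝ] CurveIndex.C1) (Θ : Matrix (Fin 2) (Fin 2) ℝ) (ε : ℝ),
        CurveIndex.IsAdmissibleChoice U X x M Θ ε →
          CurveIndex.IsLSAdmissible (CurveIndex.parametrixMap X M) (Metric.ball x ε) 0 ∧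
          CurveIndex.HasFiniteMorseIndex (V := CurveIndex.C1)
            (CurveIndex.linearModel M Θ)) ∧
      ∃! i : ℤ,
        ∀ (M : CurveIndex.C0 ≃L[ℝ] CurveIndex.C1) (Θ : Matrix (Fin 2) (Fin 2) ℝ) (ε : ℝ),
          CurveIndex.IsAdmissibleChoice U X x M Θ ε → CurveIndex.index X x M Θ ε = i) := by
  refine ⟨fun h => h.isIsolated, fun hiso => ⟨fun M Θ ε h => ⟨h.radius.isLSAdmissible h.parametrix,
    CurveIndex.hasFiniteMorseIndex_of_isCompactOperator
      (CurveIndex.isCompactOperator_linearModel_sub_one (h.isCompactOperator hX hU) Θ)⟩, ?_⟩⟩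
  obtain ⟨δ, hδ⟩ := hiso.exists_isIsolatingRadius hU hx.1
  -- the reference parametrix and the identity matrix form an admissible choice
  have hadm : CurveIndex.IsAdmissibleChoice U X x CurveIndex.stdParametrix 1 δ :=
    ⟨hδ, CurveIndex.isIdAddCompactOn_parametrixMap hX hU (fun y hy => (hδ.2 y hy).1)
      CurveIndex.isCompactOperator_stdParametrix_ddt, CurveIndex.isAdmissibleMatrix_one⟩
  refine ⟨CurveIndex.index X x CurveIndex.stdParametrix 1 δ, fun M Θ ε h => ?_,
    fun i hi => (hi _ _ _ hadm).symm⟩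
  rw [h.index_eq hX hU, hadm.index_eq hX hU]
  rcases le_total δ ε with hle | hle
  · rw [CurveIndex.lsDegree_ball_eq_of_le hX hU hδ.1 h.radius hle]
  · rw [CurveIndex.lsDegree_ball_eq_of_le hX hU h.radius.1 hδ hle]
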